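/- Let $d\ge 1$ be an integer and let $s,\beta>0$ be real. For $N\in\mathbb N$ let $G(N)$ be the random simple graph with node set $\{0,1,\dots,N\}^d$ in which distinct nodes $x,y$ are joined, independently for different unordered pairs, with probability $1$ if $\|x-y\|=1$ and with probability $1-\exp(-\beta/\|x-y\|^s)$ otherwise, where $\|x-y\|=\sum_{i=1}^d|x_i-y_i|$. Let $D(N)$ be the diameter of $G(N)$, i.e. the largest graph distance between two nodes ($G(N)$ is connected with probability $1$). Then there exist constants $C_1,C_2,C_s>0$, $\delta>1$ and $0<\eta_1<\eta_2<1$, depending only on $d$, $s$ and $\beta$, such that the following hold. 1. If $s>2d$, then $\lim_{N\to\infty}\mathrm{Prob}\{D(N)\ge N^{\psi}\}=1$ for every real $\psi<\frac{s-2d}{s-d-1}$. 2. If $s=2d$, then $\lim_{N\to\infty}\mathrm{Prob}\{D(N)\le N^{\eta_2}\}=1$; and if $d=1$, $s=2$ and $\beta<1$, then $\lim_{N\to\infty}\mathrm{Prob}\{D(N)\ge N^{\eta_1}\}=1$. 3. If $d<s<2d$, then $\lim_{N\to\infty}\mathrm{Prob}\{C_s\log N\le D(N)\le (\log N)^{\delta}\}=1$.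 4. If $s=d$, then $\lim_{N\to\infty}\mathrm{Prob}\left\{\frac{C_1\log N}{\log\log N}\le D(N)\le\frac{C_2\log N}{\log\log N}\right\}=1$. Here $\log$ is the natural logarithm. -/

import Mathlib

open MeasureTheory ProbabilityTheory Filter Topology

namespace LongRangePercolation

/-- The node set `{0, 1, …, N}^d`. -/
abbrev Node (d N : ℕ) : Type := Fin d → Fin (N + 1)

/-- The `L₁` distance `‖x - y‖ = ∑ i, |x i - y i|` of two nodes. -/
def l1dist {d N : ℕ} (x y : Node d N) : ℕ :=
  ∑ i, ((x i : ℤ) - (y i : ℤ)).natAbs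

lemma l1dist_comm {d N : ℕ} (x y : Node d N) : l1dist x y = l1dist y x := by
  unfold l1dist
  refine Finset.sum_congr rfl fun i _ => ?_
  rw [← Int.natAbs_neg, neg_sub]

/-- The probability that two nodes at `L₁` distance `k` are joined:
`1` if `k = 1` and `1 - exp (-β / k ^ s)` otherwise. (The value at `k = 0` is irrelevant, since the
graph has no loops. The outer projection onto `[0, 1]` does nothing for `β ≥ 0`, when the number
already lies there.) -/
noncomputable def connectProb (s β : ℝ) (k : ℕ) : unitInterval :=
  if k = 1 then 1
  else Set.projIcc 0 1 zero_le_one (1 - Real.exp (-(β / (k : ℝ) ^ s)))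

/-- The connection probability of an unordered pair of nodes. -/
noncomputable def edgeProb (d N : ℕ) (s β : ℝ) : Sym2 (Node d N) → unitInterval :=
  Sym2.lift ⟨fun x y => connectProb s β (l1dist x y), fun x y => by
    simp only [l1dist_comm x y]⟩

/-- A configuration declares every unordered pair of nodes to be open (`true`) or closed. -/
abbrev Config (d N : ℕ) : Type := Sym2 (Node d N) → Bool

/-- The law of the configuration: the pairs are open independently of each other, the pair `e` with
probability `edgeProb d N s β e`. -/
noncomputable def configLaw (d N : ℕ) (s β : ℝ) : Measure (Config d N) :=
  Measure.pi fun e => bernoulliMeasure true false (edgeProb d N s β e)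

/-- The graph `G(N)`: two distinct nodes are adjacent when the pair they form is open. -/
def graph {d N : ℕ} (ω : Config d N) : SimpleGraph (Node d N) :=
  SimpleGraph.fromEdgeSet {e | ω e = true}

/-- The random diameter `D(N)` of `G(N)`, the greatest graph distance of two nodes. (`G(N)` is
connected with probability one, as nodes at distance `1` are joined with probability one.) -/
noncomputable def D {d N : ℕ} (ω : Config d N) : ℕ :=
  (graph ω).diam

end LongRangePercolation

namespace LongRangePercolation

/-! ### The law of the configuration -/

section Law

variable {d N : ℕ} {s β : ℝ}

/-! The probability space is a finite product, so independence is used in one form throughout: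
functions that depend (`DependsOn`) on disjoint sets of pairs are uncorrelated. Unit edges are open
almost surely. It therefore suffices to show for each bound that its failure, intersected with
`gridOpen`, has probability tending to zero. Each regime has its own mechanism.

Lower bounds for s ≥ d. If M bounds the expected degrees, the expected number of endpoints of open
self-avoiding paths with j steps from the origin is at most M ^ j. When D ≤ n, paths with at most n
steps reach all (N + 1) ^ d nodes, so Markov's inequality (`real_D_le_le`) makes this unlikely
unless M ^ n is about N. Here M is a constant for s > d, and for s = d it is O(log N), bounded by
(log N) ^ 2.

Lower bound for s > 2d. A geodesic between opposite corners covers distance at least N. Its edges of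
length at most l cover at most l D, and the remaining edges have small expected total length
(`mul_le_mul_D_add`, `integral_longLength_le`). The choice l = N ^ (1 - ψ) / 2 gives the exponent.

Lower bound for d = 1, s = 2, β < 1. Every cut edge between the end nodes must be crossed. The edge
(i, i + 1) is a cut edge with probability at least of order i ^ (-β). A weighted count of cut edges
has mean of order log N and variance O(log N) (`exists_variance_cutSum_le`), so Chebyshev's
inequality shows that there are at least N ^ ((1 - β) / 2) of them.

Upper bound for d < s < 2d. Choose γ < 1 with 2dγ > s. Two subcubes of side L ^ γ in a cube of side
L span L ^ (2dγ) pairs, each open with probability at least of order L ^ (-s), so they are very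
likely joined. Distances thus satisfy g(L) = 2 g(L ^ γ) + 1, which has a polylogarithmic solution
(`dist_le_of_goodScale`).

Upper bound for s = 2d. The probability that the two end cubes of a row of k cubes are joined is
bounded below uniformly in their side L. Such a shortcut replaces the cost of k cubes by the cost of
2d axis-parallel segments. With k = 2d + 1 the expected distance T(L) along a line obeys T(kL) ≤ a
T(L) + k with a < k (`AxisBound.step`), so T(L) = O(L ^ ρ) with ρ < 1. Exponential moments of sums
over disjoint cubes (`real_rowSum_ge_le`) turn this expectation into a bound for all lines
simultaneously.

Upper bound for s = d. The grid is divided into blocks of a large constant side. With high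
probability every set of at most M blocks reaches at least K times as many blocks, with K of order
log N (`real_not_expands_le`). Hence after O(log N / log log N) steps the explorations from any two
nodes each contain M blocks, where M ^ 2 is at least of order N ^ d (log N) ^ 2. They then meet or
are joined directly (`real_oddClosed_le`). Exploration uses only pairs of even length and the final
connection only pairs of odd length, so the two are independent. -/

instance : IsProbabilityMeasure (configLaw d N s β) := by
  unfold configLaw; infer_instance

lemma integrable_config (f : Config d N → ℝ) : Integrable f (configLaw d N s β) :=
  Integrable.of_finite

lemma iIndepFun_eval : iIndepFun (fun e (ω : Config d N) => ω e) (configLaw d N s β) :=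
  iIndepFun_pi (X := fun _ ↦ id) (fun _ ↦ aemeasurable_id)

lemma DependsOn.exists_comp {γ : Type*} {f : Config d N → γ} {S : Finset (Sym2 (Node d N))}
    (hf : DependsOn f (S : Set (Sym2 (Node d N)))) :
    ∃ F : (S → Bool) → γ, ∀ ω, f ω = F (fun i => ω i) := by
  classical
  refine ⟨fun y => f fun i => if h : i ∈ S then y ⟨i, h⟩ else false, fun ω => hf fun i hi => ?_⟩
  have : i ∈ S := by simpa using hi
  simp [this]

/-- Functions of disjoint sets of pairs are uncorrelated. -/
lemma integral_mul_of_dependsOn {f g : Config d N → ℝ} {S T : Set (Sym2 (Node d N))}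
    (hf : DependsOn f S) (hg : DependsOn g T) (hST : Disjoint S T) :
    ∫ ω, f ω * g ω ∂configLaw d N s β =
      (∫ ω, f ω ∂configLaw d N s β) * ∫ ω, g ω ∂configLaw d N s β := by
  classical
  lift S to Finset (Sym2 (Node d N)) using S.toFinite
  lift T to Finset (Sym2 (Node d N)) using T.toFinite
  obtain ⟨F, hF⟩ := DependsOn.exists_comp hf
  obtain ⟨G, hG⟩ := DependsOn.exists_comp hg
  have h := (iIndepFun_eval (s := s) (β := β)).indepFun_finset S T (by exact_mod_cast hST)
    (fun i => measurable_of_finite _)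
  have h2 := h.comp (measurable_of_finite F) (measurable_of_finite G)
  have e1 : f = F ∘ (fun a (i : S) => a i) := by ext ω; simp [hF]
  have e2 : g = G ∘ (fun a (i : T) => a i) := by ext ω; simp [hG]
  rw [← e1, ← e2] at h2
  exact h2.integral_mul_eq_mul_integral (measurable_of_finite _).aestronglyMeasurable
    (measurable_of_finite _).aestronglyMeasurable

lemma DependsOn.prod {ι : Type*} {J : Finset ι} {f : ι → Config d N → ℝ}
    {S : ι → Set (Sym2 (Node d N))} (hf : ∀ j ∈ J, DependsOn (f j) (S j)) :
    DependsOn (fun ω => ∏ j ∈ J, f j ω) (⋃ j ∈ J, S j) := by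
  intro x y h
  refine Finset.prod_congr rfl fun j hj => hf j hj fun i hi => h i ?_
  simp only [Set.mem_iUnion]
  exact ⟨j, hj, hi⟩

lemma integral_prod_of_dependsOn {ι : Type*} (J : Finset ι) {f : ι → Config d N → ℝ}
    {S : ι → Set (Sym2 (Node d N))} (hf : ∀ j ∈ J, DependsOn (f j) (S j))
    (hS : (J : Set ι).PairwiseDisjoint S) :
    ∫ ω, ∏ j ∈ J, f j ω ∂configLaw d N s β = ∏ j ∈ J, ∫ ω, f j ω ∂configLaw d N s β := by
  classical
  induction J using Finset.induction_on with
  | empty => simp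
  | insert a J ha ih =>
    simp only [Finset.prod_insert ha]
    rw [integral_mul_of_dependsOn (hf a (by simp))
      (DependsOn.prod fun j hj => hf j (Finset.mem_insert_of_mem hj)), ih]
    · exact fun j hj => hf j (Finset.mem_insert_of_mem hj)
    · exact hS.subset (by simp)
    · rw [Set.disjoint_iUnion₂_right]
      intro j hj
      exact hS (by simp) (by simp [hj]) (by rintro rfl; exact ha hj)

/-- The probability that a pair is open. -/
lemma real_open (e : Sym2 (Node d N)) :
    (configLaw d N s β).real {ω | ω e = true} = edgeProb d N s β e := by
  have h := (measurePreserving_eval (fun e => bernoulliMeasure true false (edgeProb d N s β e)) e)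
  have h2 := h.measure_preimage (s := Set.singleton true) (measurableSet_singleton true).nullMeasurableSet
  rw [measureReal_def, configLaw]
  have : {ω : Config d N | ω e = true} = Function.eval e ⁻¹' (Set.singleton true) := by ext; exact Iff.rfl
  rw [this, h2, ← measureReal_def]
  exact
    bernoulliMeasure_real_apply_of_mem_of_notMem _ (measurableSet_singleton true) rfl
    (fun h => Bool.false_ne_true h)

lemma dependsOn_indicator {A : Set (Config d N)} {S : Set (Sym2 (Node d N))}
    (h : DependsOn (fun ω => ω ∈ A) S) : DependsOn (A.indicator (1 : Config d N → ℝ)) S := by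
  classical
  intro x y hxy
  have := h hxy
  simp only [Set.indicator_apply]
  simp only [eq_iff_iff] at this
  simp [this]

lemma integral_indicator_config (A : Set (Config d N)) :
    ∫ ω, A.indicator (1 : Config d N → ℝ) ω ∂configLaw d N s β = (configLaw d N s β).real A :=
  integral_indicator_one A.toFinite.measurableSet

/-- Events determined by disjoint sets of pairs are independent. -/
lemma real_inter_of_dependsOn {A B : Set (Config d N)} {S T : Set (Sym2 (Node d N))}
    (hA : DependsOn (fun ω => ω ∈ A) S) (hB : DependsOn (fun ω => ω ∈ B) T) (hST : Disjoint S T) :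
    (configLaw d N s β).real (A ∩ B) = (configLaw d N s β).real A * (configLaw d N s β).real B := by
  have h := integral_mul_of_dependsOn (s := s) (β := β) (dependsOn_indicator hA)
    (dependsOn_indicator hB) hST
  simp only [integral_indicator_config] at h
  rw [← h, ← integral_indicator_config]
  simp [Set.inter_indicator_one]

/-- Events determined by pairwise disjoint sets of pairs are independent. -/
lemma real_iInter_of_dependsOn {ι : Type*} (J : Finset ι) {A : ι → Set (Config d N)}
    {S : ι → Set (Sym2 (Node d N))} (hA : ∀ j ∈ J, DependsOn (fun ω => ω ∈ A j) (S j))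
    (hS : (J : Set ι).PairwiseDisjoint S) :
    (configLaw d N s β).real {ω | ∀ j ∈ J, ω ∈ A j} = ∏ j ∈ J, (configLaw d N s β).real (A j) := by
  classical
  have h := integral_prod_of_dependsOn (s := s) (β := β) J
    (fun j hj => dependsOn_indicator (hA j hj)) hS
  simp only [integral_indicator_config] at h
  rw [← h, ← integral_indicator_config]
  congr 1
  ext ω
  by_cases hω : ∀ j ∈ J, ω ∈ A j
  · rw [Set.indicator_of_mem (by exact hω)]
    simp only [Pi.one_apply]
    symm
    exact Finset.prod_eq_one fun j hj => by simp [hω j hj]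
  · rw [Set.indicator_of_notMem (by exact hω)]
    push Not at hω
    obtain ⟨j, hj, hj'⟩ := hω
    exact (Finset.prod_eq_zero hj (by simp [hj'])).symm

lemma real_closed (e : Sym2 (Node d N)) :
    (configLaw d N s β).real {ω | ω e = false} = 1 - edgeProb d N s β e := by
  have h := measureReal_compl (μ := configLaw d N s β) (s := {ω : Config d N | ω e = true})
    (Set.toFinite _).measurableSet
  rw [real_open] at h
  simp only [probReal_univ] at h
  rw [← h]
  congr 1
  ext; simp

lemma real_forall_open (E : Finset (Sym2 (Node d N))) :
    (configLaw d N s β).real {ω | ∀ e ∈ E, ω e = true} = ∏ e ∈ E, (edgeProb d N s β e : ℝ) := by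
  have := real_iInter_of_dependsOn (s := s) (β := β) E (A := fun e => {ω : Config d N | ω e = true})
    (S := fun e => {e}) (fun e _ x y h => by simp at h; simp [h])
    (fun a _ b _ hab => by simpa using hab)
  simpa [real_open] using this

lemma real_forall_closed (E : Finset (Sym2 (Node d N))) :
    (configLaw d N s β).real {ω | ∀ e ∈ E, ω e = false} =
      ∏ e ∈ E, (1 - (edgeProb d N s β e : ℝ)) := by
  have := real_iInter_of_dependsOn (s := s) (β := β) E (A := fun e => {ω : Config d N | ω e = false})
    (S := fun e => {e}) (fun e _ x y h => by simp at h; simp [h])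
    (fun a _ b _ hab => by simpa using hab)
  simpa [real_closed] using this

@[simp] lemma connectProb_one : connectProb s β 1 = 1 := by simp [connectProb]

lemma connectProb_of_ne_one (hβ : 0 ≤ β) {k : ℕ} (hk : k ≠ 1) :
    (connectProb s β k : ℝ) = 1 - Real.exp (-(β / (k : ℝ) ^ s)) := by
  have h0 : (0:ℝ) ≤ β / (k:ℝ)^s := by positivity
  have h : 1 - Real.exp (-(β / (k : ℝ) ^ s)) ∈ Set.Icc (0:ℝ) 1 := by
    constructor
    · rw [sub_nonneg, Real.exp_le_one_iff]; linarith
    · have := Real.exp_pos (-(β / (k : ℝ) ^ s)); linarith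
  rw [connectProb, if_neg hk, Set.projIcc_of_mem _ h]

/-- At k = 1 the left side vanishes, so the exponential form bounds the probability of being closed
for all pairs and unit edges need no separate treatment. Equality, needed for cut edges, holds only
away from k = 1. -/
lemma one_sub_connectProb_le (hβ : 0 ≤ β) (k : ℕ) :
    1 - (connectProb s β k : ℝ) ≤ Real.exp (-(β / (k : ℝ) ^ s)) := by
  by_cases hk : k = 1
  · subst hk; simp; positivity
  · rw [connectProb_of_ne_one hβ hk]; simp

lemma connectProb_le (hβ : 0 ≤ β) {k : ℕ} (hk : k ≠ 1) :
    (connectProb s β k : ℝ) ≤ β / (k : ℝ) ^ s := by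
  rw [connectProb_of_ne_one hβ hk]
  have := Real.add_one_le_exp (-(β / (k : ℝ) ^ s))
  linarith

lemma edgeProb_nonneg (e : Sym2 (Node d N)) : (0:ℝ) ≤ edgeProb d N s β e :=
  (edgeProb d N s β e).2.1

lemma edgeProb_le_one (e : Sym2 (Node d N)) : (edgeProb d N s β e : ℝ) ≤ 1 :=
  (edgeProb d N s β e).2.2

/-- The length of an unordered pair. -/
def len (e : Sym2 (Node d N)) : ℕ :=
  Sym2.lift ⟨fun x y => l1dist x y, fun x y => l1dist_comm x y⟩ e

@[simp] lemma len_mk (x y : Node d N) : len s(x, y) = l1dist x y := rfl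

lemma edgeProb_eq (e : Sym2 (Node d N)) : edgeProb d N s β e = connectProb s β (len e) := by
  induction e using Sym2.ind with
  | _ x y => rfl

lemma real_forall_closed_le (hβ : 0 ≤ β) (E : Finset (Sym2 (Node d N))) :
    (configLaw d N s β).real {ω | ∀ e ∈ E, ω e = false} ≤
      Real.exp (-∑ e ∈ E, β / (len e : ℝ) ^ s) := by
  rw [real_forall_closed, ← Finset.sum_neg_distrib, Real.exp_sum]
  refine Finset.prod_le_prod (fun e _ => sub_nonneg.2 (edgeProb_le_one e)) fun e _ => ?_
  rw [edgeProb_eq]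
  exact one_sub_connectProb_le hβ _

lemma real_forall_closed_eq (hβ : 0 ≤ β) (E : Finset (Sym2 (Node d N)))
    (hE : ∀ e ∈ E, len e ≠ 1) :
    (configLaw d N s β).real {ω | ∀ e ∈ E, ω e = false} =
      Real.exp (-∑ e ∈ E, β / (len e : ℝ) ^ s) := by
  rw [real_forall_closed, ← Finset.sum_neg_distrib, Real.exp_sum]
  refine Finset.prod_congr rfl fun e he => ?_
  rw [edgeProb_eq, connectProb_of_ne_one hβ (hE e he)]
  ring

/-- The pairs at distance one are all open, almost surely. -/
def gridOpen (d N : ℕ) : Set (Config d N) := {ω | ∀ e, len e = 1 → ω e = true}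

lemma real_gridOpen_compl : (configLaw d N s β).real (gridOpen d N)ᶜ = 0 := by
  classical
  have h : (configLaw d N s β).real (gridOpen d N) = 1 := by
    have := real_forall_open (s := s) (β := β)
      (Finset.univ.filter fun e : Sym2 (Node d N) => len e = 1)
    rw [Finset.prod_eq_one] at this
    · simpa [gridOpen] using this
    · intro e he
      rw [edgeProb_eq, (Finset.mem_filter.1 he).2]; simp
  rw [measureReal_compl (Set.toFinite _).measurableSet, h]; simp

/-- If the complements of good events have probability tending to zero, then events that almost
surely contain them have probability tending to one. -/
lemma tendsto_one_of_bad (A B : ∀ N : ℕ, Set (Config d N))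
    (hA : ∀ᶠ N in atTop, ∀ ω ∈ gridOpen d N, ω ∉ B N → ω ∈ A N)
    (hB : Tendsto (fun N => (configLaw d N s β).real (B N)) atTop (𝓝 0)) :
    Tendsto (fun N => configLaw d N s β (A N)) atTop (𝓝 1) := by
  have h1 : Tendsto (fun N => (configLaw d N s β).real (A N)) atTop (𝓝 1) := by
    have h2 : Tendsto (fun N => 1 - (configLaw d N s β).real (B N)) atTop (𝓝 1) := by
      simpa using hB.const_sub 1
    refine tendsto_of_tendsto_of_tendsto_of_le_of_le' h2 tendsto_const_nhds ?_
      (Eventually.of_forall fun N => measureReal_le_one)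
    filter_upwards [hA] with N hN
    have h3 : (A N)ᶜ ⊆ B N ∪ (gridOpen d N)ᶜ := by
      intro ω hω
      by_contra hc
      simp only [Set.mem_union, Set.mem_compl_iff, not_or, not_not] at hc
      exact hω (hN ω hc.2 hc.1)
    have h4 := (measureReal_mono (μ := configLaw d N s β) h3).trans (measureReal_union_le _ _)
    rw [real_gridOpen_compl, measureReal_compl (Set.toFinite _).measurableSet] at h4
    simp only [probReal_univ] at h4
    linarith
  have h5 := ENNReal.tendsto_ofReal h1
  simpa [measureReal_def] using h5

/-- Markov's inequality. -/
lemma real_le_integral_div (f : Config d N → ℝ) (hf : ∀ ω, 0 ≤ f ω) {c : ℝ} (hc : 0 < c) :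
    (configLaw d N s β).real {ω | c ≤ f ω} ≤ (∫ ω, f ω ∂configLaw d N s β) / c := by
  rw [le_div_iff₀' hc]
  exact mul_meas_ge_le_integral_of_nonneg (Eventually.of_forall hf) (integrable_config f) c

end Law

/-! ### Lines, cubes, and deterministic distance bounds from grid edges -/

section Geometry

variable {d N : ℕ}

lemma l1dist_self (x : Node d N) : l1dist x x = 0 := by simp [l1dist]

lemma l1dist_eq_zero {x y : Node d N} : l1dist x y = 0 ↔ x = y := by
  constructor
  · intro h
    simp only [l1dist, Finset.sum_eq_zero_iff, Finset.mem_univ, forall_true_left] at h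
    ext i
    have := h i
    omega
  · rintro rfl; exact l1dist_self x

lemma l1dist_triangle (x y z : Node d N) : l1dist x z ≤ l1dist x y + l1dist y z := by
  unfold l1dist
  rw [← Finset.sum_add_distrib]
  exact Finset.sum_le_sum fun i _ => by omega

lemma l1dist_le (x y : Node d N) : l1dist x y ≤ d * N := by
  unfold l1dist
  calc _ ≤ ∑ _i : Fin d, N := Finset.sum_le_sum fun i _ => by
        have := (x i).2; have := (y i).2; omega
    _ = _ := by simp

/-- The point of the line through `x` in direction `i` with `i`-th coordinate `t`. -/
def line (x : Node d N) (i : Fin d) (t : ℕ) : Node d N := Function.update x i (Fin.ofNat (N + 1) t)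

lemma line_val_self (x : Node d N) (i : Fin d) {t : ℕ} (ht : t ≤ N) : (line x i t i : ℕ) = t := by
  simp [line, Nat.mod_eq_of_lt (Nat.lt_succ_of_le ht)]

lemma line_of_ne (x : Node d N) {i j : Fin d} (t : ℕ) (h : j ≠ i) : line x i t j = x j := by
  simp [line, h]

lemma line_coord (x : Node d N) (i : Fin d) : line x i (x i) = x := by
  simp [line]

lemma l1dist_line (x : Node d N) (i : Fin d) {t r : ℕ} (ht : t ≤ N) (hr : r ≤ N) :
    l1dist (line x i t) (line x i r) = ((t : ℤ) - r).natAbs := by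
  unfold l1dist
  rw [Finset.sum_eq_single i]
  · rw [line_val_self x i ht, line_val_self x i hr]
  · intro j _ hj
    rw [line_of_ne _ _ hj, line_of_ne _ _ hj]; simp
  · simp

/-- The graph on the nodes with the open pairs and the pairs at distance one inside `B`. -/
def boxGraph (ω : Config d N) (B : Set (Node d N)) : SimpleGraph (Node d N) where
  Adj u v := u ≠ v ∧ u ∈ B ∧ v ∈ B ∧ (l1dist u v = 1 ∨ ω s(u, v) = true)
  symm := ⟨fun u v h => ⟨h.1.symm, h.2.2.1, h.2.1, by rw [l1dist_comm, Sym2.eq_swap]; exact h.2.2.2⟩⟩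
  loopless := ⟨fun u h => h.1 rfl⟩

lemma boxGraph_mono (ω : Config d N) {B B' : Set (Node d N)} (h : B ⊆ B') :
    boxGraph ω B ≤ boxGraph ω B' := fun _ _ hu => ⟨hu.1, h hu.2.1, h hu.2.2.1, hu.2.2.2⟩

/-- `boxGraph` contains the unit edges by definition, so connectivity and distance bounds in cubes
hold for every configuration. On the almost sure event `gridOpen` nothing has been added. -/
lemma graph_eq_boxGraph {ω : Config d N} (hω : ω ∈ gridOpen d N) :
    graph ω = boxGraph ω Set.univ := by
  ext u v
  simp only [graph, SimpleGraph.fromEdgeSet_adj, Set.mem_ofPred_eq, boxGraph, Set.mem_univ, true_and]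
  constructor
  · rintro ⟨h1, h2⟩; exact ⟨h2, Or.inr h1⟩
  · rintro ⟨h2, h1 | h1⟩
    · exact ⟨hω _ h1, h2⟩
    · exact ⟨h1, h2⟩

/-- `boxGraph ω B` depends only on the pairs inside `B`. -/
lemma dependsOn_boxGraph (B : Set (Node d N)) :
    DependsOn (fun ω : Config d N => boxGraph ω B) {e | ∀ x ∈ e, x ∈ B} := by
  intro ω ω' h
  ext u v
  simp only [boxGraph]
  refine and_congr_right fun _ => and_congr_right fun hu => and_congr_right fun hv => ?_
  have := h s(u, v) (by intro x hx; rcases Sym2.mem_iff.1 hx with rfl | rfl <;> assumption)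
  rw [this]

lemma exists_walk_line (ω : Config d N) (B : Set (Node d N)) (x : Node d N) (i : Fin d) {t r : ℕ}
    (htr : t ≤ r) (hr : r ≤ N) (hB : ∀ q, t ≤ q → q ≤ r → line x i q ∈ B) :
    ∃ p : (boxGraph ω B).Walk (line x i t) (line x i r), p.length = r - t := by
  induction r, htr using Nat.le_induction with
  | base => exact ⟨.nil, by simp⟩
  | succ r htr ih =>
    obtain ⟨p, hp⟩ := ih (by omega) fun q h1 h2 => hB q h1 (by omega)
    have hl : l1dist (line x i r) (line x i (r + 1)) = 1 := by
      rw [l1dist_line _ _ (by omega) hr]; omega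
    have hadj : (boxGraph ω B).Adj (line x i r) (line x i (r + 1)) := by
      refine ⟨fun h => ?_, hB _ htr (by omega), hB _ (by omega) le_rfl, Or.inl hl⟩
      rw [h, l1dist_self] at hl; omega
    exact ⟨p.concat hadj, by rw [SimpleGraph.Walk.length_concat, hp]; omega⟩

/-- The cube with lowest corner `c` and side length `L`. -/
def cube (N : ℕ) (c : Fin d → ℕ) (L : ℕ) : Set (Node d N) := {x | ∀ i, c i ≤ x i ∧ (x i : ℕ) < c i + L}

lemma line_mem_cube {c : Fin d → ℕ} {L : ℕ} {x : Node d N} {i : Fin d} {t : ℕ} (ht : t ≤ N)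
    (hx : ∀ j, j ≠ i → c j ≤ x j ∧ (x j : ℕ) < c j + L) (h1 : c i ≤ t) (h2 : t < c i + L) :
    line x i t ∈ cube N c L := by
  intro j
  by_cases hj : j = i
  · subst hj; rw [line_val_self _ _ ht]; exact ⟨h1, h2⟩
  · rw [line_of_ne _ _ hj]; exact hx j hj

lemma l1dist_le_of_mem_cube {c : Fin d → ℕ} {L : ℕ} {x y : Node d N} (hx : x ∈ cube N c L)
    (hy : y ∈ cube N c L) : l1dist x y ≤ d * L := by
  unfold l1dist
  calc _ ≤ ∑ _i : Fin d, L := Finset.sum_le_sum fun i _ => by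
        have := hx i; have := hy i; omega
    _ = _ := by simp

/-- The node whose first `j` coordinates are those of `y` and whose others are those of `x`. -/
def mix (x y : Node d N) (j : ℕ) : Node d N := fun i => if (i : ℕ) < j then y i else x i

lemma mix_zero (x y : Node d N) : mix x y 0 = x := by ext; simp [mix]

lemma mix_self (x y : Node d N) : mix x y d = y := by ext; simp [mix]

lemma line_mix_left (x y : Node d N) (j : Fin d) : line (mix x y j) j (x j) = mix x y j := by
  have : mix x y j j = x j := by simp [mix]
  rw [← this, line_coord]

lemma line_mix_right (x y : Node d N) (j : Fin d) :
    line (mix x y j) j (y j) = mix x y (j + 1) := by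
  ext i
  by_cases h : i = j
  · subst h; simp [line, mix]
  · rw [line_of_ne _ _ h]
    have : (i : ℕ) ≠ j := fun h' => h (Fin.ext h')
    simp only [mix]
    congr 2
    simp only [eq_iff_iff]
    omega

lemma mix_mem_cube {c : Fin d → ℕ} {L : ℕ} {x y : Node d N} (hx : x ∈ cube N c L)
    (hy : y ∈ cube N c L) (j : ℕ) : mix x y j ∈ cube N c L := by
  intro i
  unfold mix
  split_ifs
  · exact hy i
  · exact hx i

lemma exists_walk_line_cube (ω : Config d N) {c : Fin d → ℕ} {L : ℕ} {x : Node d N} {i : Fin d}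
    {t r : ℕ} (ht : line x i t ∈ cube N c L) (hr : line x i r ∈ cube N c L) (htN : t ≤ N)
    (hrN : r ≤ N) : ∃ p : (boxGraph ω (cube N c L)).Walk (line x i t) (line x i r), p.length ≤ L := by
  have key : ∀ t r : ℕ, t ≤ r → r ≤ N → line x i t ∈ cube N c L → line x i r ∈ cube N c L →
      ∃ p : (boxGraph ω (cube N c L)).Walk (line x i t) (line x i r), p.length ≤ L := by
    intro t r htr hrN ht hr
    have h1 := ht i
    have h2 := hr i
    rw [line_val_self _ _ (by omega)] at h1 h2
    obtain ⟨p, hp⟩ := exists_walk_line ω (cube N c L) x i htr hrN fun q h3 h4 =>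
      line_mem_cube (by omega) (fun j hj => by have := ht j; rwa [line_of_ne _ _ hj] at this)
        (by omega) (by omega)
    exact ⟨p, by omega⟩
  rcases le_total t r with h | h
  · exact key t r h hrN ht hr
  · obtain ⟨p, hp⟩ := key r t h htN hr ht
    exact ⟨p.reverse, by simpa using hp⟩

lemma exists_walk_mix (ω : Config d N) {c : Fin d → ℕ} {L : ℕ} {x y : Node d N}
    (hx : x ∈ cube N c L) (hy : y ∈ cube N c L) {j : ℕ} (hj : j < d) :
    ∃ p : (boxGraph ω (cube N c L)).Walk (mix x y j) (mix x y (j + 1)), p.length ≤ L := by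
  have h1 := line_mix_left x y ⟨j, hj⟩
  have h2 := line_mix_right x y ⟨j, hj⟩
  simp only at h1 h2
  have m1 := mix_mem_cube hx hy j
  have m2 := mix_mem_cube hx hy (j + 1)
  rw [← h1] at m1
  rw [← h2] at m2
  have := exists_walk_line_cube ω m1 m2 (by omega) (by omega)
  rwa [h1, h2] at this

lemma reachable_mix (ω : Config d N) {c : Fin d → ℕ} {L : ℕ} {x y : Node d N}
    (hx : x ∈ cube N c L) (hy : y ∈ cube N c L) {j : ℕ} (hj : j ≤ d) :
    (boxGraph ω (cube N c L)).Reachable x (mix x y j) := by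
  induction j with
  | zero => rw [mix_zero]
  | succ j ih =>
    obtain ⟨p, -⟩ := exists_walk_mix ω hx hy (j := j) (by omega)
    exact (ih (by omega)).trans ⟨p⟩

lemma reachable_cube (ω : Config d N) {c : Fin d → ℕ} {L : ℕ} {x y : Node d N}
    (hx : x ∈ cube N c L) (hy : y ∈ cube N c L) : (boxGraph ω (cube N c L)).Reachable x y := by
  have := reachable_mix ω hx hy le_rfl
  rwa [mix_self] at this

/-- Changing the coordinates one at a time leads from x to y through nodes of the cube, so all
distances reduce to distances along axis-parallel lines. -/
lemma dist_le_sum_mix (ω : Config d N) {c : Fin d → ℕ} {L : ℕ} {x y : Node d N}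
    (hx : x ∈ cube N c L) (hy : y ∈ cube N c L) :
    (boxGraph ω (cube N c L)).dist x y ≤
      ∑ j ∈ Finset.range d, (boxGraph ω (cube N c L)).dist (mix x y j) (mix x y (j + 1)) := by
  have key : ∀ m ≤ d, (boxGraph ω (cube N c L)).dist x (mix x y m) ≤
      ∑ j ∈ Finset.range m, (boxGraph ω (cube N c L)).dist (mix x y j) (mix x y (j + 1)) := by
    intro m
    induction m with
    | zero => simp [mix_zero]
    | succ m ih =>
      intro hm
      rw [Finset.sum_range_succ]
      have := (reachable_mix ω hx hy (j := m) (by omega)).dist_triangle_left (mix x y (m + 1))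
      have := ih (by omega)
      omega
  simpa [mix_self] using key d le_rfl

lemma dist_cube_le (ω : Config d N) {c : Fin d → ℕ} {L : ℕ} {x y : Node d N}
    (hx : x ∈ cube N c L) (hy : y ∈ cube N c L) : (boxGraph ω (cube N c L)).dist x y ≤ d * L := by
  refine (dist_le_sum_mix ω hx hy).trans ?_
  calc _ ≤ ∑ _j ∈ Finset.range d, L := Finset.sum_le_sum fun j hj => by
        obtain ⟨p, hp⟩ := exists_walk_mix ω hx hy (Finset.mem_range.1 hj)
        exact (SimpleGraph.dist_le p).trans hp
    _ = _ := by simp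

lemma cube_univ : cube N (fun _ : Fin d => 0) (N + 1) = Set.univ := by
  ext x
  simp only [cube, Set.mem_ofPred_eq, Set.mem_univ, iff_true]
  exact fun i => ⟨Nat.zero_le _, by omega⟩

lemma connected_boxGraph_univ (ω : Config d N) : (boxGraph ω Set.univ).Connected := by
  have : (boxGraph ω (Set.univ : Set (Node d N))).Preconnected := by
    intro x y
    have := reachable_cube ω (c := fun _ => 0) (L := N + 1) (x := x) (y := y)
      (by simp [cube_univ]) (by simp [cube_univ])
    rwa [cube_univ] at this
  exact ⟨this⟩

/-- Distances in a larger box are shorter. -/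
lemma dist_univ_le (ω : Config d N) {B : Set (Node d N)} {x y : Node d N}
    (h : (boxGraph ω B).Reachable x y) :
    (boxGraph ω Set.univ).dist x y ≤ (boxGraph ω B).dist x y :=
  h.dist_anti (boxGraph_mono ω (Set.subset_univ B))

lemma connected_graph {ω : Config d N} (hω : ω ∈ gridOpen d N) : (graph ω).Connected := by
  rw [graph_eq_boxGraph hω]; exact connected_boxGraph_univ ω

lemma dist_le_D {ω : Config d N} (hω : ω ∈ gridOpen d N) (x y : Node d N) :
    (graph ω).dist x y ≤ D ω :=
  SimpleGraph.dist_le_diam (SimpleGraph.connected_iff_ediam_ne_top.1 (connected_graph hω))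

lemma exists_dist_eq_D (ω : Config d N) : ∃ x y, (graph ω).dist x y = D ω :=
  SimpleGraph.exists_dist_eq_diam

end Geometry

/-! ### Sphere sizes and expected degrees -/

section Counting

variable {d N : ℕ} {s β : ℝ}

/-- The number of nodes at given distance from a node. -/
lemma card_sphere_le (hd : 1 ≤ d) (x : Node d N) (k : ℕ) :
    (Finset.univ.filter fun y : Node d N => l1dist x y = k).card ≤ 2 * (2 * k + 1) ^ (d - 1) := by
  classical
  obtain ⟨d, rfl⟩ : ∃ m, d = m + 1 := ⟨d - 1, by omega⟩
  let T : Finset (Bool × (Fin d → ℤ)) :=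
    Finset.univ ×ˢ Fintype.piFinset (fun _ => Finset.Icc (-(k : ℤ)) k)
  have hT : T.card = 2 * (2 * k + 1) ^ d := by
    simp only [T, Finset.card_product, Fintype.card_piFinset, Int.card_Icc]
    simp only [Finset.card_univ, Fintype.card_bool, Finset.prod_const, Fintype.card_fin]
    congr 2
    omega
  rw [Nat.add_sub_cancel, ← hT]
  -- Given the total distance k, the coordinates other than 0 determine |x 0 - y 0|, and one bit
  -- recovers its sign.
  refine Finset.card_le_card_of_injOn
    (fun y => (decide (x 0 ≤ y 0), fun i => (y i.succ : ℤ) - x i.succ)) ?_ ?_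
  · intro y hy
    have hy : l1dist x y = k := by simpa using hy
    simp only [T, Finset.coe_product, Set.mem_prod, Finset.mem_coe, Finset.mem_univ, true_and,
      Fintype.mem_piFinset, Finset.mem_Icc]
    intro i
    have : ((x i.succ : ℤ) - y i.succ).natAbs ≤ l1dist x y :=
      Finset.single_le_sum (f := fun i => ((x i : ℤ) - (y i : ℤ)).natAbs)
        (fun _ _ => Nat.zero_le _) (Finset.mem_univ i.succ)
    omega
  · intro y hy z hz hyz
    have hy : l1dist x y = k := by simpa using hy
    have hz : l1dist x z = k := by simpa using hz
    simp only [Prod.mk.injEq, decide_eq_decide] at hyz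
    have h1 : ∀ i : Fin d, y i.succ = z i.succ := fun i => by
      have := congrFun hyz.2 i
      ext
      omega
    have h0 : ((x 0 : ℤ) - y 0).natAbs = ((x 0 : ℤ) - z 0).natAbs := by
      have : l1dist x y = l1dist x z := by omega
      unfold l1dist at this
      rw [Fin.sum_univ_succ, Fin.sum_univ_succ] at this
      simp only [h1] at this
      omega
    have h2 := hyz.1
    rw [Fin.le_def, Fin.le_def] at h2
    funext i
    refine Fin.cases ?_ h1 i
    ext
    omega

lemma sum_l1dist_le (hd : 1 ≤ d) (x : Node d N) (g : ℕ → ℝ) (hg : ∀ k, 0 ≤ g k) (h0 : g 0 = 0) :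
    ∑ y, g (l1dist x y) ≤
      2 * 3 ^ (d - 1) * ∑ k ∈ Finset.Icc 1 (d * N), (k : ℝ) ^ (d - 1) * g k := by
  classical
  have h1 : ∑ y, g (l1dist x y) = ∑ k ∈ Finset.Icc 0 (d * N),
      ((Finset.univ.filter fun y : Node d N => l1dist x y = k).card : ℝ) * g k := by
    rw [← Finset.sum_fiberwise_of_maps_to (s := Finset.univ) (t := Finset.Icc 0 (d * N))
      (g := fun y => l1dist x y) (fun y _ => by simp [l1dist_le])]
    refine Finset.sum_congr rfl fun k _ => ?_
    rw [Finset.sum_congr rfl (g := fun _ => g k), Finset.sum_const, nsmul_eq_mul]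
    intro y hy
    rw [(Finset.mem_filter.1 hy).2]
  rw [h1, ← Finset.insert_Icc_add_one_left_eq_Icc (Nat.zero_le _), Finset.sum_insert (by simp), h0,
    mul_zero, zero_add, zero_add, Finset.mul_sum]
  refine Finset.sum_le_sum fun k hk => ?_
  rw [← mul_assoc]
  refine mul_le_mul_of_nonneg_right ?_ (hg k)
  have hk1 : 1 ≤ k := (Finset.mem_Icc.1 hk).1
  calc ((Finset.univ.filter fun y : Node d N => l1dist x y = k).card : ℝ)
      ≤ ((2 * (2 * k + 1) ^ (d - 1) : ℕ) : ℝ) := by exact_mod_cast card_sphere_le hd x k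
    _ ≤ ((2 * (3 * k) ^ (d - 1) : ℕ) : ℝ) := by
        have : (2 * k + 1) ^ (d - 1) ≤ (3 * k) ^ (d - 1) := Nat.pow_le_pow_left (by omega) _
        exact_mod_cast Nat.mul_le_mul_left 2 this
    _ = _ := by push_cast; rw [mul_pow]; ring

lemma connectProb_le_rpow (hβ : 0 ≤ β) (k : ℕ) (hk : 1 ≤ k) :
    (connectProb s β k : ℝ) ≤ (1 + β) * ((k : ℝ) ^ s)⁻¹ := by
  by_cases h : k = 1
  · subst h; simp; exact hβ
  · refine (connectProb_le hβ h).trans ?_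
    rw [div_eq_mul_inv]
    refine mul_le_mul_of_nonneg_right (by linarith) (by positivity)

/-- The expected degree of a node is at most a weighted sum over distances. -/
lemma sum_edgeProb_le (hd : 1 ≤ d) (hs : 0 < s) (hβ : 0 ≤ β) (x : Node d N) :
    ∑ y, (if y = x then 0 else (edgeProb d N s β s(x, y) : ℝ)) ≤
      2 * 3 ^ (d - 1) * (1 + β) *
        ∑ k ∈ Finset.Icc 1 (d * N), (k : ℝ) ^ ((d : ℝ) - 1 - s) := by
  calc ∑ y, (if y = x then 0 else (edgeProb d N s β s(x, y) : ℝ))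
      ≤ ∑ y, (1 + β) * ((l1dist x y : ℝ) ^ s)⁻¹ := by
        refine Finset.sum_le_sum fun y _ => ?_
        split_ifs with h
        · positivity
        · refine connectProb_le_rpow hβ _ ?_
          exact Nat.one_le_iff_ne_zero.2 fun h' => h (l1dist_eq_zero.1 h').symm
    _ ≤ 2 * 3 ^ (d - 1) * ∑ k ∈ Finset.Icc 1 (d * N),
          (k : ℝ) ^ (d - 1) * ((1 + β) * ((k : ℝ) ^ s)⁻¹) :=
        sum_l1dist_le hd x (fun k => (1 + β) * ((k : ℝ) ^ s)⁻¹) (fun k => by positivity)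
          (by simp [Real.zero_rpow hs.ne'])
    _ = _ := by
        rw [mul_assoc _ (1 + β), Finset.mul_sum _ _ (1 + β)]
        congr 1
        refine Finset.sum_congr rfl fun k hk => ?_
        have hk1 : 0 < (k : ℝ) := by exact_mod_cast (Finset.mem_Icc.1 hk).1
        rw [show ((d : ℝ) - 1 - s) = ((d - 1 : ℕ) : ℝ) - s by rw [Nat.cast_sub hd]; simp,
          Real.rpow_sub hk1, Real.rpow_natCast]
        field_simp

/-- Power sums with exponent less than `-1` are bounded. -/
lemma exists_sum_rpow_le {a : ℝ} (ha : a < -1) :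
    ∃ C : ℝ, 0 < C ∧ ∀ T : Finset ℕ, ∑ k ∈ T, (k : ℝ) ^ a ≤ C := by
  have h := Real.summable_nat_rpow.2 ha
  refine ⟨(∑' k : ℕ, (k : ℝ) ^ a) + 1, ?_, fun T => ?_⟩
  · have : 0 ≤ ∑' k : ℕ, (k : ℝ) ^ a := tsum_nonneg fun k => by positivity
    linarith
  · have := h.sum_le_tsum T fun k _ => by positivity
    linarith

end Counting

/-! ### First moment of the number of self-avoiding paths -/

section PathCounting

variable {d N : ℕ} {s β : ℝ}

/-- There is an open self-avoiding path with `j` steps from `x` to `y` that avoids `S`. -/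
def Hop (ω : Config d N) : ℕ → Set (Node d N) → Node d N → Node d N → Prop
  | 0, _, x, y => x = y
  | j + 1, S, x, y => ∃ z, z ≠ x ∧ z ∉ insert x S ∧ ω s(x, z) = true ∧ Hop ω j (insert x S) z y

lemma hop_of_isPath {ω : Config d N} {x y : Node d N} (p : (graph ω).Walk x y) (hp : p.IsPath)
    (S : Set (Node d N)) (hS : ∀ v ∈ p.support, v ∉ S) : Hop ω p.length S x y := by
  induction p generalizing S with
  | nil => rfl
  | @cons u v w h q ih =>
    rw [SimpleGraph.Walk.cons_isPath_iff] at hp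
    have hadj : s(u, v) ∈ {e | ω e = true} ∧ u ≠ v := by
      simpa only [graph, SimpleGraph.fromEdgeSet_adj] using h
    have key : ∀ t ∈ q.support, t ∉ insert u S := by
      intro t ht
      rw [Set.mem_insert_iff, not_or]
      exact ⟨fun h' => hp.2 (h' ▸ ht), hS t (by simp [ht])⟩
    exact ⟨v, hadj.2.symm, key v (SimpleGraph.Walk.start_mem_support q), hadj.1,
      ih hp.1 _ key⟩

/-- A path that avoids S uses only pairs disjoint from S. In the recursion x has joined S, so the
rest of the path is independent of its first edge, which contains x. This is why paths must be
self-avoiding. -/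
lemma dependsOn_hop (j : ℕ) (S : Set (Node d N)) (x y : Node d N) (hx : x ∉ S) :
    DependsOn (fun ω : Config d N => Hop ω j S x y) {e | ∀ v ∈ e, v ∉ S} := by
  induction j generalizing S x with
  | zero => intro _ _ _; rfl
  | succ j ih =>
    intro ω ω' h
    simp only [Hop, eq_iff_iff]
    refine exists_congr fun z => and_congr_right fun _ => and_congr_right fun hz => ?_
    have h1 : ω s(x, z) = ω' s(x, z) := h _ (by
      intro v hv
      rcases Sym2.mem_iff.1 hv with rfl | rfl
      · exact hx
      · exact fun h' => hz (Set.mem_insert_of_mem _ h'))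
    have h2 := @ih (insert x S) z hz ω ω' (fun e he => h e fun v hv h' =>
      he v hv (Set.mem_insert_of_mem _ h'))
    simp only at h2
    rw [h1, h2]

/-- By the independence of the first edge, one more step multiplies the sum by at most the expected
degree of a node. -/
lemma sum_real_hop_le {M : ℝ}
    (hM : ∀ x, ∑ y, (if y = x then 0 else (edgeProb d N s β s(x, y) : ℝ)) ≤ M)
    (j : ℕ) (S : Set (Node d N)) (x : Node d N) :
    ∑ y, (configLaw d N s β).real {ω | Hop ω j S x y} ≤ M ^ j := by
  classical
  have hM0 : 0 ≤ M := le_trans (Finset.sum_nonneg fun y _ => by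
    split_ifs
    · exact le_rfl
    · exact edgeProb_nonneg _) (hM x)
  induction j generalizing S x with
  | zero =>
    simp only [Hop, pow_zero]
    rw [Finset.sum_eq_single x]
    · exact measureReal_le_one
    · intro b _ hb
      simp [hb.symm]
    · simp
  | succ j ih =>
    have h1 : ∀ y, (configLaw d N s β).real {ω | Hop ω (j + 1) S x y} ≤
        ∑ z, (if z = x then 0 else (edgeProb d N s β s(x, z) : ℝ)) *
          (configLaw d N s β).real {ω | Hop ω j (insert x S) z y} := by
      intro y
      have hsub : {ω : Config d N | Hop ω (j + 1) S x y} ⊆ ⋃ z ∈ (Finset.univ : Finset (Node d N)),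
          {ω | z ≠ x ∧ z ∉ insert x S ∧ ω s(x, z) = true ∧ Hop ω j (insert x S) z y} := by
        intro ω ⟨z, hz⟩
        simp only [Finset.mem_univ, Set.iUnion_true, Set.mem_iUnion]
        exact ⟨z, hz⟩
      refine (measureReal_mono hsub (measure_ne_top _ _)).trans ((measureReal_biUnion_finset_le _ _).trans ?_)
      refine Finset.sum_le_sum fun z _ => ?_
      by_cases hz : z ∈ insert x S
      · rw [show {ω : Config d N | z ≠ x ∧ z ∉ insert x S ∧ ω s(x, z) = true ∧
          Hop ω j (insert x S) z y} = ∅ from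
            Set.eq_empty_of_forall_notMem fun ω h => h.2.1 hz]
        rw [measureReal_empty]
        split_ifs
        · simp
        · exact mul_nonneg (edgeProb_nonneg _) measureReal_nonneg
      · have hzx : z ≠ x := fun h => hz (h ▸ Set.mem_insert _ _)
        rw [if_neg hzx, ← real_open, ← real_inter_of_dependsOn (S := {s(x, z)})
          (T := {e | ∀ v ∈ e, v ∉ insert x S})]
        · refine measureReal_mono ?_
          intro ω hω
          exact ⟨hω.2.2.1, hω.2.2.2⟩
        · intro ω ω' h
          simp at h
          simp [h]
        · exact dependsOn_hop _ _ _ _ hz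
        · rw [Set.disjoint_singleton_left]
          intro h
          exact h x (by simp) (Set.mem_insert _ _)
    calc ∑ y, (configLaw d N s β).real {ω | Hop ω (j + 1) S x y}
        ≤ ∑ y, ∑ z, (if z = x then 0 else (edgeProb d N s β s(x, z) : ℝ)) *
          (configLaw d N s β).real {ω | Hop ω j (insert x S) z y} :=
          Finset.sum_le_sum fun y _ => h1 y
      _ = ∑ z, (if z = x then 0 else (edgeProb d N s β s(x, z) : ℝ)) *
          ∑ y, (configLaw d N s β).real {ω | Hop ω j (insert x S) z y} := by
          rw [Finset.sum_comm]
          simp only [Finset.mul_sum]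
      _ ≤ ∑ z, (if z = x then 0 else (edgeProb d N s β s(x, z) : ℝ)) * M ^ j := by
          refine Finset.sum_le_sum fun z _ => mul_le_mul_of_nonneg_left (ih _ _) ?_
          split_ifs
          · exact le_rfl
          · exact edgeProb_nonneg _
      _ ≤ M * M ^ j := by
          rw [← Finset.sum_mul]
          exact mul_le_mul_of_nonneg_right (hM x) (by positivity)
      _ = M ^ (j + 1) := by ring

/-- It is unlikely that the diameter is so small that balls of this radius are small on average. -/
lemma real_D_le_le {M : ℝ} (hM1 : 1 ≤ M)
    (hM : ∀ x : Node d N, ∑ y, (if y = x then 0 else (edgeProb d N s β s(x, y) : ℝ)) ≤ M) (n : ℕ) :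
    (configLaw d N s β).real {ω | ω ∈ gridOpen d N ∧ D ω ≤ n} ≤ (n + 1) * M ^ n / (N + 1) ^ d := by
  classical
  -- This counts the pairs (y, j) with j ≤ n for which some open self-avoiding path with j steps
  -- leads from the origin to y. If D ≤ n, a geodesic makes every y contribute at least one.
  let F : Config d N → ℝ := fun ω => ∑ y, ∑ j ∈ Finset.range (n + 1),
    {ω | Hop ω j ∅ (0 : Node d N) y}.indicator 1 ω
  have hF0 : ∀ ω, 0 ≤ F ω := fun ω => Finset.sum_nonneg fun y _ => Finset.sum_nonneg fun j _ =>
    Set.indicator_nonneg (fun _ _ => zero_le_one) _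
  have hF : ∀ ω, ω ∈ gridOpen d N ∧ D ω ≤ n → ((N:ℝ) + 1) ^ d ≤ F ω := by
    rintro ω ⟨hω, hD⟩
    have h1 : ∀ y : Node d N, (1 : ℝ) ≤ ∑ j ∈ Finset.range (n + 1),
        {ω | Hop ω j ∅ (0 : Node d N) y}.indicator 1 ω := by
      intro y
      obtain ⟨p, hp, hl⟩ := (connected_graph hω).exists_path_of_dist 0 y
      have h2 := hop_of_isPath p hp ∅ (by simp)
      have h3 : p.length ∈ Finset.range (n + 1) := by
        have := dist_le_D hω 0 y
        rw [Finset.mem_range]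
        omega
      refine le_trans ?_ (Finset.single_le_sum (f := fun j =>
        {ω | Hop ω j ∅ (0 : Node d N) y}.indicator (1 : Config d N → ℝ) ω) (fun j _ =>
        Set.indicator_nonneg (fun _ _ => zero_le_one) _) h3)
      rw [Set.indicator_of_mem (by exact h2)]
      simp
    calc ((N:ℝ) + 1) ^ d = ∑ _y : Node d N, (1 : ℝ) := by simp
      _ ≤ F ω := Finset.sum_le_sum fun y _ => h1 y
  have hE : ∫ ω, F ω ∂configLaw d N s β ≤ (n + 1) * M ^ n := by
    simp only [F]
    rw [integral_finsetSum _ fun _ _ => integrable_config _]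
    simp_rw [integral_finsetSum (Finset.range (n + 1)) fun _ _ => integrable_config _,
      integral_indicator_config]
    rw [Finset.sum_comm]
    calc _ ≤ ∑ _j ∈ Finset.range (n + 1), M ^ n := Finset.sum_le_sum fun j hj =>
          (sum_real_hop_le hM j ∅ 0).trans
            (pow_le_pow_right₀ hM1 (by have := Finset.mem_range.1 hj; omega))
      _ = _ := by simp
  calc (configLaw d N s β).real {ω | ω ∈ gridOpen d N ∧ D ω ≤ n}
      ≤ (configLaw d N s β).real {ω | ((N:ℝ) + 1) ^ d ≤ F ω} := measureReal_mono hF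
    _ ≤ (∫ ω, F ω ∂configLaw d N s β) / (N + 1) ^ d := real_le_integral_div F hF0 (by positivity)
    _ ≤ _ := by gcongr

end PathCounting

/-! ### Lower bounds for s > d and s = d -/

section LowerBounds

variable {d : ℕ} {s β : ℝ}

lemma tendsto_log_mul_rpow_neg {a : ℝ} (ha : 0 < a) :
    Tendsto (fun N : ℕ => (Real.log N + 1) * (N : ℝ) ^ (-a)) atTop (𝓝 0) := by
  have h1 : Tendsto (fun x : ℝ => Real.log x * x ^ (-a)) atTop (𝓝 0) := by
    have := (isLittleO_log_rpow_atTop ha).tendsto_div_nhds_zero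
    refine this.congr' ?_
    filter_upwards [eventually_gt_atTop 0] with x hx
    rw [Real.rpow_neg hx.le, div_eq_mul_inv]
  have h2 := (h1.add (tendsto_rpow_neg_atTop ha)).comp tendsto_natCast_atTop_atTop
  simp only [add_zero] at h2
  refine h2.congr fun N => ?_
  simp only [Function.comp]
  ring

/-- A lower bound on the diameter from a bound `M` on the expected degrees. -/
lemma tendsto_real_D_lt (hd : 1 ≤ d) (M : ℕ → ℝ) (t : ℕ → ℝ)
    (hM : ∀ᶠ N in atTop, 1 ≤ M N ∧
      ∀ x : Node d N, ∑ y, (if y = x then 0 else (edgeProb d N s β s(x, y) : ℝ)) ≤ M N)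
    (ht : ∀ᶠ N : ℕ in atTop, 0 ≤ t N ∧ t N ≤ Real.log N ∧
      t N * Real.log (M N) ≤ 1 / 2 * Real.log N) :
    Tendsto (fun N => (configLaw d N s β).real {ω | ω ∈ gridOpen d N ∧ (D ω : ℝ) < t N})
      atTop (𝓝 0) := by
  refine squeeze_zero' (Eventually.of_forall fun _ => measureReal_nonneg) ?_
    (tendsto_log_mul_rpow_neg (a := 1 / 2) (by norm_num))
  filter_upwards [hM, ht, eventually_ge_atTop 1] with N ⟨h1, h2⟩ ⟨h3, h4, h5⟩ hN
  have hN0 : (0 : ℝ) < N := by exact_mod_cast hN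
  set n := ⌊t N⌋₊ with hn
  have hnt : (n : ℝ) ≤ t N := Nat.floor_le h3
  -- The assumption t log M ≤ (log N) / 2 leaves a spare factor N ^ (1 / 2), which absorbs the
  -- number n + 1 of path lengths.
  have hMn : M N ^ n ≤ (N : ℝ) ^ (1 / 2 : ℝ) := by
    rw [← Real.rpow_natCast, Real.rpow_def_of_pos (by linarith), Real.rpow_def_of_pos hN0]
    refine Real.exp_le_exp.2 ?_
    have := mul_le_mul_of_nonneg_right hnt (Real.log_nonneg h1)
    linarith
  calc (configLaw d N s β).real {ω | ω ∈ gridOpen d N ∧ (D ω : ℝ) < t N}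
      ≤ (configLaw d N s β).real {ω | ω ∈ gridOpen d N ∧ D ω ≤ n} :=
        measureReal_mono fun ω hω => ⟨hω.1, Nat.le_floor hω.2.le⟩
    _ ≤ (n + 1) * M N ^ n / (N + 1) ^ d := real_D_le_le h1 h2 n
    _ ≤ (Real.log N + 1) * (N : ℝ) ^ (1 / 2 : ℝ) / N := by
        have hd' : (N : ℝ) ≤ (N + 1) ^ d := by
          calc (N : ℝ) ≤ (N + 1) ^ 1 := by linarith
            _ ≤ _ := pow_le_pow_right₀ (by linarith) hd
        have : (0:ℝ) ≤ Real.log N := by linarith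
        gcongr
        linarith
    _ = (Real.log N + 1) * (N : ℝ) ^ (-(1 / 2) : ℝ) := by
        rw [mul_div_assoc, ← Real.rpow_sub_one hN0.ne']
        norm_num

theorem tendsto_D_lt_log (hd : 1 ≤ d) (hβ : 0 < β) (hs : (d : ℝ) < s) :
    ∃ C : ℝ, 0 < C ∧ Tendsto (fun N : ℕ => (configLaw d N s β).real
      {ω | ω ∈ gridOpen d N ∧ (D ω : ℝ) < C * Real.log N}) atTop (𝓝 0) := by
  have hs0 : 0 < s := lt_of_le_of_lt (Nat.cast_nonneg d) hs
  obtain ⟨K, hK, hK'⟩ := exists_sum_rpow_le (a := (d : ℝ) - 1 - s) (by linarith)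
  -- Taking M ≥ e ensures log M ≥ 1, so that log N / (2 log M) ≤ log N.
  set M : ℝ := max (Real.exp 1) (2 * 3 ^ (d - 1) * (1 + β) * K) with hMdef
  have hMe : Real.exp 1 ≤ M := le_max_left _ _
  have hM1 : 1 ≤ M := le_trans (by have := Real.add_one_le_exp (1:ℝ); linarith) hMe
  have hlog : 1 ≤ Real.log M := by
    rw [← Real.log_exp 1]; exact Real.log_le_log (Real.exp_pos _) hMe
  refine ⟨1 / (2 * Real.log M), by positivity, tendsto_real_D_lt hd (fun _ => M) _ ?_ ?_⟩
  · refine Eventually.of_forall fun N => ⟨hM1, fun x => ?_⟩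
    refine (sum_edgeProb_le hd hs0 hβ.le x).trans (le_trans ?_ (le_max_right _ _))
    exact mul_le_mul_of_nonneg_left (hK' _) (by positivity)
  · filter_upwards [eventually_ge_atTop 1] with N hN
    have : 0 ≤ Real.log N := Real.log_natCast_nonneg N
    refine ⟨by positivity, ?_, ?_⟩
    · refine mul_le_of_le_one_left this ?_
      rw [div_le_one (by positivity)]
      linarith
    · field_simp
      exact le_rfl

lemma tendsto_log_natCast : Tendsto (fun N : ℕ => Real.log N) atTop atTop :=
  Real.tendsto_log_atTop.comp tendsto_natCast_atTop_atTop

lemma sum_Icc_inv_le {n : ℕ} : ∑ k ∈ Finset.Icc 1 n, (k : ℝ)⁻¹ ≤ 1 + Real.log n := by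
  have := harmonic_le_one_add_log n
  rw [harmonic_eq_sum_Icc] at this
  push_cast at this
  exact this

theorem tendsto_D_lt_log_div_log_log (hd : 1 ≤ d) (hβ : 0 < β) (hs : s = d) :
    ∃ C : ℝ, 0 < C ∧ Tendsto (fun N : ℕ => (configLaw d N s β).real
      {ω | ω ∈ gridOpen d N ∧ (D ω : ℝ) < C * Real.log N / Real.log (Real.log N)})
        atTop (𝓝 0) := by
  have hd0 : (0 : ℝ) < d := by exact_mod_cast hd
  have hs0 : 0 < s := by rw [hs]; exact hd0
  -- The degree bound K log N is enlarged to (log N) ^ 2 to absorb K. Its logarithm is 2 log log N,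
  -- and the constant 1 / 4 then gives exactly t log M = (log N) / 2.
  refine ⟨1 / 4, by norm_num, tendsto_real_D_lt hd (fun N => Real.log N ^ 2) _ ?_ ?_⟩
  · have h1 : Tendsto (fun N : ℕ => Real.log N) atTop atTop := tendsto_log_natCast
    set K : ℝ := 2 * 3 ^ (d - 1) * (1 + β) * (2 + Real.log d) with hK
    have hlogd : 0 ≤ Real.log d := Real.log_natCast_nonneg d
    filter_upwards [h1.eventually_ge_atTop 1, h1.eventually_ge_atTop K, eventually_ge_atTop 1]
      with N hN1 hN2 hN3
    refine ⟨by nlinarith, fun x => (sum_edgeProb_le hd hs0 hβ.le x).trans ?_⟩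
    have h2 : ∑ k ∈ Finset.Icc 1 (d * N), (k : ℝ) ^ ((d : ℝ) - 1 - s) ≤
        (2 + Real.log d) * Real.log N := by
      rw [hs, show ((d : ℝ) - 1 - d) = -1 by ring]
      simp only [Real.rpow_neg_one]
      refine sum_Icc_inv_le.trans ?_
      push_cast
      rw [Real.log_mul hd0.ne' (by positivity)]
      nlinarith
    calc _ ≤ 2 * 3 ^ (d - 1) * (1 + β) * ((2 + Real.log d) * Real.log N) :=
          mul_le_mul_of_nonneg_left h2 (by positivity)
      _ = K * Real.log N := by rw [hK]; ring
      _ ≤ _ := by nlinarith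
  · have h1 : Tendsto (fun N : ℕ => Real.log N) atTop atTop := tendsto_log_natCast
    have h2 : Tendsto (fun N : ℕ => Real.log (Real.log N)) atTop atTop :=
      Real.tendsto_log_atTop.comp h1
    filter_upwards [h1.eventually_ge_atTop 1, h2.eventually_ge_atTop 1] with N hN1 hN2
    refine ⟨by positivity, ?_, ?_⟩
    · rw [div_le_iff₀ (by linarith)]
      nlinarith
    · rw [Real.log_pow]
      field_simp
      norm_num

end LowerBounds

/-! ### Lower bound for s > 2d from the total length of long edges -/

section LongEdges

variable {d N : ℕ} {s β : ℝ}

open Classical in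
/-- The total length of the open edges at `x` of length greater than `l`. -/
noncomputable def longLength (l : ℝ) (ω : Config d N) (x : Node d N) : ℝ :=
  ∑ y, if l < l1dist x y ∧ ω s(x, y) = true then (l1dist x y : ℝ) else 0

lemma longLength_nonneg (l : ℝ) (ω : Config d N) (x : Node d N) : 0 ≤ longLength l ω x :=
  Finset.sum_nonneg fun _ _ => by positivity

/-- Each step of the walk is either of length at most l or is charged to `longLength` at its first
node. -/
lemma l1dist_le_of_walk {l : ℝ} (hl0 : 0 ≤ l) {ω : Config d N} {x y : Node d N} (p : (graph ω).Walk x y) :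
    (l1dist x y : ℝ) ≤ l * p.length + (p.support.map (longLength l ω)).sum := by
  classical
  induction p with
  | nil => simp [l1dist_self, longLength_nonneg]
  | @cons u v w h q ih =>
    have hadj : s(u, v) ∈ {e | ω e = true} ∧ u ≠ v := by
      simpa only [graph, SimpleGraph.fromEdgeSet_adj] using h
    have h1 : (l1dist u w : ℝ) ≤ l1dist u v + l1dist v w := by exact_mod_cast l1dist_triangle u v w
    have h2 : (l1dist u v : ℝ) ≤ l + longLength l ω u := by
      by_cases hl : l < l1dist u v
      · have := Finset.single_le_sum (f := fun y =>
          if l < l1dist u y ∧ ω s(u, y) = true then (l1dist u y : ℝ) else 0)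
          (fun _ _ => by positivity) (Finset.mem_univ v)
        simp only [if_pos (show l < l1dist u v ∧ ω s(u, v) = true from ⟨hl, hadj.1⟩)] at this
        unfold longLength
        linarith
      · have := longLength_nonneg l ω u
        linarith [not_lt.1 hl]
    rw [SimpleGraph.Walk.length_cons, SimpleGraph.Walk.support_cons, List.map_cons, List.sum_cons]
    push_cast
    linarith

/-- For lengths k > l one has 1 ≤ l ^ (-a) k ^ a. Restricting to long edges therefore gains l ^
(-a), provided that the power sum still converges with its exponent raised by a. -/
lemma integral_longLength_le (hd : 1 ≤ d) (hβ : 0 ≤ β) {l a : ℝ} (hl : 0 < l) (ha : 0 ≤ a) {K : ℝ}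
    (hK : ∀ T : Finset ℕ, ∑ k ∈ T, (k : ℝ) ^ ((d : ℝ) - s + a) ≤ K) (x : Node d N) :
    ∫ ω, longLength l ω x ∂configLaw d N s β ≤ 2 * 3 ^ (d - 1) * (1 + β) * K * l ^ (-a) := by
  classical
  unfold longLength
  rw [integral_finsetSum _ fun _ _ => integrable_config _]
  set g : ℕ → ℝ := fun k => if l < k then (1 + β) * ((k : ℝ) ^ s)⁻¹ * k else 0 with hg
  have h1 : ∀ y : Node d N, ∫ ω : Config d N, (if l < l1dist x y ∧ ω s(x, y) = true
      then (l1dist x y : ℝ) else 0) ∂configLaw d N s β ≤ g (l1dist x y) := by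
    intro y
    simp only [hg]
    split_ifs with h
    · have e1 : (fun ω : Config d N => if l < l1dist x y ∧ ω s(x, y) = true
          then (l1dist x y : ℝ) else 0) =
          fun ω => {ω : Config d N | ω s(x, y) = true}.indicator 1 ω * (l1dist x y : ℝ) := by
        ext ω
        by_cases hω : ω s(x, y) = true <;> simp [hω, h]
      rw [e1, integral_mul_const, integral_indicator_config, real_open]
      refine mul_le_mul_of_nonneg_right (connectProb_le_rpow hβ _ ?_) (by positivity)
      have : (0 : ℝ) < l1dist x y := hl.trans h
      exact_mod_cast this
    · simp [h]
  have h0 : ∀ k, 0 ≤ g k := fun k => by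
    simp only [hg]
    split_ifs <;> positivity
  calc _ ≤ ∑ y, g (l1dist x y) := Finset.sum_le_sum fun y _ => h1 y
    _ ≤ 2 * 3 ^ (d - 1) * ∑ k ∈ Finset.Icc 1 (d * N), (k : ℝ) ^ (d - 1) * g k :=
        sum_l1dist_le hd x g h0 (by simp [hg])
    _ ≤ 2 * 3 ^ (d - 1) * ∑ k ∈ Finset.Icc 1 (d * N),
          (1 + β) * l ^ (-a) * (k : ℝ) ^ ((d : ℝ) - s + a) := by
        refine mul_le_mul_of_nonneg_left (Finset.sum_le_sum fun k hk => ?_) (by positivity)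
        have hk1 : 0 < (k : ℝ) := by exact_mod_cast (Finset.mem_Icc.1 hk).1
        simp only [hg]
        split_ifs with h
        · have h2 : 1 ≤ l ^ (-a) * (k : ℝ) ^ a := by
            rw [Real.rpow_neg hl.le, ← div_eq_inv_mul, le_div_iff₀ (by positivity), one_mul]
            exact Real.rpow_le_rpow hl.le h.le ha
          have h3 : (k : ℝ) ^ ((d : ℝ) - s + a) =
              (k : ℝ) ^ (d - 1) * k * ((k : ℝ) ^ s)⁻¹ * (k : ℝ) ^ a := by
            rw [Real.rpow_add hk1, Real.rpow_sub hk1, Real.rpow_natCast, div_eq_mul_inv,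
              ← pow_succ, Nat.sub_add_cancel hd]
          rw [h3]
          calc (k : ℝ) ^ (d - 1) * ((1 + β) * ((k : ℝ) ^ s)⁻¹ * k)
              = (k : ℝ) ^ (d - 1) * ((1 + β) * ((k : ℝ) ^ s)⁻¹ * k) * 1 := by ring
            _ ≤ (k : ℝ) ^ (d - 1) * ((1 + β) * ((k : ℝ) ^ s)⁻¹ * k) * (l ^ (-a) * (k : ℝ) ^ a) :=
                mul_le_mul_of_nonneg_left h2 (by positivity)
            _ = _ := by ring
        · rw [mul_zero]; positivity
    _ = 2 * 3 ^ (d - 1) * ((1 + β) * l ^ (-a) * ∑ k ∈ Finset.Icc 1 (d * N),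
          (k : ℝ) ^ ((d : ℝ) - s + a)) := by rw [← Finset.mul_sum]
    _ ≤ 2 * 3 ^ (d - 1) * ((1 + β) * l ^ (-a) * K) := by
        gcongr
        exact hK _
    _ = _ := by ring

/-- A geodesic between opposite corners spans distance d N ≥ N. It visits no node twice, so its long
edges are accounted for by the sum over all nodes. -/
lemma mul_le_mul_D_add (hd : 1 ≤ d) {l : ℝ} (hl : 0 ≤ l) {ω : Config d N} (hω : ω ∈ gridOpen d N) :
    (N : ℝ) ≤ l * D ω + ∑ x, longLength l ω x := by
  classical
  obtain ⟨p, hp, hlen⟩ := (connected_graph hω).exists_path_of_dist (0 : Node d N)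
    (fun _ => Fin.last N)
  have h1 := l1dist_le_of_walk hl p
  have h2 : l1dist (0 : Node d N) (fun _ => Fin.last N) = d * N := by simp [l1dist]
  have h3 : (p.support.map (longLength l ω)).sum ≤ ∑ x, longLength l ω x := by
    rw [← List.sum_toFinset _ hp.support_nodup]
    exact Finset.sum_le_sum_of_subset_of_nonneg (Finset.subset_univ _)
      fun _ _ _ => longLength_nonneg _ _ _
  have h4 : (p.length : ℝ) ≤ D ω := by
    rw [hlen]; exact_mod_cast dist_le_D hω _ _
  have h5 : (N : ℝ) ≤ ((d * N : ℕ) : ℝ) := by exact_mod_cast Nat.le_mul_of_pos_left N hd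
  rw [h2] at h1
  have := mul_le_mul_of_nonneg_left h4 hl
  linarith

theorem tendsto_D_lt_rpow (hd : 1 ≤ d) (hβ : 0 < β) (hs : 2 * (d : ℝ) < s) {ψ : ℝ}
    (hψ : ψ < (s - 2 * d) / (s - d - 1)) :
    Tendsto (fun N : ℕ => (configLaw d N s β).real
      {ω | ω ∈ gridOpen d N ∧ (D ω : ℝ) < (N : ℝ) ^ ψ}) atTop (𝓝 0) := by
  have hd1 : (1 : ℝ) ≤ d := by exact_mod_cast hd
  have ha : 0 < s - d - 1 := by linarith
  rw [lt_div_iff₀ ha] at hψ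
  set q := 1 - ψ with hq
  have hqa : (d : ℝ) - 1 < q * (s - d - 1) := by rw [hq]; linarith
  have hq0 : 0 < q := by
    by_contra h
    have : q * (s - d - 1) ≤ 0 := mul_nonpos_of_nonpos_of_nonneg (not_lt.1 h) ha.le
    linarith
  -- The hypothesis on ψ says exactly that (d - 1) / q < s - d - 1, and a is the midpoint. Being
  -- below s - d - 1 it keeps the power sum convergent; being above (d - 1) / q it makes N ^ d l ^
  -- (-a) / N tend to zero.
  set a := (q * (s - d - 1) + (d - 1)) / (2 * q) with ha'
  have ha0 : 0 ≤ a := by positivity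
  have haq : (d : ℝ) - 1 < q * a := by
    rw [ha']; field_simp; linarith
  have has : (d : ℝ) - s + a < -1 := by
    have : a < s - d - 1 := by
      rw [ha', div_lt_iff₀ (by positivity)]; linarith
    linarith
  obtain ⟨K, hK, hK'⟩ := exists_sum_rpow_le has
  set C : ℝ := 2 * 3 ^ (d - 1) * (1 + β) * K * 2 ^ a * 2 ^ d * 2 with hC
  have hlim : Tendsto (fun N : ℕ => C * (N : ℝ) ^ (-(q * a - (d - 1)))) atTop (𝓝 0) := by
    simpa using ((tendsto_rpow_neg_atTop (sub_pos.2 haq)).comp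
      tendsto_natCast_atTop_atTop).const_mul C
  refine squeeze_zero' (Eventually.of_forall fun _ => measureReal_nonneg) ?_ hlim
  filter_upwards [eventually_ge_atTop 1] with N hN
  have hN0 : (0 : ℝ) < N := by exact_mod_cast hN
  have hN1 : (1 : ℝ) ≤ N := by exact_mod_cast hN
  -- With this threshold, short edges of a geodesic with fewer than N ^ ψ steps cover less than N /
  -- 2, so long edges must have total length at least N / 2.
  set l : ℝ := (N : ℝ) ^ q / 2 with hl
  have hl0 : 0 < l := by positivity
  calc (configLaw d N s β).real {ω | ω ∈ gridOpen d N ∧ (D ω : ℝ) < (N : ℝ) ^ ψ}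
      ≤ (configLaw d N s β).real {ω | (N : ℝ) / 2 ≤ ∑ x, longLength l ω x} := by
        refine measureReal_mono ?_
        rintro ω ⟨hω, hD⟩
        have h1 := mul_le_mul_D_add hd hl0.le hω
        have h2 : l * D ω ≤ l * (N : ℝ) ^ ψ := mul_le_mul_of_nonneg_left hD.le hl0.le
        have h3 : l * (N : ℝ) ^ ψ = N / 2 := by
          rw [hl, div_mul_eq_mul_div, ← Real.rpow_add hN0, hq]; simp
        simp only [Set.mem_ofPred_eq]
        linarith
    _ ≤ (∫ ω, ∑ x, longLength l ω x ∂configLaw d N s β) / (N / 2) :=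
        real_le_integral_div _ (fun ω => Finset.sum_nonneg fun _ _ => longLength_nonneg _ _ _)
          (by positivity)
    _ ≤ ((N + 1) ^ d * (2 * 3 ^ (d - 1) * (1 + β) * K * l ^ (-a))) / (N / 2) := by
        gcongr
        rw [integral_finsetSum _ fun _ _ => integrable_config _]
        calc _ ≤ ∑ _x : Node d N, 2 * 3 ^ (d - 1) * (1 + β) * K * l ^ (-a) :=
              Finset.sum_le_sum fun x _ => integral_longLength_le hd hβ.le hl0 ha0 hK' x
          _ = _ := by simp
    _ ≤ ((2 * N) ^ d * (2 * 3 ^ (d - 1) * (1 + β) * K * l ^ (-a))) / (N / 2) := by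
        gcongr; linarith
    _ = C * (N : ℝ) ^ (-(q * a - (d - 1))) := by
        have e1 : l ^ (-a) = 2 ^ a * (N : ℝ) ^ (-(q * a)) := by
          rw [hl, Real.div_rpow (by positivity) (by norm_num), ← Real.rpow_mul hN0.le,
            Real.rpow_neg (by norm_num : (0:ℝ) ≤ 2)]
          field_simp
        have e2 : (N : ℝ) ^ (-(q * a - (d - 1))) = (N : ℝ) ^ (-(q * a)) * (N : ℝ) ^ d / N := by
          rw [show -(q * a - ((d : ℝ) - 1)) = -(q * a) + d - 1 by ring, Real.rpow_sub_one hN0.ne',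
            Real.rpow_add hN0, Real.rpow_natCast]
        rw [e1, e2, hC, mul_pow]
        field_simp

end LongEdges

/-! ### Cut edges on the line for s = 2 -/

section CutEdges

variable {N : ℕ} {β : ℝ}

/-- The node of the one-dimensional box with coordinate `a`. -/
def pt (N a : ℕ) : Node 1 N := fun _ => Fin.ofNat (N + 1) a

lemma pt_val {a : ℕ} (ha : a ≤ N) (i : Fin 1) : (pt N a i : ℕ) = a := by
  simp [pt, Nat.mod_eq_of_lt (Nat.lt_succ_of_le ha)]

lemma pt_coord (x : Node 1 N) : pt N (x 0) = x := by
  funext i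
  rw [Subsingleton.elim i 0]
  simp [pt]

lemma pt_inj {a b : ℕ} (ha : a ≤ N) (hb : b ≤ N) (h : pt N a = pt N b) : a = b := by
  rw [← pt_val ha 0, ← pt_val hb 0, h]

lemma l1dist_pt {a b : ℕ} (hab : a ≤ b) (hb : b ≤ N) : l1dist (pt N a) (pt N b) = b - a := by
  simp only [l1dist, Finset.univ_unique, Finset.sum_singleton]
  rw [pt_val (hab.trans hb), pt_val hb]
  omega

/-- The pairs `a ≤ i`, `j < b` with `a + 2 ≤ b`. -/
def spanIdx (N i j : ℕ) : Finset (ℕ × ℕ) :=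
  (Finset.range (N + 1) ×ˢ Finset.range (N + 1)).filter
    fun p => p.1 ≤ i ∧ j < p.2 ∧ p.1 + 2 ≤ p.2

lemma mem_spanIdx {i j : ℕ} {p : ℕ × ℕ} :
    p ∈ spanIdx N i j ↔ p.2 ≤ N ∧ p.1 ≤ i ∧ j < p.2 ∧ p.1 + 2 ≤ p.2 := by
  simp only [spanIdx, Finset.mem_filter, Finset.mem_product, Finset.mem_range]
  omega

/-- The pairs of nodes on both sides of `(i, j]`, except neighbours. -/
def spanPairs (N i j : ℕ) : Finset (Sym2 (Node 1 N)) :=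
  (spanIdx N i j).image fun p => s(pt N p.1, pt N p.2)

lemma injOn_spanPairs (i j : ℕ) :
    Set.InjOn (fun p : ℕ × ℕ => s(pt N p.1, pt N p.2)) (spanIdx N i j) := by
  intro p hp q hq h
  rw [Finset.mem_coe, mem_spanIdx] at hp hq
  simp only [Sym2.eq_iff] at h
  rcases h with ⟨h1, h2⟩ | ⟨h1, h2⟩
  · exact Prod.ext (pt_inj (by omega) (by omega) h1) (pt_inj (by omega) (by omega) h2)
  · have := pt_inj (N := N) (by omega) (by omega) h1
    have := pt_inj (N := N) (by omega) (by omega) h2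
    omega

/-- A pair that spans both gaps i and j has its left end at most i and its right end beyond j. The
common pairs, the source of the correlation of two cut events, thus have weight governed by the
interval between i and j. -/
lemma spanPairs_inter_subset (i j : ℕ) :
    spanPairs N i i ∩ spanPairs N j j ⊆ spanPairs N i j := by
  intro e he
  rw [Finset.mem_inter] at he
  obtain ⟨p, hp, rfl⟩ := Finset.mem_image.1 he.1
  obtain ⟨q, hq, hpq⟩ := Finset.mem_image.1 he.2
  rw [mem_spanIdx] at hp hq
  have : q = p := by
    -- The parameters N and 0 give an index set that contains all the index pairs in question, so
    -- injectivity applies to p and q at once.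
    refine injOn_spanPairs (N := N) N 0 ?_ ?_ hpq <;> rw [Finset.mem_coe, mem_spanIdx] <;> omega
  subst this
  exact Finset.mem_image_of_mem _ (mem_spanIdx.2 (by omega))

/-- Total intensity of the pairs in `T`. -/
noncomputable def weight (β : ℝ) (T : Finset (Sym2 (Node 1 N))) : ℝ :=
  ∑ e ∈ T, β / (len e : ℝ) ^ (2 : ℝ)

lemma weight_spanPairs (i j : ℕ) :
    weight β (spanPairs N i j) =
      ∑ p ∈ spanIdx N i j, β * (((p.2 - p.1 : ℕ) : ℝ) ^ 2)⁻¹ := by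
  unfold weight spanPairs
  rw [Finset.sum_image (injOn_spanPairs i j)]
  refine Finset.sum_congr rfl fun p hp => ?_
  rw [mem_spanIdx] at hp
  rw [len_mk, l1dist_pt (by omega) hp.1, div_eq_mul_inv]
  norm_num

lemma sum_inv_sq_le {a j n : ℕ} (h : a < j) :
    ∑ b ∈ Finset.Ioc j n, (((b - a : ℕ) : ℝ) ^ 2)⁻¹ ≤ ((j - a : ℕ) : ℝ)⁻¹ := by
  rcases le_total j n with hn | hn
  · have h1 := sum_Ioc_inv_sq_le_sub (α := ℝ) (k := j - a) (n := n - a) (by omega) (by omega)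
    have h2 : ∑ b ∈ Finset.Ioc j n, (((b - a : ℕ) : ℝ) ^ 2)⁻¹ =
        ∑ i ∈ Finset.Ioc (j - a) (n - a), ((i : ℝ) ^ 2)⁻¹ := by
      refine Finset.sum_nbij (fun b => b - a) ?_ ?_ ?_ ?_
      · intro b hb; rw [Finset.mem_Ioc] at *; omega
      · intro b hb c hc hbc
        rw [Finset.mem_coe, Finset.mem_Ioc] at *
        simp only at hbc
        omega
      · intro b hb
        rw [Finset.mem_coe, Finset.mem_Ioc] at hb
        refine ⟨b + a, ?_, by simp⟩
        rw [Finset.mem_coe, Finset.mem_Ioc]; omega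
      · intro b _; rfl
    rw [h2]
    have : (0:ℝ) ≤ ((n - a : ℕ) : ℝ)⁻¹ := by positivity
    linarith
  · rw [Finset.Ioc_eq_empty (by omega)]; simp

lemma weight_spanPairs_le (hβ : 0 ≤ β) {i j : ℕ} (hij : i < j) :
    weight β (spanPairs N i j) ≤ β * ∑ a ∈ Finset.range (i + 1), ((j - a : ℕ) : ℝ)⁻¹ := by
  rw [weight_spanPairs, ← Finset.mul_sum]
  refine mul_le_mul_of_nonneg_left ?_ hβ
  calc _ ≤ ∑ p ∈ Finset.range (i + 1) ×ˢ Finset.Ioc j N, (((p.2 - p.1 : ℕ) : ℝ) ^ 2)⁻¹ := by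
        refine Finset.sum_le_sum_of_subset_of_nonneg ?_ fun _ _ _ => by positivity
        intro p hp
        rw [mem_spanIdx] at hp
        rw [Finset.mem_product, Finset.mem_range, Finset.mem_Ioc]
        omega
    _ ≤ _ := by
        rw [Finset.sum_product]
        refine Finset.sum_le_sum fun a ha => sum_inv_sq_le ?_
        have := Finset.mem_range.1 ha
        omega

lemma sum_range_inv_sub (i : ℕ) :
    ∑ a ∈ Finset.range i, ((i - a : ℕ) : ℝ)⁻¹ = ∑ k ∈ Finset.Icc 1 i, (k : ℝ)⁻¹ := by
  refine Finset.sum_nbij (fun a => i - a) ?_ ?_ ?_ ?_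
  · intro b hb; rw [Finset.mem_range] at hb; rw [Finset.mem_Icc]; omega
  · intro b hb c hc hbc
    rw [Finset.mem_coe, Finset.mem_range] at *
    simp only at hbc
    omega
  · intro b hb
    rw [Finset.mem_coe, Finset.mem_Icc] at hb
    refine ⟨i - b, ?_, ?_⟩
    · rw [Finset.mem_coe, Finset.mem_range]; omega
    · simp only; omega
  · intro b _; rfl

/-- Left ends a < i contribute at most 1 / (i - a) each, a harmonic sum; the left end i only pairs
with nodes from i + 2 on and contributes at most 1. Hence i is a cut with probability at least exp
(-2 β) i ^ (-β) when i ≥ 1. -/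
lemma weight_spanPairs_self_le (hβ : 0 ≤ β) (i : ℕ) :
    weight β (spanPairs N i i) ≤ β * (2 + Real.log i) := by
  rw [weight_spanPairs, ← Finset.mul_sum]
  refine mul_le_mul_of_nonneg_left ?_ hβ
  calc _ ≤ ∑ p ∈ Finset.range i ×ˢ Finset.Ioc i N ∪ {i} ×ˢ Finset.Ioc (i + 1) N,
        (((p.2 - p.1 : ℕ) : ℝ) ^ 2)⁻¹ := by
        refine Finset.sum_le_sum_of_subset_of_nonneg ?_ fun _ _ _ => by positivity
        intro p hp
        rw [mem_spanIdx] at hp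
        rw [Finset.mem_union, Finset.mem_product, Finset.mem_product, Finset.mem_range,
          Finset.mem_Ioc, Finset.mem_Ioc, Finset.mem_singleton]
        omega
    _ ≤ ∑ p ∈ Finset.range i ×ˢ Finset.Ioc i N, (((p.2 - p.1 : ℕ) : ℝ) ^ 2)⁻¹ +
        ∑ p ∈ {i} ×ˢ Finset.Ioc (i + 1) N, (((p.2 - p.1 : ℕ) : ℝ) ^ 2)⁻¹ := by
        rw [← Finset.sum_union_inter]
        have : (0 : ℝ) ≤ ∑ p ∈ Finset.range i ×ˢ Finset.Ioc i N ∩ {i} ×ˢ Finset.Ioc (i + 1) N,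
          (((p.2 - p.1 : ℕ) : ℝ) ^ 2)⁻¹ := Finset.sum_nonneg fun _ _ => by positivity
        linarith
    _ ≤ (1 + Real.log i) + 1 := by
        rw [Finset.sum_product, Finset.sum_product, Finset.sum_singleton]
        refine add_le_add ?_ ?_
        · refine le_trans (Finset.sum_le_sum fun a ha => sum_inv_sq_le (Finset.mem_range.1 ha)) ?_
          rw [sum_range_inv_sub]
          exact sum_Icc_inv_le
        · refine (sum_inv_sq_le (Nat.lt_succ_self i)).trans ?_
          simp
    _ = _ := by ring

/-- The edge `(i, i + 1)` is a cut edge. -/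
def Cut (ω : Config 1 N) (i : ℕ) : Prop := ∀ e ∈ spanPairs N i i, ω e = false

lemma len_of_mem_spanPairs {i j : ℕ} {e : Sym2 (Node 1 N)} (he : e ∈ spanPairs N i j) :
    len e ≠ 1 := by
  obtain ⟨p, hp, rfl⟩ := Finset.mem_image.1 he
  rw [mem_spanIdx] at hp
  rw [len_mk, l1dist_pt (by omega) hp.1]
  omega

lemma real_cut (hβ : 0 ≤ β) (i : ℕ) :
    (configLaw 1 N 2 β).real {ω | Cut ω i} = Real.exp (-weight β (spanPairs N i i)) :=
  real_forall_closed_eq hβ _ fun _ he => len_of_mem_spanPairs he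

/-- Both cuts occur exactly when all pairs in a union are closed. The weight of the union is the sum
of the two weights less that of the intersection, and only the intersection produces the last
factor. -/
lemma real_cut_inter_le (hβ : 0 ≤ β) (i j : ℕ) :
    (configLaw 1 N 2 β).real {ω | Cut ω i ∧ Cut ω j} ≤
      Real.exp (-weight β (spanPairs N i i)) * Real.exp (-weight β (spanPairs N j j)) *
        Real.exp (weight β (spanPairs N i j)) := by
  have h1 : {ω : Config 1 N | Cut ω i ∧ Cut ω j} =
      {ω | ∀ e ∈ spanPairs N i i ∪ spanPairs N j j, ω e = false} := by
    ext ω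
    simp only [Cut, Set.mem_ofPred_eq, Finset.mem_union]
    constructor
    · rintro ⟨h, h'⟩ e (he | he)
      · exact h e he
      · exact h' e he
    · exact fun h => ⟨fun e he => h e (Or.inl he), fun e he => h e (Or.inr he)⟩
  rw [h1, real_forall_closed_eq hβ, ← Real.exp_add, ← Real.exp_add]
  · refine Real.exp_le_exp.2 ?_
    have h2 := Finset.sum_union_inter (s₁ := spanPairs N i i) (s₂ := spanPairs N j j)
      (f := fun e => β / (len e : ℝ) ^ (2 : ℝ))
    have h3 : ∑ e ∈ spanPairs N i i ∩ spanPairs N j j, β / (len e : ℝ) ^ (2 : ℝ) ≤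
        weight β (spanPairs N i j) :=
      Finset.sum_le_sum_of_subset_of_nonneg (spanPairs_inter_subset i j)
        fun _ _ _ => by positivity
    unfold weight at h3 ⊢
    linarith
  · intro e he
    rcases Finset.mem_union.1 he with h | h <;> exact len_of_mem_spanPairs h

open Classical in
/-- The number of cut edges in `I` to the left of a node changes by at most one along an edge. -/
lemma card_cut_le (ω : Config 1 N) (I : Finset ℕ) {u v : Node 1 N} (h : (graph ω).Adj u v) :
    (I.filter fun i => Cut ω i ∧ i < (v 0 : ℕ)).card ≤
      (I.filter fun i => Cut ω i ∧ i < (u 0 : ℕ)).card + 1 := by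
  have hadj : s(u, v) ∈ {e | ω e = true} ∧ u ≠ v := by
    simpa only [graph, SimpleGraph.fromEdgeSet_adj] using h
  -- Moving right by at most one adds at most the gap at u itself. An open jump of length at least
  -- two spans every gap that it passes, so none of these is a cut.
  by_cases hv : (v 0 : ℕ) ≤ u 0 + 1
  · refine (Finset.card_le_card ?_).trans (Finset.card_insert_le (u 0 : ℕ) _)
    intro i hi
    rw [Finset.mem_filter] at hi
    rw [Finset.mem_insert, Finset.mem_filter]
    by_cases h : i = u 0
    · exact Or.inl h
    · exact Or.inr ⟨hi.1, hi.2.1, by omega⟩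
  · refine (Finset.card_le_card ?_).trans (Nat.le_succ _)
    intro i hi
    rw [Finset.mem_filter] at hi ⊢
    refine ⟨hi.1, hi.2.1, ?_⟩
    by_contra hc
    have h1 : s(u, v) ∈ spanPairs N i i := by
      rw [← pt_coord u, ← pt_coord v]
      exact Finset.mem_image_of_mem (fun p : ℕ × ℕ => s(pt N p.1, pt N p.2))
        (a := ((u 0 : ℕ), (v 0 : ℕ))) (mem_spanIdx.2 (by have := (v 0).2; simp only; omega))
    have h2 := hi.2.1 _ h1
    have h3 : ω s(u, v) = true := hadj.1
    rw [h2] at h3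
    exact absurd h3 (by simp)

-- Along a walk from node 0 to node N the number of cuts to the left rises from none to all of them,
-- by at most one at each step.
open Classical in
lemma card_cut_le_D {ω : Config 1 N} (hω : ω ∈ gridOpen 1 N) (I : Finset ℕ) (hI : ∀ i ∈ I, i < N) :
    (I.filter fun i => Cut ω i).card ≤ D ω := by
  have key : ∀ {u v : Node 1 N} (p : (graph ω).Walk u v),
      (I.filter fun i => Cut ω i ∧ i < (v 0 : ℕ)).card ≤
        (I.filter fun i => Cut ω i ∧ i < (u 0 : ℕ)).card + p.length := by
    intro u v p
    induction p with
    | nil => simp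
    | cons h q ih =>
      have := card_cut_le ω I h
      rw [SimpleGraph.Walk.length_cons]
      omega
  obtain ⟨p, hp⟩ := (connected_graph hω).exists_walk_length_eq_dist (pt N 0) (pt N N)
  have h1 := key p
  rw [pt_val le_rfl, pt_val (Nat.zero_le N)] at h1
  have h2 : (I.filter fun i => Cut ω i ∧ i < 0) = ∅ := by simp
  have h3 : (I.filter fun i => Cut ω i ∧ i < N) = I.filter fun i => Cut ω i :=
    Finset.filter_congr fun i hi => by simp [hI i hi]
  rw [h2, h3, Finset.card_empty, hp] at h1
  have := dist_le_D hω (pt N 0) (pt N N)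
  omega

end CutEdges

/-! ### Second moment of the weighted number of cut edges -/

section SecondMoment

variable {N : ℕ} {β : ℝ}

/-- Bernoulli's inequality for the exponent 1 - β, which lies in (0, 1). The right side telescopes,
which bounds the sum of r ^ (-β). -/
lemma one_sub_rpow_le_inv {r : ℕ} (hr : 1 ≤ r) (hβ0 : 0 < β) (hβ1 : β < 1) :
    (1 - β) * (r : ℝ) ^ (-β) ≤ (r : ℝ) ^ (1 - β) - ((r - 1 : ℕ) : ℝ) ^ (1 - β) := by
  have hr0 : (0 : ℝ) < r := by exact_mod_cast hr
  have h1 : (((r - 1 : ℕ) : ℝ)) = r * (1 + -(1 / (r : ℝ))) := by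
    rw [Nat.cast_sub hr]; field_simp; ring
  have hr1 : 1 / (r : ℝ) ≤ 1 := by rw [div_le_one hr0]; exact_mod_cast hr
  have h2 := rpow_one_add_le_one_add_mul_self (s := -(1 / (r : ℝ))) (p := 1 - β)
    (by linarith) (by linarith) (by linarith)
  rw [h1, Real.mul_rpow hr0.le (by linarith)]
  have h3 : (r : ℝ) ^ (1 - β) = (r : ℝ) ^ (-β) * r := by
    rw [← Real.rpow_add_one hr0.ne']; ring_nf
  have h4 := mul_le_mul_of_nonneg_left h2 (Real.rpow_nonneg hr0.le (1 - β))
  have h5 : (r : ℝ) ^ (1 - β) * (1 / r) = (r : ℝ) ^ (-β) := by rw [h3]; field_simp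
  nlinarith

lemma sum_Icc_rpow_neg_le (hβ0 : 0 < β) (hβ1 : β < 1) (n : ℕ) :
    ∑ r ∈ Finset.Icc 1 n, (r : ℝ) ^ (-β) ≤ (n : ℝ) ^ (1 - β) / (1 - β) := by
  rw [le_div_iff₀' (by linarith), Finset.mul_sum]
  induction n with
  | zero => simp; exact Real.rpow_nonneg le_rfl _
  | succ n ih =>
    rw [Finset.sum_Icc_succ_top (by omega)]
    have := one_sub_rpow_le_inv (r := n + 1) (by omega) hβ0 hβ1
    rw [Nat.add_sub_cancel] at this
    linarith

lemma sum_range_inv_sub_le_log {i j : ℕ} (hij : i < j) :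
    ∑ a ∈ Finset.range (i + 1), ((j - a : ℕ) : ℝ)⁻¹ ≤
      ((j - i : ℕ) : ℝ)⁻¹ + Real.log j - Real.log ((j - i : ℕ) : ℝ) := by
  induction i with
  | zero => simp
  | succ i ih =>
    rw [Finset.sum_range_succ]
    have h1 := ih (by omega)
    obtain ⟨m, hm⟩ : ∃ m : ℕ, j - i = m + 1 := ⟨j - i - 1, by omega⟩
    have hm' : j - (i + 1) = m := by omega
    have hm0 : (0 : ℝ) < m := by
      have : 0 < m := by omega
      exact_mod_cast this
    rw [hm] at h1
    rw [hm']
    have h2 := Real.log_le_sub_one_of_pos (x := (m : ℝ) / (m + 1)) (by positivity)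
    rw [Real.log_div hm0.ne' (by positivity)] at h2
    have h3 : (m : ℝ) / (m + 1) - 1 = -((m : ℝ) + 1)⁻¹ := by field_simp; ring
    push_cast at *
    linarith

/-- The left side is the relative covariance of two cut events. The factor i / j records that a
short left part spans little of what j sees, and the power of j / (j - i) records the strong
correlation of nearby cuts. -/
lemma exp_weight_sub_one_le (hβ0 : 0 < β) (hβ1 : β < 1) {i j : ℕ} (hi : 1 ≤ i) (hij : i < j) :
    Real.exp (weight β (spanPairs N i j)) - 1 ≤
      4 * Real.exp β * ((i : ℝ) / j) * ((j : ℝ) / (j - i : ℕ)) ^ β := by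
  set W := weight β (spanPairs N i j)
  have hi0 : (0 : ℝ) < i := by exact_mod_cast hi
  have hj0 : (0 : ℝ) < j := by exact_mod_cast (by omega : 0 < j)
  have hr0 : (0 : ℝ) < (j - i : ℕ) := by exact_mod_cast (by omega : 0 < j - i)
  have hr1 : (1 : ℝ) ≤ (j - i : ℕ) := by exact_mod_cast (by omega : 1 ≤ j - i)
  have hW := weight_spanPairs_le (N := N) hβ0.le hij
  have hq : 1 ≤ (j : ℝ) / (j - i : ℕ) := by
    rw [one_le_div hr0]; exact_mod_cast Nat.sub_le j i
  have hq1 : 1 ≤ ((j : ℝ) / (j - i : ℕ)) ^ β := Real.one_le_rpow hq hβ0.le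
  -- When i is far from j, the weight is at most min (4 i / j, β) and exp W - 1 ≤ W exp W. Otherwise
  -- j ≤ 4 i, so the factor 4 i / j is at least one and the crude bound on exp W suffices.
  by_cases hc : 2 * (i + 1) ≤ j
  · have h1 : ∑ a ∈ Finset.range (i + 1), ((j - a : ℕ) : ℝ)⁻¹ ≤ (i + 1) * ((j - i : ℕ) : ℝ)⁻¹ := by
      calc _ ≤ ∑ _a ∈ Finset.range (i + 1), ((j - i : ℕ) : ℝ)⁻¹ := by
            refine Finset.sum_le_sum fun a ha => ?_
            have : a < i + 1 := Finset.mem_range.1 ha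
            gcongr
            omega
        _ = _ := by simp
    have h2 : ((i : ℝ) + 1) * ((j - i : ℕ) : ℝ)⁻¹ ≤ 4 * (i / j) := by
      rw [← div_eq_mul_inv, ← mul_div_assoc, div_le_div_iff₀ hr0 hj0, Nat.cast_sub hij.le]
      have h3 : (2 * ((i : ℝ) + 1)) ≤ j := by exact_mod_cast hc
      have h4 : (1 : ℝ) ≤ i := by exact_mod_cast hi
      nlinarith
    have h3 : ((i : ℝ) + 1) * ((j - i : ℕ) : ℝ)⁻¹ ≤ 1 := by
      rw [← div_eq_mul_inv, div_le_one hr0]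
      exact_mod_cast (by omega : i + 1 ≤ j - i)
    have hWβ : W ≤ β := by nlinarith
    have hW4 : W ≤ 4 * (i / j) := by
      have : (0 : ℝ) ≤ i / j := by positivity
      nlinarith
    have h5 : Real.exp W - 1 ≤ W * Real.exp W := by
      have h6 := Real.add_one_le_exp (-W)
      have h7 : Real.exp W * Real.exp (-W) = 1 := by rw [← Real.exp_add]; simp
      nlinarith [Real.exp_pos W]
    have h8 : W * Real.exp W ≤ 4 * (i / j) * Real.exp β :=
      mul_le_mul hW4 (Real.exp_le_exp.2 hWβ) (Real.exp_pos _).le (by positivity)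
    calc Real.exp W - 1 ≤ 4 * Real.exp β * ((i : ℝ) / j) * 1 := by linarith
      _ ≤ _ := mul_le_mul_of_nonneg_left hq1 (by positivity)
  · have h1 : W ≤ β + Real.log ((j : ℝ) / (j - i : ℕ)) * β := by
      have := sum_range_inv_sub_le_log hij
      have h2 : ((j - i : ℕ) : ℝ)⁻¹ ≤ 1 := inv_le_one_of_one_le₀ hr1
      rw [Real.log_div hj0.ne' hr0.ne']
      nlinarith
    have h2 : Real.exp W ≤ Real.exp β * ((j : ℝ) / (j - i : ℕ)) ^ β := by
      rw [Real.rpow_def_of_pos (by positivity), ← Real.exp_add]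
      exact Real.exp_le_exp.2 h1
    have h3 : 1 ≤ 4 * ((i : ℝ) / j) := by
      rw [← mul_div_assoc, one_le_div hj0]
      exact_mod_cast (by omega : j ≤ 4 * i)
    calc Real.exp W - 1 ≤ 1 * (Real.exp β * ((j : ℝ) / (j - i : ℕ)) ^ β) := by linarith
      _ ≤ 4 * ((i : ℝ) / j) * (Real.exp β * ((j : ℝ) / (j - i : ℕ)) ^ β) :=
          mul_le_mul_of_nonneg_right h3 (by positivity)
      _ = _ := by ring

/-- Weighted number of cut edges, normalised to have expectation `∑ 1 / i`. -/
noncomputable def cutSum (β : ℝ) (I : Finset ℕ) (ω : Config 1 N) : ℝ :=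
  ∑ i ∈ I, Real.exp (weight β (spanPairs N i i)) / i * {ω : Config 1 N | Cut ω i}.indicator 1 ω

lemma integral_cutSum (hβ : 0 ≤ β) (I : Finset ℕ) :
    ∫ ω : Config 1 N, cutSum β I ω ∂configLaw 1 N 2 β = ∑ i ∈ I, (i : ℝ)⁻¹ := by
  unfold cutSum
  rw [integral_finsetSum _ fun _ _ => integrable_config _]
  refine Finset.sum_congr rfl fun i _ => ?_
  rw [integral_const_mul, integral_indicator_config, real_cut hβ, div_mul_eq_mul_div,
    ← Real.exp_add]
  simp

lemma integral_cutSum_sq (I : Finset ℕ) :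
    ∫ ω : Config 1 N, cutSum β I ω ^ 2 ∂configLaw 1 N 2 β =
      ∑ i ∈ I, ∑ j ∈ I, Real.exp (weight β (spanPairs N i i)) / i *
        (Real.exp (weight β (spanPairs N j j)) / j) *
          (configLaw 1 N 2 β).real {ω | Cut ω i ∧ Cut ω j} := by
  have h : ∀ ω : Config 1 N, cutSum β I ω ^ 2 = ∑ i ∈ I, ∑ j ∈ I,
      Real.exp (weight β (spanPairs N i i)) / i * (Real.exp (weight β (spanPairs N j j)) / j) *
        {ω : Config 1 N | Cut ω i ∧ Cut ω j}.indicator 1 ω := by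
    intro ω
    rw [sq, cutSum, Finset.sum_mul_sum]
    refine Finset.sum_congr rfl fun i _ => Finset.sum_congr rfl fun j _ => ?_
    have : {ω : Config 1 N | Cut ω i ∧ Cut ω j}.indicator (1 : Config 1 N → ℝ) ω =
        {ω : Config 1 N | Cut ω i}.indicator 1 ω * {ω : Config 1 N | Cut ω j}.indicator 1 ω := by
      rw [← Pi.mul_apply, ← Set.inter_indicator_one]; rfl
    rw [this]; ring
  simp_rw [h]
  rw [integral_finsetSum _ fun _ _ => integrable_config _]
  refine Finset.sum_congr rfl fun i _ => ?_
  rw [integral_finsetSum _ fun _ _ => integrable_config _]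
  refine Finset.sum_congr rfl fun j _ => ?_
  rw [integral_const_mul, integral_indicator_config]

/-- The bound on the covariance of two cut edges. -/
noncomputable def cutCov (β : ℝ) (i j : ℕ) : ℝ :=
  if i < j then 4 * Real.exp β * ((j : ℝ) ^ (β - 2) * ((j - i : ℕ) : ℝ) ^ (-β)) else 0

lemma cutCov_nonneg (i j : ℕ) : 0 ≤ cutCov β i j := by
  unfold cutCov; split_ifs <;> positivity

lemma cut_term_le_of_lt (hβ0 : 0 < β) (hβ1 : β < 1) {i j : ℕ} (hi : 1 ≤ i) (hij : i < j) :
    Real.exp (weight β (spanPairs N i i)) / i * (Real.exp (weight β (spanPairs N j j)) / j) *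
      (configLaw 1 N 2 β).real {ω | Cut ω i ∧ Cut ω j} ≤ (i : ℝ)⁻¹ * (j : ℝ)⁻¹ + cutCov β i j := by
  have hi0 : (0 : ℝ) < i := by exact_mod_cast hi
  have hj0 : (0 : ℝ) < j := by exact_mod_cast (by omega : 0 < j)
  have hr0 : (0 : ℝ) < (j - i : ℕ) := by exact_mod_cast (by omega : 0 < j - i)
  have h1 := mul_le_mul_of_nonneg_left (real_cut_inter_le (N := N) hβ0.le i j)
    (show 0 ≤ Real.exp (weight β (spanPairs N i i)) / i *
      (Real.exp (weight β (spanPairs N j j)) / j) by positivity)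
  refine h1.trans ?_
  have e1 : Real.exp (weight β (spanPairs N i i)) / i * (Real.exp (weight β (spanPairs N j j)) / j) *
      (Real.exp (-weight β (spanPairs N i i)) * Real.exp (-weight β (spanPairs N j j)) *
        Real.exp (weight β (spanPairs N i j))) =
      (i : ℝ)⁻¹ * (j : ℝ)⁻¹ * Real.exp (weight β (spanPairs N i j)) := by
    rw [Real.exp_neg, Real.exp_neg]
    field_simp
  rw [e1]
  have h2 := exp_weight_sub_one_le (N := N) hβ0 hβ1 hi hij
  have h3 := mul_le_mul_of_nonneg_left h2 (show 0 ≤ (i : ℝ)⁻¹ * (j : ℝ)⁻¹ by positivity)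
  have e2 : (i : ℝ)⁻¹ * (j : ℝ)⁻¹ * (4 * Real.exp β * ((i : ℝ) / j) *
      ((j : ℝ) / (j - i : ℕ)) ^ β) = cutCov β i j := by
    rw [cutCov, if_pos hij, Real.div_rpow hj0.le hr0.le, Real.rpow_sub hj0, Real.rpow_neg hr0.le]
    norm_num
    field_simp
  rw [e2] at h3
  linarith

lemma cut_term_le (hβ0 : 0 < β) (hβ1 : β < 1) {i j : ℕ} (hi : 1 ≤ i) (hj : 1 ≤ j) :
    Real.exp (weight β (spanPairs N i i)) / i * (Real.exp (weight β (spanPairs N j j)) / j) *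
      (configLaw 1 N 2 β).real {ω | Cut ω i ∧ Cut ω j} ≤ (i : ℝ)⁻¹ * (j : ℝ)⁻¹ +
        (cutCov β i j + cutCov β j i + if i = j then Real.exp (2 * β) * (i : ℝ) ^ (β - 2) else 0) := by
  have h1 := cutCov_nonneg (β := β) i j
  have h2 := cutCov_nonneg (β := β) j i
  rcases lt_trichotomy i j with h | h | h
  · have := cut_term_le_of_lt (N := N) hβ0 hβ1 hi h
    rw [if_neg h.ne]
    linarith
  · subst h
    have hi0 : (0 : ℝ) < i := by exact_mod_cast hi
    have h3 : (configLaw 1 N 2 β).real {ω : Config 1 N | Cut ω i ∧ Cut ω i} =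
        Real.exp (-weight β (spanPairs N i i)) := by
      simp only [and_self]; exact real_cut hβ0.le i
    have h4 : Real.exp (weight β (spanPairs N i i)) ≤ Real.exp (2 * β) * (i : ℝ) ^ β := by
      rw [Real.rpow_def_of_pos hi0, ← Real.exp_add]
      have := weight_spanPairs_self_le (N := N) hβ0.le i
      exact Real.exp_le_exp.2 (by linarith)
    rw [h3, if_pos rfl, Real.exp_neg, Real.rpow_sub hi0]
    have e : Real.exp (weight β (spanPairs N i i)) / i * (Real.exp (weight β (spanPairs N i i)) / i) *
        (Real.exp (weight β (spanPairs N i i)))⁻¹ =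
        Real.exp (weight β (spanPairs N i i)) / (i : ℝ) ^ 2 := by field_simp
    rw [e]
    have h5 : Real.exp (weight β (spanPairs N i i)) / (i : ℝ) ^ 2 ≤
        Real.exp (2 * β) * (i : ℝ) ^ β / (i : ℝ) ^ 2 := by gcongr
    have h6 : (0 : ℝ) ≤ (i : ℝ)⁻¹ * (i : ℝ)⁻¹ := by positivity
    have h7 : (i : ℝ) ^ (2 : ℝ) = (i : ℝ) ^ 2 := by norm_num
    rw [h7, ← mul_div_assoc]
    linarith
  · have := cut_term_le_of_lt (N := N) hβ0 hβ1 hj h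
    have e : {ω : Config 1 N | Cut ω i ∧ Cut ω j} = {ω | Cut ω j ∧ Cut ω i} := by
      ext; exact and_comm
    rw [if_neg h.ne', e]
    linarith

/-- For β < 1 the sum of (j - i) ^ (-β) over i < j is of order j ^ (1 - β), so each j contributes
only O(1 / j) to the variance. -/
lemma sum_cutCov_le (hβ0 : 0 < β) (hβ1 : β < 1) (I : Finset ℕ) (j : ℕ) :
    ∑ i ∈ I, cutCov β i j ≤ 4 * Real.exp β / (1 - β) * (j : ℝ)⁻¹ := by
  rcases Nat.eq_zero_or_pos j with rfl | hj
  · rw [Finset.sum_eq_zero]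
    · simp
    · intro i _; simp [cutCov]
  have hj0 : (0 : ℝ) < j := by exact_mod_cast hj
  have h1 : ∑ i ∈ I, cutCov β i j ≤
      ∑ i ∈ Finset.range j, 4 * Real.exp β * ((j : ℝ) ^ (β - 2) * ((j - i : ℕ) : ℝ) ^ (-β)) := by
    unfold cutCov
    rw [← Finset.sum_filter]
    refine Finset.sum_le_sum_of_subset_of_nonneg ?_ fun _ _ _ => by positivity
    intro i hi
    exact Finset.mem_range.2 (Finset.mem_filter.1 hi).2
  have h2 : ∑ i ∈ Finset.range j, ((j - i : ℕ) : ℝ) ^ (-β) =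
      ∑ r ∈ Finset.Icc 1 j, (r : ℝ) ^ (-β) := by
    refine Finset.sum_nbij (fun a => j - a) ?_ ?_ ?_ ?_
    · intro b hb; rw [Finset.mem_range] at hb; rw [Finset.mem_Icc]; omega
    · intro b hb c hc hbc
      rw [Finset.mem_coe, Finset.mem_range] at *
      simp only at hbc
      omega
    · intro b hb
      rw [Finset.mem_coe, Finset.mem_Icc] at hb
      refine ⟨j - b, ?_, ?_⟩
      · rw [Finset.mem_coe, Finset.mem_range]; omega
      · simp only; omega
    · intro b _; rfl
  refine h1.trans ?_
  rw [← Finset.mul_sum, ← Finset.mul_sum, h2]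
  calc 4 * Real.exp β * ((j : ℝ) ^ (β - 2) * ∑ r ∈ Finset.Icc 1 j, (r : ℝ) ^ (-β))
      ≤ 4 * Real.exp β * ((j : ℝ) ^ (β - 2) * ((j : ℝ) ^ (1 - β) / (1 - β))) := by
        gcongr; exact sum_Icc_rpow_neg_le hβ0 hβ1 j
    _ = 4 * Real.exp β / (1 - β) * ((j : ℝ) ^ (β - 2) * (j : ℝ) ^ (1 - β)) := by ring
    _ = _ := by
        rw [← Real.rpow_add hj0, show β - 2 + (1 - β) = -1 by ring, Real.rpow_neg_one]

/-- The off-diagonal covariances add up to a harmonic sum and the diagonal terms i ^ (β - 2) are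
summable. The variance is thus of smaller order than the squared mean when the latter is of order
(log N) ^ 2. -/
lemma exists_variance_cutSum_le (hβ0 : 0 < β) (hβ1 : β < 1) :
    ∃ K : ℝ, 0 < K ∧ ∀ (N : ℕ) (I : Finset ℕ), I ⊆ Finset.Icc 1 N →
      ∫ ω : Config 1 N, (cutSum β I ω - ∑ i ∈ I, (i : ℝ)⁻¹) ^ 2 ∂configLaw 1 N 2 β ≤
        K * (1 + Real.log N) := by
  obtain ⟨C, hC, hC'⟩ := exists_sum_rpow_le (a := β - 2) (by linarith)
  have hb : 0 < 1 - β := by linarith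
  refine ⟨2 * (4 * Real.exp β / (1 - β)) + Real.exp (2 * β) * C, by positivity, fun N I hI => ?_⟩
  set h := ∑ i ∈ I, (i : ℝ)⁻¹ with hh
  have hI1 : ∀ i ∈ I, 1 ≤ i := fun i hi => (Finset.mem_Icc.1 (hI hi)).1
  have h1 : ∫ ω : Config 1 N, (cutSum β I ω - h) ^ 2 ∂configLaw 1 N 2 β =
      ∫ ω : Config 1 N, cutSum β I ω ^ 2 ∂configLaw 1 N 2 β - h ^ 2 := by
    have e : ∀ ω : Config 1 N, (cutSum β I ω - h) ^ 2 =
        cutSum β I ω ^ 2 - 2 * h * cutSum β I ω + h ^ 2 := fun ω => by ring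
    simp_rw [e]
    rw [integral_add (integrable_config _) (integrable_config _),
      integral_sub (integrable_config _) (integrable_config _), integral_const_mul,
      integral_cutSum hβ0.le, ← hh]
    simp
    ring
  have h2 : ∫ ω : Config 1 N, cutSum β I ω ^ 2 ∂configLaw 1 N 2 β ≤
      h ^ 2 + (2 * ∑ j ∈ I, ∑ i ∈ I, cutCov β i j +
        ∑ i ∈ I, Real.exp (2 * β) * (i : ℝ) ^ (β - 2)) := by
    rw [integral_cutSum_sq]
    refine (Finset.sum_le_sum fun i hi => Finset.sum_le_sum fun j hj =>
      cut_term_le hβ0 hβ1 (hI1 i hi) (hI1 j hj)).trans (le_of_eq ?_)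
    simp only [Finset.sum_add_distrib]
    rw [← Finset.sum_mul_sum, ← hh, Finset.sum_comm (f := fun i j => cutCov β i j)]
    simp only [Finset.sum_ite_eq]
    rw [Finset.sum_congr rfl (g := fun i : ℕ => Real.exp (2 * β) * (i : ℝ) ^ (β - 2))
      (fun i hi => if_pos hi)]
    ring
  have h3 : ∑ j ∈ I, ∑ i ∈ I, cutCov β i j ≤ 4 * Real.exp β / (1 - β) * (1 + Real.log N) := by
    refine (Finset.sum_le_sum fun j _ => sum_cutCov_le hβ0 hβ1 I j).trans ?_
    rw [← Finset.mul_sum]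
    refine mul_le_mul_of_nonneg_left ?_ (by positivity)
    exact (Finset.sum_le_sum_of_subset_of_nonneg hI fun _ _ _ => by positivity).trans sum_Icc_inv_le
  have h4 : ∑ i ∈ I, Real.exp (2 * β) * (i : ℝ) ^ (β - 2) ≤ Real.exp (2 * β) * C := by
    rw [← Finset.mul_sum]
    exact mul_le_mul_of_nonneg_left (hC' I) (by positivity)
  have h5 : 0 ≤ Real.log N := Real.log_natCast_nonneg N
  have h6 : 0 ≤ Real.exp (2 * β) * C * Real.log N := by positivity
  rw [h1]
  nlinarith

theorem tendsto_D_lt_rpow_of_lt_one (hβ0 : 0 < β) (hβ1 : β < 1) :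
    Tendsto (fun N : ℕ => (configLaw 1 N 2 β).real
      {ω | ω ∈ gridOpen 1 N ∧ (D ω : ℝ) < (N : ℝ) ^ ((1 - β) / 2)}) atTop (𝓝 0) := by
  classical
  obtain ⟨K, hK, hK'⟩ := exists_variance_cutSum_le hβ0 hβ1
  have hlog := tendsto_log_natCast
  have hlim : Tendsto (fun N : ℕ => 128 * K * (Real.log N)⁻¹) atTop (𝓝 0) := by
    simpa using (tendsto_inv_atTop_zero.comp hlog).const_mul (128 * K)
  refine squeeze_zero' (Eventually.of_forall fun _ => measureReal_nonneg) ?_ hlim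
  filter_upwards [hlog.eventually_ge_atTop (8 * Real.exp (2 * β)), hlog.eventually_ge_atTop 8,
    eventually_ge_atTop 1] with N hN1 hN2 hN3
  have hN0 : (0 : ℝ) < N := by exact_mod_cast hN3
  have hN0' : (1 : ℝ) ≤ N := by exact_mod_cast hN3
  -- Only cuts beyond the square root of N are counted. This keeps a positive fraction of the
  -- harmonic sum, while each cut has weight at most exp (2 β) n ^ (-(1 - β)).
  set n := ⌈(N : ℝ) ^ (1 / 2 : ℝ)⌉₊ with hn
  have hsq : 1 ≤ (N : ℝ) ^ (1 / 2 : ℝ) := Real.one_le_rpow hN0' (by norm_num)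
  have hn1 : (N : ℝ) ^ (1 / 2 : ℝ) ≤ n := Nat.le_ceil _
  have hn2 : (n : ℝ) ≤ 2 * (N : ℝ) ^ (1 / 2 : ℝ) := by
    have := Nat.ceil_lt_add_one (show 0 ≤ (N : ℝ) ^ (1 / 2 : ℝ) by positivity)
    linarith
  have hn0 : (0 : ℝ) < n := by linarith
  have hlogn : Real.log n ≤ 1 + 1 / 2 * Real.log N := by
    have h1 := Real.log_le_log hn0 hn2
    rw [Real.log_mul (by norm_num) (by positivity), Real.log_rpow hN0] at h1
    have := Real.log_two_lt_d9
    linarith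
  set I := Finset.Icc 1 (N - 1) \ Finset.Icc 1 n with hI
  have hIN : I ⊆ Finset.Icc 1 N := by
    intro i hi
    have := Finset.mem_Icc.1 (Finset.mem_sdiff.1 hi).1
    rw [Finset.mem_Icc]; omega
  have hIn : ∀ i ∈ I, n ≤ i := by
    intro i hi
    rw [hI, Finset.mem_sdiff, Finset.mem_Icc, Finset.mem_Icc] at hi
    omega
  set h := ∑ i ∈ I, (i : ℝ)⁻¹ with hh
  have hlow : 1 / 4 * Real.log N ≤ h := by
    have h1 := Finset.sum_inter_add_sum_sdiff (Finset.Icc 1 (N - 1)) (Finset.Icc 1 n)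
      fun i : ℕ => (i : ℝ)⁻¹
    have h2 : ∑ i ∈ Finset.Icc 1 (N - 1) ∩ Finset.Icc 1 n, (i : ℝ)⁻¹ ≤ 1 + Real.log n :=
      (Finset.sum_le_sum_of_subset_of_nonneg Finset.inter_subset_right
        fun _ _ _ => by positivity).trans sum_Icc_inv_le
    have h3 : Real.log N ≤ ∑ i ∈ Finset.Icc 1 (N - 1), (i : ℝ)⁻¹ := by
      have := log_add_one_le_harmonic (N - 1)
      rw [Nat.sub_add_cancel hN3, harmonic_eq_sum_Icc] at this
      push_cast at this
      exact this
    rw [← hI, ← hh] at h1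
    linarith
  -- With fewer than N ^ ((1 - β) / 2) steps there are too few cuts: the weighted count is at most
  -- exp (2 β), which is at most half its mean h.
  have hsub : {ω : Config 1 N | ω ∈ gridOpen 1 N ∧ (D ω : ℝ) < (N : ℝ) ^ ((1 - β) / 2)} ⊆
      {ω | (h / 2) ^ 2 ≤ (cutSum β I ω - h) ^ 2} := by
    rintro ω ⟨hω, hD⟩
    have h1 : cutSum β I ω ≤ Real.exp (2 * β) * (n : ℝ) ^ (-(1 - β)) *
        (I.filter fun i => Cut ω i).card := by
      rw [Finset.card_filter, Nat.cast_sum, Finset.mul_sum]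
      refine Finset.sum_le_sum fun i hi => ?_
      have hi0 : (0 : ℝ) < i := hn0.trans_le (by exact_mod_cast hIn i hi)
      by_cases hc : Cut ω i
      · rw [Set.indicator_of_mem (by exact hc), if_pos hc]
        simp only [Pi.one_apply, mul_one, Nat.cast_one]
        rw [div_le_iff₀ hi0]
        calc Real.exp (weight β (spanPairs N i i)) ≤ Real.exp (2 * β) * (i : ℝ) ^ β := by
              rw [Real.rpow_def_of_pos hi0, ← Real.exp_add]
              have := weight_spanPairs_self_le (N := N) hβ0.le i
              exact Real.exp_le_exp.2 (by linarith)
          _ = Real.exp (2 * β) * (i : ℝ) ^ (-(1 - β)) * i := by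
              rw [mul_assoc, ← Real.rpow_add_one hi0.ne']; congr 2; ring
          _ ≤ Real.exp (2 * β) * (n : ℝ) ^ (-(1 - β)) * i := by
              refine mul_le_mul_of_nonneg_right (mul_le_mul_of_nonneg_left ?_ (by positivity)) hi0.le
              exact Real.rpow_le_rpow_of_nonpos hn0 (by exact_mod_cast hIn i hi) (by linarith)
      · rw [Set.indicator_of_notMem (by exact hc), if_neg hc]; simp
    have h2 : ((I.filter fun i => Cut ω i).card : ℝ) ≤ (N : ℝ) ^ ((1 - β) / 2) := by
      refine le_trans ?_ hD.le
      have := card_cut_le_D hω I fun i hi => by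
        have := Finset.mem_Icc.1 (Finset.mem_sdiff.1 hi).1
        omega
      exact_mod_cast this
    have h3 : (n : ℝ) ^ (-(1 - β)) * (N : ℝ) ^ ((1 - β) / 2) ≤ 1 := by
      calc (n : ℝ) ^ (-(1 - β)) * (N : ℝ) ^ ((1 - β) / 2)
          ≤ ((N : ℝ) ^ (1 / 2 : ℝ)) ^ (-(1 - β)) * (N : ℝ) ^ ((1 - β) / 2) := by
            gcongr ?_ * _
            exact Real.rpow_le_rpow_of_nonpos (by linarith) hn1 (by linarith)
        _ = 1 := by
            rw [← Real.rpow_mul hN0.le, ← Real.rpow_add hN0]; ring_nf; simp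
    have h4 : cutSum β I ω ≤ Real.exp (2 * β) := by
      calc cutSum β I ω ≤ Real.exp (2 * β) * (n : ℝ) ^ (-(1 - β)) * (N : ℝ) ^ ((1 - β) / 2) :=
            h1.trans (mul_le_mul_of_nonneg_left h2 (by positivity))
        _ = Real.exp (2 * β) * ((n : ℝ) ^ (-(1 - β)) * (N : ℝ) ^ ((1 - β) / 2)) := by ring
        _ ≤ _ := mul_le_of_le_one_right (Real.exp_pos _).le h3
    have h5 : h / 2 ≤ h - cutSum β I ω := by linarith
    have h6 : 0 ≤ h / 2 := by linarith
    simp only [Set.mem_ofPred_eq]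
    nlinarith
  have hpos : 0 < h := by linarith
  calc _ ≤ (configLaw 1 N 2 β).real {ω | (h / 2) ^ 2 ≤ (cutSum β I ω - h) ^ 2} :=
        measureReal_mono hsub
    _ ≤ (∫ ω : Config 1 N, (cutSum β I ω - h) ^ 2 ∂configLaw 1 N 2 β) / (h / 2) ^ 2 :=
        real_le_integral_div _ (fun _ => sq_nonneg _) (by positivity)
    _ ≤ K * (2 * Real.log N) / (1 / 4 * Real.log N / 2) ^ 2 := by
        gcongr
        refine (hK' N I hIN).trans ?_
        gcongr
        linarith
    _ = 128 * K * (Real.log N)⁻¹ := by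
        have : Real.log N ≠ 0 := by linarith
        field_simp
        norm_num

end SecondMoment

/-! ### Connections between sets of nodes and cubes -/

section Connections

variable {d N : ℕ} {s β : ℝ}

/-- Many pairs of bounded length are unlikely to be all closed. -/
lemma real_forall_closed_le_of_len (hs : 0 ≤ s) (hβ : 0 ≤ β) (E : Finset (Sym2 (Node d N))) {R : ℝ}
    (hE : ∀ e ∈ E, 1 ≤ len e ∧ (len e : ℝ) ≤ R) :
    (configLaw d N s β).real {ω | ∀ e ∈ E, ω e = false} ≤ Real.exp (-(β * E.card / R ^ s)) := by
  refine (real_forall_closed_le hβ E).trans (Real.exp_le_exp.2 (neg_le_neg ?_))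
  calc β * E.card / R ^ s = ∑ _e ∈ E, β / R ^ s := by simp; ring
    _ ≤ _ := Finset.sum_le_sum fun e he => by
      have h1 : (1 : ℝ) ≤ len e := by exact_mod_cast (hE e he).1
      have h2 := (hE e he).2
      gcongr

/-- Two disjoint sets of nodes that are not too far apart are unlikely not to be joined. -/
lemma real_not_joined_le (hs : 0 ≤ s) (hβ : 0 ≤ β) (U V : Finset (Node d N)) (hUV : Disjoint U V)
    {R : ℝ} (hR : ∀ u ∈ U, ∀ v ∈ V, (l1dist u v : ℝ) ≤ R) :
    (configLaw d N s β).real {ω | ∀ u ∈ U, ∀ v ∈ V, ω s(u, v) = false} ≤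
      Real.exp (-(β * (U.card * V.card) / R ^ s)) := by
  classical
  have hinj : Set.InjOn (fun p : Node d N × Node d N => s(p.1, p.2)) (U ×ˢ V : Finset _) := by
    intro p hp q hq h
    rw [Finset.mem_coe, Finset.mem_product] at hp hq
    simp only [Sym2.eq_iff] at h
    rcases h with h | h
    · exact Prod.ext h.1 h.2
    · exact absurd (h.1 ▸ hp.1) (fun h' => Finset.disjoint_left.1 hUV h' hq.2)
  have h := real_forall_closed_le_of_len (s := s) (β := β) hs hβ
    ((U ×ˢ V).image fun p => s(p.1, p.2)) (R := R) (by
      intro e he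
      obtain ⟨p, hp, rfl⟩ := Finset.mem_image.1 he
      rw [Finset.mem_product] at hp
      refine ⟨?_, hR _ hp.1 _ hp.2⟩
      rw [len_mk, Nat.one_le_iff_ne_zero]
      intro h0
      exact Finset.disjoint_left.1 hUV hp.1 (l1dist_eq_zero.1 h0 ▸ hp.2))
  rw [Finset.card_image_of_injOn hinj, Finset.card_product] at h
  push_cast at h
  refine le_trans (measureReal_mono ?_) h
  intro ω hω e he
  obtain ⟨p, hp, rfl⟩ := Finset.mem_image.1 he
  rw [Finset.mem_product] at hp
  exact hω _ hp.1 _ hp.2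

lemma card_cube {c : Fin d → ℕ} {L : ℕ} (hc : ∀ i, c i + L ≤ N + 1) :
    (cube N c L).toFinite.toFinset.card = L ^ d := by
  classical
  have h : (cube N c L).toFinite.toFinset = Fintype.piFinset fun i : Fin d =>
      (Finset.univ.filter fun t : Fin (N + 1) => c i ≤ t ∧ (t : ℕ) < c i + L) := by
    ext x; simp [cube]
  rw [h, Fintype.card_piFinset]
  calc _ = ∏ _i : Fin d, L := Finset.prod_congr rfl fun i _ => ?_
    _ = _ := by simp
  have : (Finset.univ.filter fun t : Fin (N + 1) => c i ≤ t ∧ (t : ℕ) < c i + L).card =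
      (Finset.Ico (c i) (c i + L)).card := by
    refine Finset.card_nbij (fun t => (t : ℕ)) ?_ ?_ ?_
    · intro t ht
      simpa using ht
    · intro t _ r _ h
      exact Fin.ext h
    · intro t ht
      rw [Finset.mem_coe, Finset.mem_Ico] at ht
      exact ⟨⟨t, by have := hc i; omega⟩, by simpa using ht, rfl⟩
  rw [this]; simp

/-- Every node of a cube lies in a subcube of prescribed side length. -/
lemma exists_subcube {c : Fin d → ℕ} {L L' : ℕ} (hc : ∀ i, c i + L ≤ N + 1) (hL0 : 1 ≤ L')
    (hL : L' ≤ L) {x : Node d N} (hx : x ∈ cube N c L) :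
    ∃ c' : Node d N, (∀ i, (c' i : ℕ) + L' ≤ N + 1) ∧ x ∈ cube N (fun i => c' i) L' ∧
      cube N (fun i => (c' i : ℕ)) L' ⊆ cube N c L := by
  refine ⟨fun i => ⟨min (x i) (c i + L - L'), by have := (x i).2; omega⟩, fun i => ?_, fun i => ?_,
    fun y hy i => ?_⟩
  · have := hc i
    simp only
    omega
  · have := hx i
    simp only
    omega
  · have := hx i
    have := hy i
    simp only at this
    omega

end Connections

/-! ### Recursion over scales -/

section PolyLog

variable {d N : ℕ} {s β : ℝ}

/-- Any two cubes of side `L'` in a common cube of side `L` meet or are joined. -/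
def GoodScale (ω : Config d N) (L L' : ℕ) : Prop :=
  ∀ a b : Node d N, (∀ i, (a i : ℕ) + L' ≤ N + 1) → (∀ i, (b i : ℕ) + L' ≤ N + 1) →
    (∀ u ∈ cube N (fun i => (a i : ℕ)) L', ∀ v ∈ cube N (fun i => (b i : ℕ)) L',
      l1dist u v ≤ d * L) →
    ∃ u ∈ cube N (fun i => (a i : ℕ)) L', ∃ v ∈ cube N (fun i => (b i : ℕ)) L',
      u = v ∨ ω s(u, v) = true

/-- A union bound over the corners of the two cubes. Cubes that meet are never bad; disjoint ones
offer L' ^ (2d) pairs, each of length at most d L. -/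
lemma real_not_goodScale_le (hs : 0 ≤ s) (hβ : 0 ≤ β) (L L' : ℕ) :
    (configLaw d N s β).real {ω | ¬ GoodScale ω L L'} ≤
      ((N : ℝ) + 1) ^ (2 * d) * Real.exp (-(β * (L' : ℝ) ^ (2 * d) / ((d : ℝ) * L) ^ s)) := by
  classical
  let bad : Node d N × Node d N → Set (Config d N) := fun p =>
    {ω | ((∀ i, (p.1 i : ℕ) + L' ≤ N + 1) ∧ (∀ i, (p.2 i : ℕ) + L' ≤ N + 1) ∧
      (∀ u ∈ cube N (fun i => (p.1 i : ℕ)) L', ∀ v ∈ cube N (fun i => (p.2 i : ℕ)) L',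
        l1dist u v ≤ d * L)) ∧
      ¬ ∃ u ∈ cube N (fun i => (p.1 i : ℕ)) L', ∃ v ∈ cube N (fun i => (p.2 i : ℕ)) L',
        u = v ∨ ω s(u, v) = true}
  have hsub : {ω : Config d N | ¬ GoodScale ω L L'} ⊆ ⋃ p ∈ (Finset.univ : Finset _), bad p := by
    intro ω hω
    simp only [GoodScale, Set.mem_ofPred_eq, not_forall] at hω
    obtain ⟨a, b, h1, h2, h3, h4⟩ := hω
    simp only [Finset.mem_univ, Set.iUnion_true, Set.mem_iUnion]
    exact ⟨(a, b), ⟨h1, h2, h3⟩, h4⟩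
  refine (measureReal_mono hsub (measure_ne_top _ _)).trans
    ((measureReal_biUnion_finset_le _ _).trans ?_)
  calc _ ≤ ∑ _p : Node d N × Node d N,
        Real.exp (-(β * (L' : ℝ) ^ (2 * d) / ((d : ℝ) * L) ^ s)) := Finset.sum_le_sum fun p _ => ?_
    _ = _ := by simp [pow_mul', sq]
  by_cases hp : (∀ i, (p.1 i : ℕ) + L' ≤ N + 1) ∧ (∀ i, (p.2 i : ℕ) + L' ≤ N + 1) ∧
      (∀ u ∈ cube N (fun i => (p.1 i : ℕ)) L', ∀ v ∈ cube N (fun i => (p.2 i : ℕ)) L',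
        l1dist u v ≤ d * L)
  swap
  · rw [show bad p = ∅ from Set.eq_empty_of_forall_notMem fun ω h => hp h.1, measureReal_empty]
    positivity
  by_cases hm : Disjoint (cube N (fun i => (p.1 i : ℕ)) L') (cube N (fun i => (p.2 i : ℕ)) L')
  swap
  · obtain ⟨w, h1, h2⟩ := Set.not_disjoint_iff.1 hm
    rw [show bad p = ∅ from Set.eq_empty_of_forall_notMem fun ω h =>
      h.2 ⟨w, h1, w, h2, Or.inl rfl⟩, measureReal_empty]
    positivity
  have h := real_not_joined_le (s := s) (β := β) hs hβ
    (cube N (fun i => (p.1 i : ℕ)) L').toFinite.toFinset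
    (cube N (fun i => (p.2 i : ℕ)) L').toFinite.toFinset (by simpa using hm) (R := d * L) (by
      intro u hu v hv
      exact_mod_cast hp.2.2 u (by simpa using hu) v (by simpa using hv))
  rw [card_cube hp.1, card_cube hp.2.1] at h
  push_cast at h
  rw [← pow_add, ← two_mul] at h
  refine le_trans (measureReal_mono ?_) h
  intro ω hω u hu v hv
  by_contra hc
  exact hω.2 ⟨u, by simpa using hu, v, by simpa using hv, Or.inr (by simpa using hc)⟩

/-- Good scales allow to bound distances by recursion over scales. -/
lemma dist_le_of_goodScale {ω : Config d N} {f : ℕ → ℕ} {g : ℕ → ℝ} {Λ : ℕ}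
    (hf : ∀ L, Λ ≤ L → 1 ≤ f L ∧ f L < L) (hgood : ∀ L, Λ ≤ L → L ≤ N + 1 → GoodScale ω L (f L))
    (hg0 : ∀ L < Λ, ((d * L : ℕ) : ℝ) ≤ g L) (hg : ∀ L, Λ ≤ L → 2 * g (f L) + 1 ≤ g L) (L : ℕ) :
    ∀ c : Fin d → ℕ, (∀ i, c i + L ≤ N + 1) → L ≤ N + 1 → ∀ x ∈ cube N c L, ∀ y ∈ cube N c L,
      ((boxGraph ω Set.univ).dist x y : ℝ) ≤ g L := by
  induction L using Nat.strong_induction_on with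
  | _ L ih =>
    intro c hc hLN x hx y hy
    by_cases hL : L < Λ
    · refine le_trans ?_ (hg0 L hL)
      exact_mod_cast (dist_univ_le ω (reachable_cube ω hx hy)).trans (dist_cube_le ω hx hy)
    · push Not at hL
      obtain ⟨hf1, hf2⟩ := hf L hL
      obtain ⟨a, ha, hxa, hsa⟩ := exists_subcube hc hf1 hf2.le hx
      obtain ⟨b, hb, hyb, hsb⟩ := exists_subcube hc hf1 hf2.le hy
      obtain ⟨u, hu, v, hv, huv⟩ := hgood L hL hLN a b ha hb fun u hu v hv =>
        l1dist_le_of_mem_cube (hsa hu) (hsb hv)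
      have h1 := ih (f L) hf2 _ ha (by omega) x hxa u hu
      have h2 := ih (f L) hf2 _ hb (by omega) v hv y hyb
      have h3 : (boxGraph ω Set.univ).dist u v ≤ 1 := by
        by_cases huv' : u = v
        · rw [huv', SimpleGraph.dist_self]; omega
        · have : (boxGraph ω Set.univ).Adj u v :=
            ⟨huv', trivial, trivial, Or.inr (huv.resolve_left huv')⟩
          exact (SimpleGraph.dist_eq_one_iff_adj.2 this).le
      have hconn := connected_boxGraph_univ ω
      have h4 : (boxGraph ω Set.univ).dist x y ≤ (boxGraph ω Set.univ).dist x u + 1 +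
          (boxGraph ω Set.univ).dist v y := by
        have := hconn.dist_triangle (u := x) (v := u) (w := y)
        have := hconn.dist_triangle (u := u) (v := v) (w := y)
        omega
      have h5 : ((boxGraph ω Set.univ).dist x y : ℝ) ≤ (boxGraph ω Set.univ).dist x u + 1 +
          (boxGraph ω Set.univ).dist v y := by exact_mod_cast h4
      have := hg L hL
      linarith

end PolyLog

/-! ### Polylogarithmic upper bound for d < s < 2d -/

section PolyLogBound

variable {d : ℕ} {s β : ℝ}

/-- An exponent of order (log N) ^ 2 beats any polynomial number of events; the union bounds of the
upper estimates draw on this. -/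
lemma tendsto_pow_mul_exp_neg_log_sq (m : ℕ) {κ : ℝ} (hκ : 0 < κ) :
    Tendsto (fun N : ℕ => ((N : ℝ) + 2) ^ m * Real.exp (-(κ * Real.log N ^ 2))) atTop (𝓝 0) := by
  have hlim : Tendsto (fun N : ℕ => Real.exp (-Real.log N)) atTop (𝓝 0) :=
    Real.tendsto_exp_neg_atTop_nhds_zero.comp tendsto_log_natCast
  refine squeeze_zero' (Eventually.of_forall fun _ => by positivity) ?_ hlim
  filter_upwards [tendsto_log_natCast.eventually_ge_atTop ((2 * m + 1) / κ),
    eventually_ge_atTop 2] with N hN hN2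
  have hN2' : (2 : ℝ) ≤ N := by exact_mod_cast hN2
  have hlog : 0 ≤ Real.log N := Real.log_natCast_nonneg N
  have h1 : ((N : ℝ) + 2) ^ m ≤ Real.exp (2 * m * Real.log N) := by
    calc ((N : ℝ) + 2) ^ m ≤ ((N : ℝ) ^ 2) ^ m := by gcongr; nlinarith
      _ = Real.exp (2 * m * Real.log N) := by
        rw [← pow_mul, ← Real.rpow_natCast, Real.rpow_def_of_pos (by linarith)]
        push_cast; ring_nf
  calc _ ≤ Real.exp (2 * m * Real.log N) * Real.exp (-(κ * Real.log N ^ 2)) := by gcongr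
    _ = Real.exp (2 * m * Real.log N - κ * Real.log N ^ 2) := by
        rw [← Real.exp_add, sub_eq_add_neg]
    _ ≤ Real.exp (-Real.log N) := by
        refine Real.exp_le_exp.2 ?_
        rw [div_le_iff₀ hκ] at hN
        nlinarith

/-- The margin between γ and γ' absorbs the rounding of L ^ γ, so that passing to the next scale
multiplies the logarithm by at most γ'. -/
lemma eventually_ceil_rpow {γ γ' : ℝ} (hγ0 : 0 < γ) (hγ : γ < γ') (hγ' : γ' < 1) :
    ∀ᶠ L : ℕ in atTop, 1 ≤ ⌈(L : ℝ) ^ γ⌉₊ ∧ ⌈(L : ℝ) ^ γ⌉₊ < L ∧ 1 ≤ γ' * Real.log L ∧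
      Real.log (⌈(L : ℝ) ^ γ⌉₊ : ℝ) ≤ γ' * Real.log L := by
  have h1 : Tendsto (fun L : ℕ => (L : ℝ) ^ (γ' - γ)) atTop atTop :=
    (tendsto_rpow_atTop (by linarith)).comp tendsto_natCast_atTop_atTop
  have h2 : Tendsto (fun L : ℕ => γ' * Real.log L) atTop atTop :=
    tendsto_log_natCast.const_mul_atTop (by linarith)
  filter_upwards [h1.eventually_ge_atTop 2, h2.eventually_ge_atTop 1, eventually_ge_atTop 2]
    with L hL1 hL2 hL3
  have hL0 : (1 : ℝ) < L := by exact_mod_cast hL3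
  have hpow : 1 ≤ (L : ℝ) ^ γ := Real.one_le_rpow hL0.le hγ0.le
  have h3 : (⌈(L : ℝ) ^ γ⌉₊ : ℝ) ≤ (L : ℝ) ^ γ' := by
    have h4 := Nat.ceil_lt_add_one (show 0 ≤ (L : ℝ) ^ γ by positivity)
    have h5 : (L : ℝ) ^ γ' = (L : ℝ) ^ (γ' - γ) * (L : ℝ) ^ γ := by
      rw [← Real.rpow_add (by linarith)]; ring_nf
    nlinarith
  have h6 : (1 : ℝ) ≤ ⌈(L : ℝ) ^ γ⌉₊ := hpow.trans (Nat.le_ceil _)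
  refine ⟨by exact_mod_cast h6, ?_, hL2, ?_⟩
  · have h7 : (L : ℝ) ^ γ' < (L : ℝ) ^ (1 : ℝ) := Real.rpow_lt_rpow_of_exponent_lt hL0 hγ'
    rw [Real.rpow_one] at h7
    exact_mod_cast h3.trans_lt h7
  · have := Real.log_le_log (by linarith) h3
    rwa [Real.log_rpow (by linarith)] at this

/-- Since γ ^ δ = 1 / 2, the function C (log L) ^ δ is halved when log L is multiplied by γ;
subtracting 1 from it absorbs the connecting edge in 2 g(f L) + 1 ≤ g(L). The factor C = d Λ + 1
covers the scales below Λ, where grid paths are used. -/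
lemma D_le_of_goodScale {N : ℕ} {ω : Config d N} (hω : ω ∈ gridOpen d N) {f : ℕ → ℕ} {Λ : ℕ}
    {γ δ : ℝ} (hγ : 0 ≤ γ) (hδ : 0 ≤ δ) (hγδ : γ ^ δ = 1 / 2)
    (hf : ∀ L, Λ ≤ L → 1 ≤ f L ∧ f L < L ∧ 1 ≤ γ * Real.log L ∧
      Real.log (f L : ℝ) ≤ γ * Real.log L)
    (hgood : ∀ L, Λ ≤ L → L ≤ N + 1 → GoodScale ω L (f L)) :
    (D ω : ℝ) ≤ (d * Λ + 1) * (max 1 (Real.log ((N + 1 : ℕ) : ℝ))) ^ δ := by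
  have hB : (0 : ℝ) ≤ d * Λ := by positivity
  have key := dist_le_of_goodScale
    (g := fun L => ((d : ℝ) * Λ + 1) * (max 1 (Real.log L)) ^ δ - 1) (f := f) (Λ := Λ)
    (fun L hL => ⟨(hf L hL).1, (hf L hL).2.1⟩) hgood
    (fun L hL => by
      have h1 : (1 : ℝ) ≤ (max 1 (Real.log L)) ^ δ :=
        Real.one_le_rpow (le_max_left _ _) hδ
      have h2 : ((d * L : ℕ) : ℝ) ≤ d * Λ := by
        exact_mod_cast Nat.mul_le_mul_left d hL.le
      have h3 := mul_le_mul_of_nonneg_left h1 (by linarith : (0 : ℝ) ≤ d * Λ + 1)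
      linarith)
    (fun L hL => by
      obtain ⟨-, -, h3, h4⟩ := hf L hL
      have hlogL : 0 ≤ Real.log L := Real.log_natCast_nonneg L
      have h5 : (max 1 (Real.log (f L))) ^ δ ≤ (γ * Real.log L) ^ δ :=
        Real.rpow_le_rpow (by positivity) (max_le h3 h4) hδ
      rw [Real.mul_rpow hγ hlogL, hγδ] at h5
      have h6 : Real.log L ^ δ ≤ (max 1 (Real.log L)) ^ δ :=
        Real.rpow_le_rpow hlogL (le_max_right _ _) hδ
      have h7 := mul_le_mul_of_nonneg_left (h5.trans
        (mul_le_mul_of_nonneg_left h6 (by norm_num))) (by linarith : (0 : ℝ) ≤ d * Λ + 1)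
      linarith)
  obtain ⟨x, y, hxy⟩ := exists_dist_eq_D ω
  have h1 := key (N + 1) (fun _ => 0) (by simp) le_rfl x (by simp [cube_univ]) y
    (by simp [cube_univ])
  rw [← graph_eq_boxGraph hω, hxy] at h1
  linarith

/-- At scale L the exponent is of order L ^ θ, and the lower bound on Λ makes this at least (log N)
^ 2 for every L ≥ Λ, enough for a union bound over scales. -/
lemma real_exists_not_goodScale_le (hd : 1 ≤ d) (hs : 0 < s) (hβ : 0 < β) {N : ℕ} {γ θ : ℝ}
    (hθ : θ = 2 * d * γ - s) (hθ0 : 0 < θ) (Λ : ℕ) (hΛ : Real.log N ^ (2 / θ) ≤ Λ) (hΛ1 : 1 ≤ Λ) :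
    (configLaw d N s β).real
      (⋃ L ∈ Finset.Icc Λ (N + 1), {ω | ¬ GoodScale ω L ⌈(L : ℝ) ^ γ⌉₊}) ≤
      ((N : ℝ) + 2) ^ (2 * d + 1) * Real.exp (-(β / (d : ℝ) ^ s * Real.log N ^ 2)) := by
  have hd0 : (0 : ℝ) < d := by exact_mod_cast hd
  have hlog : 0 ≤ Real.log N := Real.log_natCast_nonneg N
  calc _ ≤ ∑ L ∈ Finset.Icc Λ (N + 1),
        (configLaw d N s β).real {ω | ¬ GoodScale ω L ⌈(L : ℝ) ^ γ⌉₊} :=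
        measureReal_biUnion_finset_le _ _
    _ ≤ ∑ _L ∈ Finset.Icc Λ (N + 1), ((N : ℝ) + 2) ^ (2 * d) *
          Real.exp (-(β / (d : ℝ) ^ s * Real.log N ^ 2)) := by
        refine Finset.sum_le_sum fun L hL => (real_not_goodScale_le hs.le hβ.le L _).trans ?_
        have hLΛ : (Λ : ℝ) ≤ L := by exact_mod_cast (Finset.mem_Icc.1 hL).1
        have hL0 : (0 : ℝ) < L := by
          have : (1 : ℝ) ≤ Λ := by exact_mod_cast hΛ1
          linarith
        have h1 : (L : ℝ) ^ (2 * d * γ) ≤ (⌈(L : ℝ) ^ γ⌉₊ : ℝ) ^ (2 * d) := by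
          have h2 : (L : ℝ) ^ γ ≤ ⌈(L : ℝ) ^ γ⌉₊ := Nat.le_ceil _
          calc (L : ℝ) ^ (2 * d * γ) = ((L : ℝ) ^ γ) ^ (2 * d) := by
                rw [← Real.rpow_natCast, ← Real.rpow_mul hL0.le]; push_cast; ring_nf
            _ ≤ _ := pow_le_pow_left₀ (by positivity) h2 _
        have h2 : Real.log N ^ 2 ≤ (L : ℝ) ^ θ := by
          calc Real.log N ^ 2 = (Real.log N ^ (2 / θ)) ^ θ := by
                rw [← Real.rpow_mul hlog, div_mul_cancel₀ _ hθ0.ne']; norm_num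
            _ ≤ (L : ℝ) ^ θ := Real.rpow_le_rpow (by positivity) (hΛ.trans hLΛ) hθ0.le
        gcongr
        · linarith
        · calc β / (d : ℝ) ^ s * Real.log N ^ 2 ≤ β / (d : ℝ) ^ s * (L : ℝ) ^ θ := by gcongr
            _ = β * (L : ℝ) ^ (2 * d * γ) / (d * L) ^ s := by
              rw [Real.mul_rpow hd0.le hL0.le, hθ, Real.rpow_sub hL0]
              field_simp
            _ ≤ _ := by gcongr
    _ ≤ _ := by
        rw [Finset.sum_const, nsmul_eq_mul, Nat.card_Icc, ← mul_assoc, pow_succ' _ (2 * d)]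
        refine mul_le_mul_of_nonneg_right (mul_le_mul_of_nonneg_right ?_ (by positivity))
          (Real.exp_pos _).le
        have : ((N + 1 + 1 - Λ : ℕ) : ℝ) ≤ ((N + 2 : ℕ) : ℝ) := by
          exact_mod_cast (by omega : N + 1 + 1 - Λ ≤ N + 2)
        push_cast at this ⊢
        linarith

theorem tendsto_log_rpow_lt_D (hd : 1 ≤ d) (hβ : 0 < β) (hs1 : (d : ℝ) < s) (hs2 : s < 2 * d) :
    ∃ δ : ℝ, 1 < δ ∧ Tendsto (fun N : ℕ => (configLaw d N s β).real
      {ω | ω ∈ gridOpen d N ∧ Real.log N ^ δ < (D ω : ℝ)}) atTop (𝓝 0) := by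
  have hd0 : (0 : ℝ) < d := by exact_mod_cast hd
  have hd1 : (1 : ℝ) ≤ d := by exact_mod_cast hd
  have hs0 : 0 < s := hd0.trans hs1
  -- The midpoint of s / (2d) and 1; the condition s < 2d leaves room for γ < 1 with 2dγ > s.
  obtain ⟨γ, hγ0, hγ1, hγs⟩ : ∃ γ : ℝ, 0 < γ ∧ γ < 1 ∧ 0 < 2 * d * γ - s := by
    refine ⟨(1 + s / (2 * d)) / 2, by positivity, ?_, ?_⟩
    · have : s / (2 * d) < 1 := by rw [div_lt_one (by linarith)]; exact hs2
      linarith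
    · have : 2 * d * ((1 + s / (2 * d)) / 2) = d + s / 2 := by field_simp
      rw [this]; linarith
  obtain ⟨γ', hγ', hγ'1⟩ := exists_between hγ1
  have hγ'0 : 0 < γ' := hγ0.trans hγ'
  obtain ⟨δ', hδ'0, hγδ⟩ : ∃ δ' : ℝ, 0 < δ' ∧ γ' ^ δ' = 1 / 2 := by
    have hlogγ : Real.log γ' < 0 := Real.log_neg hγ'0 hγ'1
    refine ⟨Real.log 2 / (-Real.log γ'), div_pos (Real.log_pos (by norm_num)) (by linarith), ?_⟩
    rw [Real.rpow_def_of_pos hγ'0, show Real.log γ' * (Real.log 2 / -Real.log γ') =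
      -Real.log 2 by rw [div_neg, mul_neg, mul_div_cancel₀ _ hlogγ.ne], Real.exp_neg,
      Real.exp_log (by norm_num)]
    norm_num
  obtain ⟨θ, hθ⟩ : ∃ θ, θ = 2 * d * γ - s := ⟨_, rfl⟩
  rw [← hθ] at hγs
  obtain ⟨A, hA⟩ : ∃ A, A = 2 / θ := ⟨_, rfl⟩
  have hA0 : 0 < A := by rw [hA]; positivity
  obtain ⟨L₀, hL₀⟩ := eventually_atTop.1 (eventually_ceil_rpow hγ0 hγ' hγ'1)
  -- A comes from the smallest scale (log N) ^ A, δ' from the recursion, and the extra 1 absorbs all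
  -- constant factors.
  refine ⟨A + δ' + 1, by linarith, squeeze_zero'
    (Eventually.of_forall fun _ => measureReal_nonneg) ?_
    (tendsto_pow_mul_exp_neg_log_sq (2 * d + 1) (show 0 < β / (d : ℝ) ^ s by positivity))⟩
  have hΛ : Tendsto (fun N : ℕ => Real.log N ^ A) atTop atTop :=
    (tendsto_rpow_atTop hA0).comp tendsto_log_natCast
  filter_upwards [hΛ.eventually_ge_atTop (L₀ + 1), tendsto_log_natCast.eventually_ge_atTop 1,
    tendsto_log_natCast.eventually_ge_atTop (3 * d * 2 ^ δ'), eventually_ge_atTop 2]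
    with N hN1 hN2 hN3 hN4
  have hN0 : (2 : ℝ) ≤ N := by exact_mod_cast hN4
  obtain ⟨X, hX⟩ : ∃ X, X = Real.log N ^ A := ⟨_, rfl⟩
  have hX1 : (1 : ℝ) ≤ X := by rw [hX]; exact Real.one_le_rpow hN2 hA0.le
  have hXΛ : X ≤ ⌈X⌉₊ := Nat.le_ceil _
  have hΛ2 : (⌈X⌉₊ : ℝ) ≤ 2 * X := by
    have := Nat.ceil_lt_add_one (show 0 ≤ X by linarith)
    linarith
  have hΛ0 : L₀ ≤ ⌈X⌉₊ := by
    have : (L₀ : ℝ) ≤ ⌈X⌉₊ := by linarith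
    exact_mod_cast this
  refine le_trans (measureReal_mono ?_ (measure_ne_top _ _))
    (real_exists_not_goodScale_le hd hs0 hβ hθ hγs ⌈X⌉₊ (by rw [← hA, ← hX]; exact hXΛ)
      (Nat.one_le_ceil_iff.2 (by linarith)))
  rintro ω ⟨hω, hD⟩
  by_contra hc
  refine absurd ?_ (not_le.2 hD)
  have h1 := D_le_of_goodScale hω hγ'0.le hδ'0.le hγδ (Λ := ⌈X⌉₊)
    (fun L hL => hL₀ L (hΛ0.trans hL)) fun L h1 h2 => by
      by_contra hc'
      exact hc (Set.mem_biUnion (x := L) (by simp only [Finset.coe_Icc, Set.mem_Icc]; exact ⟨h1, h2⟩) hc')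
  refine h1.trans ?_
  have hlog2 : max 1 (Real.log ((N + 1 : ℕ) : ℝ)) ≤ 2 * Real.log N := by
    refine max_le (by linarith) ?_
    rw [← Real.log_rpow (by linarith)]
    refine Real.log_le_log (by positivity) ?_
    push_cast
    norm_num
    nlinarith
  have h2 : (max 1 (Real.log ((N + 1 : ℕ) : ℝ))) ^ δ' ≤ 2 ^ δ' * Real.log N ^ δ' := by
    rw [← Real.mul_rpow (by norm_num) (by linarith)]
    exact Real.rpow_le_rpow (by positivity) hlog2 hδ'0.le
  have h3 : (d : ℝ) * ⌈X⌉₊ + 1 ≤ 3 * d * X := by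
    have h4 := mul_le_mul_of_nonneg_left hΛ2 hd0.le
    have h5 : 1 ≤ d * X := one_le_mul_of_one_le_of_one_le hd1 hX1
    linarith
  calc _ ≤ (3 * d * X) * (2 ^ δ' * Real.log N ^ δ') :=
        mul_le_mul h3 h2 (by positivity) (by positivity)
    _ = (3 * d * 2 ^ δ') * (Real.log N ^ A * Real.log N ^ δ') := by rw [hX]; ring
    _ ≤ Real.log N * (Real.log N ^ A * Real.log N ^ δ') :=
        mul_le_mul_of_nonneg_right hN3 (by positivity)
    _ = Real.log N ^ (A + δ' + 1) := by
      rw [Real.rpow_add_one (by linarith), Real.rpow_add (by linarith)]; ring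

end PolyLogBound

/-! ### Expected distances in cubes and traversal of rows -/

section Renormalization

variable {d N : ℕ} {s β : ℝ}

/-- Distance inside a cube. -/
noncomputable def cdist (ω : Config d N) (c : Fin d → ℕ) (L : ℕ) (x y : Node d N) : ℝ :=
  ((boxGraph ω (cube N c L)).dist x y : ℝ)

lemma cdist_nonneg (ω : Config d N) (c : Fin d → ℕ) (L : ℕ) (x y : Node d N) :
    0 ≤ cdist ω c L x y := Nat.cast_nonneg _

lemma dependsOn_cdist (c : Fin d → ℕ) (L : ℕ) (x y : Node d N) :
    DependsOn (fun ω : Config d N => cdist ω c L x y) {e | ∀ z ∈ e, z ∈ cube N c L} := by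
  intro ω ω' h
  have := dependsOn_boxGraph (cube N c L) h
  simp only at this
  simp only [cdist, this]

/-- A bound for the expected distance inside cubes of side `L` of nodes on a common line. -/
def AxisBound (d N : ℕ) (s β : ℝ) (L : ℕ) (T : ℝ) : Prop :=
  ∀ c : Fin d → ℕ, (∀ i, c i + L ≤ N + 1) → ∀ (x : Node d N) (i : Fin d) (t r : ℕ), t ≤ N → r ≤ N →
    line x i t ∈ cube N c L → line x i r ∈ cube N c L →
    ∫ ω, cdist ω c L (line x i t) (line x i r) ∂configLaw d N s β ≤ T

lemma axisBound_one : AxisBound d N s β 1 0 := by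
  intro c _ x i t r ht hr h1 h2
  have : line x i t = line x i r := by
    funext j
    have := h1 j
    have := h2 j
    ext
    omega
  rw [this]
  simp [cdist]

/-- An arbitrary pair of nodes in the cube is joined by d axis-parallel segments inside it. -/
lemma AxisBound.integral_cdist_le {L : ℕ} {T : ℝ} (h : AxisBound d N s β L T) {c : Fin d → ℕ}
    (hc : ∀ i, c i + L ≤ N + 1) {x y : Node d N} (hx : x ∈ cube N c L) (hy : y ∈ cube N c L) :
    ∫ ω, cdist ω c L x y ∂configLaw d N s β ≤ d * T := by
  calc ∫ ω, cdist ω c L x y ∂configLaw d N s β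
      ≤ ∫ ω, ∑ j ∈ Finset.range d, cdist ω c L (mix x y j) (mix x y (j + 1))
          ∂configLaw d N s β := by
        refine integral_mono (integrable_config _) (integrable_config _) fun ω => ?_
        have := dist_le_sum_mix ω hx hy
        simp only [cdist]
        exact_mod_cast this
    _ = ∑ j ∈ Finset.range d, ∫ ω, cdist ω c L (mix x y j) (mix x y (j + 1))
          ∂configLaw d N s β := integral_finsetSum _ fun _ _ => integrable_config _
    _ ≤ ∑ _j ∈ Finset.range d, T := by
        refine Finset.sum_le_sum fun j hj => ?_
        have hj := Finset.mem_range.1 hj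
        have h1 := line_mix_left x y ⟨j, hj⟩
        have h2 := line_mix_right x y ⟨j, hj⟩
        simp only at h1 h2
        have m1 := mix_mem_cube hx hy j
        have m2 := mix_mem_cube hx hy (j + 1)
        have := h c hc (mix x y j) ⟨j, hj⟩ (x ⟨j, hj⟩) (y ⟨j, hj⟩) (by omega) (by omega)
        rw [h1, h2] at this
        exact this m1 m2
    _ = d * T := by simp

lemma reachable_and_dist_line_succ (ω : Config d N) {B : Set (Node d N)} {x : Node d N} {i : Fin d}
    {t : ℕ} (ht : t + 1 ≤ N) (h1 : line x i t ∈ B) (h2 : line x i (t + 1) ∈ B) :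
    (boxGraph ω B).Reachable (line x i t) (line x i (t + 1)) ∧
      (boxGraph ω B).dist (line x i t) (line x i (t + 1)) ≤ 1 := by
  obtain ⟨p, hp⟩ := exists_walk_line ω B x i (Nat.le_succ t) ht fun q h3 h4 => by
    rcases (by omega : q = t ∨ q = t + 1) with rfl | rfl <;> assumption
  exact ⟨⟨p⟩, (SimpleGraph.dist_le p).trans (by omega)⟩

/-- Corner of the `j`-th cube of a row of cubes in direction `i`. -/
def rowCorner (c : Fin d → ℕ) (i : Fin d) (a L j : ℕ) : Fin d → ℕ := Function.update c i (a + j * L)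

lemma line_mem_row {c : Fin d → ℕ} {L : ℕ} {x : Node d N} {i : Fin d} {a j t : ℕ}
    (hx : ∀ l, l ≠ i → c l ≤ x l ∧ (x l : ℕ) < c l + L) (ht : t ≤ N)
    (h1 : a + j * L ≤ t) (h2 : t < a + (j + 1) * L) :
    line x i t ∈ cube N (rowCorner c i a L j) L := by
  refine line_mem_cube ht (fun l hl => ?_) ?_ ?_
  · simpa [rowCorner, hl] using hx l hl
  · simpa [rowCorner] using h1
  · simp only [rowCorner, Function.update_self]
    rw [add_mul, one_mul] at h2
    omega

/-- Traversing a row of cubes. -/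
lemma dist_row_le (ω : Config d N) {B : Set (Node d N)} {c : Fin d → ℕ} {L : ℕ} (hL : 1 ≤ L)
    {x : Node d N} {i : Fin d} {a : ℕ} (hx : ∀ l, l ≠ i → c l ≤ x l ∧ (x l : ℕ) < c l + L) (J : ℕ)
    (hJ : a + J * L ≤ N) (hB : ∀ j < J, cube N (rowCorner c i a L j) L ⊆ B)
    (hend : line x i (a + J * L) ∈ B) :
    (boxGraph ω B).Reachable (line x i a) (line x i (a + J * L)) ∧
    ((boxGraph ω B).dist (line x i a) (line x i (a + J * L)) : ℝ) ≤
      ∑ j ∈ Finset.range J, (cdist ω (rowCorner c i a L j) L (line x i (a + j * L))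
        (line x i (a + j * L + (L - 1))) + 1) := by
  induction J with
  | zero => simp
  | succ J ih =>
    have hJ' : a + J * L + (L - 1) + 1 = a + (J + 1) * L := by rw [add_mul, one_mul]; omega
    have m1 : line x i (a + J * L) ∈ cube N (rowCorner c i a L J) L :=
      line_mem_row hx (by omega) le_rfl (by omega)
    have m2 : line x i (a + J * L + (L - 1)) ∈ cube N (rowCorner c i a L J) L :=
      line_mem_row hx (by omega) (by omega) (by omega)
    have hQ := hB J (Nat.lt_succ_self J)
    obtain ⟨r1, h1⟩ := ih (by omega) (fun j hj => hB j (by omega)) (hQ m1)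
    have r2 := reachable_cube ω m1 m2
    have h2 : (boxGraph ω B).dist (line x i (a + J * L)) (line x i (a + J * L + (L - 1))) ≤
      (boxGraph ω (cube N (rowCorner c i a L J) L)).dist (line x i (a + J * L))
        (line x i (a + J * L + (L - 1))) := r2.dist_anti (boxGraph_mono ω hQ)
    have r2' := r2.mono (boxGraph_mono ω hQ)
    obtain ⟨r3, h3⟩ := reachable_and_dist_line_succ ω (B := B) (x := x) (i := i)
      (t := a + J * L + (L - 1)) (by omega) (hQ m2) (by rw [hJ']; exact hend)
    rw [hJ'] at r3 h3
    refine ⟨r1.trans (r2'.trans r3), ?_⟩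
    rw [Finset.sum_range_succ]
    have h4 := r1.dist_triangle_left (line x i (a + (J + 1) * L))
    have h5 := r2'.dist_triangle_left (line x i (a + (J + 1) * L))
    have h6 : ((boxGraph ω B).dist (line x i a) (line x i (a + (J + 1) * L)) : ℝ) ≤
        (boxGraph ω B).dist (line x i a) (line x i (a + J * L)) +
        (boxGraph ω (cube N (rowCorner c i a L J) L)).dist (line x i (a + J * L))
        (line x i (a + J * L + (L - 1))) + 1 := by exact_mod_cast (by omega)
    simp only [cdist] at h1 ⊢
    linarith

open Classical in
/-- An element satisfying `P`, if there is one. -/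
noncomputable def pick {α : Type*} (P : α → Prop) : Option α :=
  if h : ∃ a, P a then some h.choose else none

lemma pick_eq_some {α : Type*} {P : α → Prop} {a : α} (h : pick P = some a) : P a := by
  classical
  unfold pick at h
  split_ifs at h with h'
  rw [← Option.some.inj h]
  exact h'.choose_spec

lemma pick_eq_none {α : Type*} {P : α → Prop} (h : pick P = none) (a : α) : ¬ P a := by
  classical
  unfold pick at h
  split_ifs at h with h'
  exact fun ha => h' ⟨a, ha⟩

/-- Expectation of a quantity bounded by terms that are chosen independently of their values. -/
lemma integral_le_of_pick {α : Type*} [Fintype α] (P : Config d N → α → Prop)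
    {S S' : Set (Sym2 (Node d N))} (hP : DependsOn P S) (hSS : Disjoint S S')
    (F : Option α → Config d N → ℝ) (hF : ∀ o, DependsOn (F o) S') (G : Config d N → ℝ)
    (hG : ∀ ω, G ω ≤ F (pick (P ω)) ω) {b₀ b₁ : ℝ} (hb₀ : ∫ ω, F none ω ∂configLaw d N s β ≤ b₀)
    (hb₁ : ∀ a, (∃ ω, P ω a) → ∫ ω, F (some a) ω ∂configLaw d N s β ≤ b₁) :
    ∫ ω, G ω ∂configLaw d N s β ≤
      b₁ + (configLaw d N s β).real {ω | ∀ a, ¬ P ω a} * (b₀ - b₁) := by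
  classical
  have hdep : ∀ o, DependsOn (fun ω => ω ∈ {ω | pick (P ω) = o}) S := by
    intro o ω ω' h
    simp only [Set.mem_ofPred_eq, hP h]
  -- Exactly one value o of `pick` occurs. Its indicator depends on S and F o depends on S', so each
  -- term factorises and no conditioning is needed.
  have h1 : ∀ ω, G ω ≤ ∑ o, {ω | pick (P ω) = o}.indicator 1 ω * F o ω := by
    intro ω
    rw [Finset.sum_eq_single (pick (P ω))]
    · simpa using hG ω
    · intro o _ ho
      rw [Set.indicator_of_notMem (by exact ho.symm), zero_mul]
    · simp
  have h2 : ∫ ω, G ω ∂configLaw d N s β ≤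
      ∑ o, (configLaw d N s β).real {ω | pick (P ω) = o} * ∫ ω, F o ω ∂configLaw d N s β := by
    refine (integral_mono (integrable_config _) (integrable_config _) h1).trans (le_of_eq ?_)
    rw [integral_finsetSum _ fun _ _ => integrable_config _]
    refine Finset.sum_congr rfl fun o _ => ?_
    rw [integral_mul_of_dependsOn (dependsOn_indicator (hdep o)) (hF o) hSS,
      integral_indicator_config]
  have h3 : ∑ o, (configLaw d N s β).real {ω | pick (P ω) = o} = 1 := by
    simp only [← integral_indicator_config]
    rw [← integral_finsetSum _ fun _ _ => integrable_config _]
    have : ∀ ω, ∑ o, {ω | pick (P ω) = o}.indicator (1 : Config d N → ℝ) ω = 1 := by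
      intro ω
      rw [Finset.sum_eq_single (pick (P ω))]
      · simp
      · intro o _ ho
        rw [Set.indicator_of_notMem (by exact ho.symm)]
      · simp
    simp [this]
  have h4 : {ω | pick (P ω) = none} = {ω | ∀ a, ¬ P ω a} := by
    ext ω
    simp only [Set.mem_ofPred_eq]
    constructor
    · exact fun h => pick_eq_none h
    · intro h
      unfold pick
      rw [dif_neg (by rintro ⟨a, ha⟩; exact h a ha)]
  rw [Fintype.sum_option] at h2 h3
  rw [h4] at h2 h3
  have h5 : ∑ a, (configLaw d N s β).real {ω | pick (P ω) = some a} *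
      ∫ ω, F (some a) ω ∂configLaw d N s β ≤
      ∑ a, (configLaw d N s β).real {ω | pick (P ω) = some a} * b₁ := by
    refine Finset.sum_le_sum fun a _ => ?_
    by_cases ha : ∃ ω, P ω a
    · exact mul_le_mul_of_nonneg_left (hb₁ a ha) measureReal_nonneg
    · rw [show {ω | pick (P ω) = some a} = ∅ from Set.eq_empty_of_forall_notMem
        fun ω h => ha ⟨ω, pick_eq_some h⟩]
      simp
  rw [← Finset.sum_mul] at h5
  have h6 := mul_le_mul_of_nonneg_left hb₀
    (measureReal_nonneg (μ := configLaw d N s β) (s := {ω | ∀ a, ¬ P ω a}))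
  have h7 : ∑ a, (configLaw d N s β).real {ω | pick (P ω) = some a} =
    1 - (configLaw d N s β).real {ω | ∀ a, ¬ P ω a} := by linarith
  rw [h7] at h5
  linarith

end Renormalization

/-! ### One renormalization step for s = 2d -/

section RenormalizationStep

variable {d N : ℕ} {s β : ℝ}

lemma cdist_comm (ω : Config d N) (c : Fin d → ℕ) (L : ℕ) (x y : Node d N) :
    cdist ω c L x y = cdist ω c L y x := by
  unfold cdist; rw [SimpleGraph.dist_comm]

lemma dist_le_cdist (ω : Config d N) {B : Set (Node d N)} {c : Fin d → ℕ} {L : ℕ}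
    (hB : cube N c L ⊆ B) {x y : Node d N} (hx : x ∈ cube N c L) (hy : y ∈ cube N c L) :
    ((boxGraph ω B).dist x y : ℝ) ≤ cdist ω c L x y := by
  unfold cdist
  exact_mod_cast (reachable_cube ω hx hy).dist_anti (boxGraph_mono ω hB)

lemma dist_triangle_of_mem (ω : Config d N) {B : Set (Node d N)} {c : Fin d → ℕ} {L : ℕ}
    (hB : B = cube N c L) {x y : Node d N} (z : Node d N) (hx : x ∈ B) (hy : y ∈ B) :
    ((boxGraph ω B).dist x z : ℝ) ≤ (boxGraph ω B).dist x y + (boxGraph ω B).dist y z := by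
  subst hB
  exact_mod_cast (reachable_cube ω hx hy).dist_triangle_left z

/-- The pairs whose endpoints are in the same layer of width `L` in direction `i`. -/
def sameLayer (N : ℕ) (c : Fin d → ℕ) (i : Fin d) (L : ℕ) : Set (Sym2 (Node d N)) :=
  {e | ∀ z ∈ e, ∀ w ∈ e, ((z i : ℕ) - c i) / L = ((w i : ℕ) - c i) / L}

lemma layer_of_mem_row {c c' : Fin d → ℕ} {i : Fin d} {L v j : ℕ} {z : Node d N}
    (hz : z ∈ cube N (rowCorner c' i (c i + v * L) L j) L) : ((z i : ℕ) - c i) / L = v + j := by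
  have := hz i
  simp only [rowCorner, Function.update_self] at this
  refine Nat.div_eq_of_lt_le ?_ ?_
  · rw [add_mul]; omega
  · rw [Nat.succ_mul, add_mul]; omega

/-- A cube of the row lies in a single layer, whereas a shortcut between the end cubes joins
different layers. The choice of shortcut is therefore independent of the distances inside the cubes.
-/
lemma dependsOn_cdist_row {c c' : Fin d → ℕ} {i : Fin d} {L v j : ℕ} (x y : Node d N) :
    DependsOn (fun ω : Config d N => cdist ω (rowCorner c' i (c i + v * L) L j) L x y)
      (sameLayer N c i L) := by
  intro ω ω' h
  refine dependsOn_cdist _ _ _ _ fun e he => h e fun z hz w hw => ?_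
  rw [layer_of_mem_row (he z hz), layer_of_mem_row (he w hw)]

lemma dependsOn_add {f g : Config d N → ℝ} {S : Set (Sym2 (Node d N))} (hf : DependsOn f S)
    (hg : DependsOn g S) : DependsOn (fun ω => f ω + g ω) S := fun _ _ h => by
  simp only [hf h, hg h]

lemma dependsOn_sum {ι : Type*} {J : Finset ι} {f : ι → Config d N → ℝ}
    {S : Set (Sym2 (Node d N))} (hf : ∀ j ∈ J, DependsOn (f j) S) :
    DependsOn (fun ω => ∑ j ∈ J, f j ω) S := fun _ _ h =>
  Finset.sum_congr rfl fun j hj => hf j hj h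

lemma dependsOn_constant (a : ℝ) (S : Set (Sym2 (Node d N))) :
    DependsOn (fun _ : Config d N => a) S := fun _ _ _ => rfl

/-- Length of the route that traverses a row of cubes from the layer of `t` to the layer of `r`. -/
noncomputable def rowRoute (ω : Config d N) (c c' : Fin d → ℕ) (x : Node d N) (i : Fin d)
    (L p m t r : ℕ) : ℝ :=
  cdist ω (rowCorner c' i (c i + p * L) L 0) L (line x i t) (line x i (c i + p * L + (L - 1))) + 1 +
    ∑ j ∈ Finset.range m, (cdist ω (rowCorner c' i (c i + (p + 1) * L) L j) L
      (line x i (c i + (p + 1) * L + j * L)) (line x i (c i + (p + 1) * L + j * L + (L - 1))) + 1) +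
    cdist ω (rowCorner c' i (c i + (p + 1) * L + m * L) L 0) L
      (line x i (c i + (p + 1) * L + m * L)) (line x i r)

lemma dependsOn_rowRoute (c c' : Fin d → ℕ) (x : Node d N) (i : Fin d) (L p m t r : ℕ) :
    DependsOn (fun ω : Config d N => rowRoute ω c c' x i L p m t r) (sameLayer N c i L) := by
  unfold rowRoute
  refine dependsOn_add (dependsOn_add (dependsOn_add (dependsOn_cdist_row _ _)
    (dependsOn_constant _ _)) (dependsOn_sum fun j _ => dependsOn_add (dependsOn_cdist_row _ _)
    (dependsOn_constant _ _))) ?_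
  rw [add_assoc, ← add_mul]
  exact dependsOn_cdist_row _ _

/-- Crossing fewer than k cubes of a row costs at most (k - 1) T plus the connecting edges. When all
k cubes are involved, an open pair between the end cubes reduces the cost to 2 d T + 1 = (k - 1) T +
1, since each end cube is crossed along d segments; this dictates k = 2d + 1. There are L ^ (2d)
candidate pairs of length at most d k L, and because s = 2d the side L cancels: a shortcut is
missing with probability at most a constant q < 1. Only then is the full row traversed, which costs
one more T. -/
lemma AxisBound.step {L : ℕ} {T : ℝ} (h : AxisBound d N s β L T) (hT : 0 ≤ T) (hL : 1 ≤ L)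
    (hd : 1 ≤ d) (hβ : 0 < β) (hs : s = 2 * d) {k : ℕ} (hk : k = 2 * d + 1) :
    AxisBound d N s β (k * L)
      ((k - 1 + Real.exp (-(β / ((d : ℝ) * k) ^ (2 * d)))) * T + k) := by
  intro c hc x i t r ht hr hxt hxr
  wlog htr : t ≤ r generalizing t r
  · have := this r t hr ht hxr hxt (le_of_not_ge htr)
    simp_rw [cdist_comm _ _ _ (line x i t)]
    exact this
  set q := Real.exp (-(β / ((d : ℝ) * k) ^ (2 * d))) with hq
  have hq0 : 0 < q := Real.exp_pos _
  have hkd : (k : ℝ) = 2 * d + 1 := by rw [hk]; push_cast; ring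
  have hd1 : (1 : ℝ) ≤ d := by exact_mod_cast hd
  have hqT : 0 ≤ q * T := by positivity
  have hdT : 0 ≤ (2 * d - 1) * T := mul_nonneg (by linarith) hT
  -- the row of cubes
  let c' : Fin d → ℕ := fun l => c l + ((x l : ℕ) - c l) / L * L
  have hxc : ∀ l, l ≠ i → c l ≤ x l ∧ (x l : ℕ) < c l + k * L := fun l hl => by
    have := hxt l
    rwa [line_of_ne _ _ hl] at this
  have hx' : ∀ l, l ≠ i → c' l ≤ x l ∧ (x l : ℕ) < c' l + L := by
    intro l hl
    have h1 := hxc l hl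
    have h2 := Nat.div_mul_le_self ((x l : ℕ) - c l) L
    have h3 := Nat.lt_div_mul_add (a := (x l : ℕ) - c l) (b := L) (by omega)
    simp only [c']
    omega
  have hc'L : ∀ l, l ≠ i → c' l + L ≤ c l + k * L := by
    intro l hl
    have h1 := hxc l hl
    have h2 : ((x l : ℕ) - c l) / L < k := Nat.div_lt_of_lt_mul (by rw [mul_comm]; omega)
    have h3 : (((x l : ℕ) - c l) / L + 1) * L ≤ k * L := Nat.mul_le_mul_right L h2
    rw [add_mul, one_mul] at h3
    simp only [c']
    omega
  have hti := hxt i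
  have hri := hxr i
  rw [line_val_self _ _ ht] at hti
  rw [line_val_self _ _ hr] at hri
  have hrowsub : ∀ v, v + L ≤ c i + k * L → c i ≤ v →
      cube N (rowCorner c' i v L 0) L ⊆ cube N c (k * L) := by
    intro v hv1 hv2 z hz l
    have := hz l
    by_cases hl : l = i
    · subst hl
      simp only [rowCorner, Function.update_self] at this
      omega
    · simp only [rowCorner, Function.update_of_ne hl] at this
      have := hc'L l hl
      have : c l ≤ c' l := Nat.le_add_right _ _
      omega
  have hrowfit : ∀ v, v + L ≤ c i + k * L → ∀ l, rowCorner c' i v L 0 l + L ≤ N + 1 := by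
    intro v hv l
    have := hc l
    by_cases hl : l = i
    · subst hl
      simp only [rowCorner, Function.update_self]
      omega
    · simp only [rowCorner, Function.update_of_ne hl]
      have := hc'L l hl
      omega
  have hrow0 : ∀ v j, rowCorner c' i v L j = rowCorner c' i (v + j * L) L 0 := by
    intro v j; simp [rowCorner]
  set B := cube N c (k * L) with hB
  obtain ⟨p, hp⟩ : ∃ p, p = (t - c i) / L := ⟨_, rfl⟩
  have hp1 : p * L ≤ t - c i := hp ▸ Nat.div_mul_le_self _ _
  have hp2 : t - c i < p * L + L := hp ▸ Nat.lt_div_mul_add (by omega)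
  have hr1 : (r - c i) / L * L ≤ r - c i := Nat.div_mul_le_self _ _
  have hr2 : r - c i < (r - c i) / L * L + L := Nat.lt_div_mul_add (by omega)
  have hrk : (r - c i) / L < k := Nat.div_lt_of_lt_mul (by rw [mul_comm]; omega)
  have hpr : p ≤ (r - c i) / L := hp ▸ Nat.div_le_div_right (by omega)
  clear hp
  have hmemrow : ∀ v w, v ≤ w → w < v + L → w ≤ N →
      line x i w ∈ cube N (rowCorner c' i v L 0) L := fun v w h1 h2 h3 =>
    line_mem_row hx' h3 (by omega) (by omega)
  have hbound : ∀ v w w', v ≤ w → w < v + L → v ≤ w' → w' < v + L → w ≤ N → w' ≤ N →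
      v + L ≤ c i + k * L → ∫ ω, cdist ω (rowCorner c' i v L 0) L (line x i w) (line x i w')
        ∂configLaw d N s β ≤ T := fun v w w' h1 h2 h3 h4 h5 h6 h7 =>
    h _ (hrowfit v h7) x i w w' h5 h6 (hmemrow v w h1 h2 h5) (hmemrow v w' h3 h4 h6)
  have hpL : p * L + L ≤ k * L := by
    have : (p + 1) * L ≤ k * L := Nat.mul_le_mul_right L (by omega)
    rwa [add_mul, one_mul] at this
  have hm1 := hmemrow (c i + p * L) t (by omega) (by omega) ht
  have hs1 := hrowsub (c i + p * L) (by omega) (by omega)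
  rcases hpr.eq_or_lt with hpe | hpl
  · -- both nodes in one cube of the row
    rw [← hpe] at hr1 hr2
    have hm2 := hmemrow (c i + p * L) r (by omega) (by omega) hr
    calc ∫ ω, cdist ω c (k * L) (line x i t) (line x i r) ∂configLaw d N s β
        ≤ ∫ ω, cdist ω (rowCorner c' i (c i + p * L) L 0) L (line x i t) (line x i r)
            ∂configLaw d N s β :=
          integral_mono (integrable_config _) (integrable_config _)
            fun ω => dist_le_cdist ω hs1 hm1 hm2
      _ ≤ T := hbound _ _ _ (by omega) (by omega) (by omega) (by omega) ht hr (by omega)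
      _ ≤ _ := by rw [hkd]; nlinarith
  obtain ⟨m, hm⟩ : ∃ m, (r - c i) / L = p + 1 + m := ⟨(r - c i) / L - (p + 1), by omega⟩
  rw [hm] at hr1 hr2 hrk
  have e1 : (p + 1 + m) * L = p * L + L + m * L := by ring
  have e2 : (p + 1) * L = p * L + L := by ring
  have hkL : p * L + L + m * L + L ≤ k * L := by
    have : (p + 1 + m + 1) * L ≤ k * L := Nat.mul_le_mul_right L (by omega)
    calc _ = (p + 1 + m + 1) * L := by ring
      _ ≤ _ := this
  rw [e1] at hr1 hr2
  have hs2 := hrowsub (c i + (p + 1) * L + m * L) (by omega) (by omega)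
  have hm2 := hmemrow (c i + p * L) (c i + p * L + (L - 1)) (by omega) (by omega) (by omega)
  have hm3 := hmemrow (c i + (p + 1) * L + m * L) (c i + (p + 1) * L + m * L) (by omega) (by omega)
    (by omega)
  have hm4 := hmemrow (c i + (p + 1) * L + m * L) r (by omega) (by omega) hr
  have hroute : ∀ ω : Config d N, cdist ω c (k * L) (line x i t) (line x i r) ≤
      rowRoute ω c c' x i L p m t r := by
    intro ω
    have hj : ∀ j < m, c i + (p + 1) * L + j * L + L ≤ c i + k * L := fun j hj => by
      have : (j + 1) * L ≤ m * L := Nat.mul_le_mul_right L hj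
      rw [add_mul, one_mul] at this
      omega
    obtain ⟨-, h2⟩ := dist_row_le ω (B := B) hL hx' m (a := c i + (p + 1) * L) (by omega)
      (fun j hjm => by rw [hrow0]; exact hrowsub _ (hj j hjm) (by omega)) (hs2 hm3)
    have h1 := dist_le_cdist ω hs1 hm1 hm2
    have h3 := dist_le_cdist ω hs2 hm3 hm4
    have e3 : c i + p * L + (L - 1) + 1 = c i + (p + 1) * L := by rw [e2]; omega
    have hm5 : line x i (c i + (p + 1) * L) ∈ B := by
      refine line_mem_cube (by omega) hxc (by omega) (by omega)
    obtain ⟨-, h4⟩ := reachable_and_dist_line_succ ω (B := B) (x := x) (i := i)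
      (t := c i + p * L + (L - 1)) (by omega) (hs1 hm2) (by rw [e3]; exact hm5)
    rw [e3] at h4
    have h4' : ((boxGraph ω B).dist (line x i (c i + p * L + (L - 1)))
      (line x i (c i + (p + 1) * L)) : ℝ) ≤ 1 := by exact_mod_cast h4
    have t1 := dist_triangle_of_mem ω hB (line x i r) (hs1 hm1) (hs1 hm2)
    have t2 := dist_triangle_of_mem ω hB (line x i r) (hs1 hm2) hm5
    have t3 := dist_triangle_of_mem ω hB (line x i r) hm5 (hs2 hm3)
    unfold rowRoute
    rw [cdist, ← hB]
    linarith
  have hrouteE : ∫ ω, rowRoute ω c c' x i L p m t r ∂configLaw d N s β ≤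
      (m + 2) * T + (m + 1) := by
    unfold rowRoute
    rw [integral_add (integrable_config _) (integrable_config _),
      integral_add (integrable_config _) (integrable_config _),
      integral_add (integrable_config _) (integrable_config _),
      integral_finsetSum _ fun _ _ => integrable_config _]
    have b1 := hbound (c i + p * L) t (c i + p * L + (L - 1)) (by omega) (by omega) (by omega)
      (by omega) ht (by omega) (by omega)
    have b3 := hbound (c i + (p + 1) * L + m * L) (c i + (p + 1) * L + m * L) r (by omega)
      (by omega) (by omega) (by omega) (by omega) hr (by omega)
    have b2 : ∑ j ∈ Finset.range m, ∫ ω, (cdist ω (rowCorner c' i (c i + (p + 1) * L) L j) L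
        (line x i (c i + (p + 1) * L + j * L)) (line x i (c i + (p + 1) * L + j * L + (L - 1))) + 1)
          ∂configLaw d N s β ≤ ∑ _j ∈ Finset.range m, (T + 1) := by
      refine Finset.sum_le_sum fun j hj => ?_
      have : (j + 1) * L ≤ m * L := Nat.mul_le_mul_right L (Finset.mem_range.1 hj)
      rw [add_mul, one_mul] at this
      rw [integral_add (integrable_config _) (integrable_config _), hrow0]
      have := hbound (c i + (p + 1) * L + j * L) (c i + (p + 1) * L + j * L)
        (c i + (p + 1) * L + j * L + (L - 1)) (by omega) (by omega) (by omega) (by omega)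
        (by omega) (by omega) (by omega)
      simp only [integral_const, probReal_univ, one_smul]
      linarith
    simp only [Finset.sum_const, Finset.card_range, nsmul_eq_mul] at b2
    simp only [integral_const, probReal_univ, one_smul]
    linarith
  by_cases hmk : m + 3 ≤ k
  · -- the row is not full
    have hmk' : (m : ℝ) + 3 ≤ 2 * d + 1 := by rw [← hkd]; exact_mod_cast hmk
    calc ∫ ω, cdist ω c (k * L) (line x i t) (line x i r) ∂configLaw d N s β
        ≤ ∫ ω, rowRoute ω c c' x i L p m t r ∂configLaw d N s β :=
          integral_mono (integrable_config _) (integrable_config _) hroute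
      _ ≤ (m + 2) * T + (m + 1) := hrouteE
      _ ≤ _ := by rw [hkd]; nlinarith
  -- The two nodes now lie in the first and the last of the k cubes.
  have hmk' : k = m + 2 := by omega
  have hp0 : p = 0 := by omega
  -- the shortcut
  set U := cube N (rowCorner c' i (c i + p * L) L 0) L with hU
  set V := cube N (rowCorner c' i (c i + (p + 1) * L + m * L) L 0) L with hV
  have hfitU := hrowfit (c i + p * L) (by omega)
  have hfitV := hrowfit (c i + (p + 1) * L + m * L) (by omega)
  have hVrow : ∀ v ∈ V, ((v i : ℕ) - c i) / L = p + 1 + m := fun v hv => by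
    rw [hV, add_assoc, ← add_mul] at hv
    simpa using layer_of_mem_row (v := p + 1 + m) (j := 0) hv
  have hUrow : ∀ u ∈ U, ((u i : ℕ) - c i) / L = p := fun u hu => by
    simpa using layer_of_mem_row hu
  let P : Config d N → Node d N × Node d N → Prop := fun ω w =>
    w.1 ∈ U ∧ w.2 ∈ V ∧ ω s(w.1, w.2) = true
  let F : Option (Node d N × Node d N) → Config d N → ℝ := fun o ω => match o with
    | none => rowRoute ω c c' x i L p m t r
    | some w => cdist ω (rowCorner c' i (c i + p * L) L 0) L (line x i t) w.1 + 1 +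
        cdist ω (rowCorner c' i (c i + (p + 1) * L + m * L) L 0) L w.2 (line x i r)
  have hP : DependsOn P (sameLayer N c i L)ᶜ := by
    intro ω ω' hω
    funext w
    simp only [P, eq_iff_iff]
    refine and_congr_right fun hu => and_congr_right fun hv => ?_
    rw [hω s(w.1, w.2)]
    intro hlay
    have := hlay w.1 (by simp) w.2 (by simp)
    rw [hUrow _ hu, hVrow _ hv] at this
    omega
  have hF : ∀ o, DependsOn (F o) (sameLayer N c i L) := by
    rintro (_ | w)
    · exact dependsOn_rowRoute c c' x i L p m t r
    · refine dependsOn_add (dependsOn_add (dependsOn_cdist_row _ _) (dependsOn_constant _ _)) ?_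
      rw [add_assoc, ← add_mul]
      exact dependsOn_cdist_row _ _
  have hG : ∀ ω, cdist ω c (k * L) (line x i t) (line x i r) ≤ F (pick (P ω)) ω := by
    intro ω
    rcases hpick : pick (P ω) with _ | w
    · exact hroute ω
    · obtain ⟨hu, hv, huv⟩ := pick_eq_some hpick
      have hne : w.1 ≠ w.2 := by
        intro hne
        have h1 := hUrow _ hu
        rw [hne, hVrow _ hv] at h1
        omega
      have hadj : (boxGraph ω B).Adj w.1 w.2 := ⟨hne, hs1 hu, hs2 hv, Or.inr huv⟩
      have h0 : ((boxGraph ω B).dist w.1 w.2 : ℝ) = 1 := by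
        rw [SimpleGraph.dist_eq_one_iff_adj.2 hadj]; simp
      have h1 := dist_le_cdist ω hs1 hm1 hu
      have h2 := dist_le_cdist ω hs2 hv hm4
      have t1 := dist_triangle_of_mem ω hB (line x i r) (hs1 hm1) (hs1 hu)
      have t2 := dist_triangle_of_mem ω hB (line x i r) (hs1 hu) (hs2 hv)
      simp only [F]
      rw [cdist, ← hB]
      linarith
  have hb₁ : ∀ w, (∃ ω, P ω w) → ∫ ω, F (some w) ω ∂configLaw d N s β ≤ 2 * d * T + 1 := by
    rintro w ⟨ω, hu, hv, -⟩
    have b1 := h.integral_cdist_le hfitU hm1 hu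
    have b2 := h.integral_cdist_le hfitV hv hm4
    simp only [F]
    rw [integral_add (integrable_config _) (integrable_config _),
      integral_add (integrable_config _) (integrable_config _)]
    simp only [integral_const, probReal_univ, one_smul]
    linarith
  have hmain := integral_le_of_pick (s := s) (β := β) P hP disjoint_compl_left F hF _ hG
    hrouteE hb₁
  have hnone : (configLaw d N s β).real {ω | ∀ w, ¬ P ω w} ≤ q := by
    have h1 := real_not_joined_le (s := s) (β := β) (by rw [hs]; positivity) hβ.le
      U.toFinite.toFinset V.toFinite.toFinset (by
        rw [Finset.disjoint_left]
        intro z hz hz'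
        have h1 := hUrow z (by simpa using hz)
        rw [hVrow z (by simpa using hz')] at h1
        omega) (R := (d : ℝ) * (k * L)) (by
        intro u hu v hv
        have := l1dist_le_of_mem_cube (hs1 (by simpa using hu)) (hs2 (by simpa using hv))
        exact_mod_cast this)
    rw [card_cube hfitU, card_cube hfitV] at h1
    refine le_trans (measureReal_mono ?_) (h1.trans (le_of_eq ?_))
    · intro ω hω u hu v hv
      have := hω (u, v)
      simp only [P, not_and] at this
      simpa using this (by simpa using hu) (by simpa using hv)
    · rw [hq]
      congr 2
      have hL0 : (0 : ℝ) < L := by exact_mod_cast hL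
      have hk0 : (0 : ℝ) < k := by rw [hkd]; positivity
      rw [hs, show (2 : ℝ) * (d : ℝ) = ((2 * d : ℕ) : ℝ) by push_cast; ring, Real.rpow_natCast,
        ← mul_assoc (d : ℝ), mul_pow _ (L : ℝ)]
      push_cast
      rw [← pow_add, ← two_mul]
      field_simp
  refine hmain.trans ?_
  have hm' : (m : ℝ) = 2 * d - 1 := by
    have : (k : ℝ) = m + 2 := by rw [hmk']; push_cast; ring
    linarith
  -- The excess of the row route over the shortcut route is a single T plus a constant, and it is
  -- paid only with probability q.
  have h1 : (m + 2) * T + (m + 1) - (2 * d * T + 1) = T + (2 * d - 1) := by rw [hm']; ring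
  rw [h1]
  have h2 := mul_le_mul_of_nonneg_right hnone (show 0 ≤ T + (2 * (d : ℝ) - 1) by linarith)
  have hq1 : q ≤ 1 := by
    rw [hq, Real.exp_le_one_iff]
    exact neg_nonpos.2 (by positivity)
  have h3 := mul_le_mul_of_nonneg_right hq1 (show 0 ≤ 2 * (d : ℝ) - 1 by linarith)
  rw [hkd]
  linarith

end RenormalizationStep

/-! ### Upper bound for s = 2d: iteration and concentration -/

section Critical

variable {d N : ℕ} {s β : ℝ}

/-- The recursion T ↦ a T + k started from 0 stays below k (a ^ n - 1), because a ≥ 2. -/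
lemma axisBound_pow (hd : 1 ≤ d) (hβ : 0 < β) (hs : s = 2 * d) {k : ℕ} (hk : k = 2 * d + 1) {a : ℝ}
    (ha : a = k - 1 + Real.exp (-(β / ((d : ℝ) * k) ^ (2 * d)))) (n : ℕ) :
    AxisBound d N s β (k ^ n) (k * (a ^ n - 1)) := by
  have hk3 : (3 : ℝ) ≤ k := by
    have : 3 ≤ k := by omega
    exact_mod_cast this
  have ha2 : 2 ≤ a := by rw [ha]; have := Real.exp_pos (-(β / ((d : ℝ) * k) ^ (2 * d))); linarith
  induction n with
  | zero => simpa using axisBound_one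
  | succ n ih =>
    have h0 : 0 ≤ (k : ℝ) * (a ^ n - 1) :=
      mul_nonneg (by linarith) (sub_nonneg.2 (one_le_pow₀ (by linarith)))
    have h1 := ih.step h0 (Nat.one_le_pow _ _ (by omega)) hd hβ hs hk
    rw [← ha, ← pow_succ'] at h1
    intro c hc x i t r ht hr hxt hxr
    refine (h1 c hc x i t r ht hr hxt hxr).trans ?_
    rw [pow_succ]
    nlinarith

/-- Corner coordinates of a row of cubes of side `L` along the line through `x`. -/
def lineCorner (x : Node d N) (L : ℕ) : Fin d → ℕ := fun l => min (x l) (N + 1 - L)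

lemma lineCorner_spec {L : ℕ} (hL : 1 ≤ L) (hLN : L ≤ N + 1) (x : Node d N) (l : Fin d) :
    lineCorner x L l ≤ x l ∧ (x l : ℕ) < lineCorner x L l + L ∧ lineCorner x L l + L ≤ N + 1 := by
  have := (x l).2
  unfold lineCorner
  omega

/-- Total distance inside the first `J` cubes of a row. -/
noncomputable def rowSum (ω : Config d N) (x : Node d N) (i : Fin d) (L t J : ℕ) : ℝ :=
  ∑ j ∈ Finset.range J, cdist ω (rowCorner (lineCorner x L) i t L j) L (line x i (t + j * L))
    (line x i (t + j * L + (L - 1)))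

lemma exp_le_one_add_two_mul {y : ℝ} (h0 : 0 ≤ y) (h1 : y ≤ 1) : Real.exp y ≤ 1 + 2 * y := by
  have := Real.abs_exp_sub_one_le (x := y) (by rwa [abs_of_nonneg h0])
  rw [abs_of_nonneg h0] at this
  linarith [le_abs_self (Real.exp y - 1)]

/-- An exponential Markov bound. A distance inside a cube, divided by L, lies in [0, 1] along a
line, so exp y ≤ 1 + 2 y bounds its exponential moment by exp (2 T / L). The cubes of the row are
disjoint, so these moments multiply. -/
lemma real_rowSum_ge_le {L : ℕ} {T : ℝ} (h : AxisBound d N s β L T) (hL : 1 ≤ L)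
    (hLN : L ≤ N + 1) (x : Node d N) (i : Fin d) (t J : ℕ) (hJ : t + J * L ≤ N) (τ : ℝ) :
    (configLaw d N s β).real {ω | τ * L ≤ rowSum ω x i L t J} ≤
      Real.exp (J * (2 * T / L) - τ) := by
  have hL0 : (0 : ℝ) < L := by exact_mod_cast hL
  have hjJ : ∀ j < J, t + j * L + L ≤ N := fun j hj => by
    have : (j + 1) * L ≤ J * L := Nat.mul_le_mul_right L hj
    rw [add_mul, one_mul] at this
    omega
  have hx : ∀ l, l ≠ i → lineCorner x L l ≤ x l ∧ (x l : ℕ) < lineCorner x L l + L :=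
    fun l _ => ⟨(lineCorner_spec hL hLN x l).1, (lineCorner_spec hL hLN x l).2.1⟩
  have hfit : ∀ j < J, ∀ l, rowCorner (lineCorner x L) i t L j l + L ≤ N + 1 := by
    intro j hj l
    have := hjJ j hj
    by_cases hl : l = i
    · subst hl; simp only [rowCorner, Function.update_self]; omega
    · simp only [rowCorner, Function.update_of_ne hl]
      exact (lineCorner_spec hL hLN x l).2.2
  have m1 : ∀ j < J, line x i (t + j * L) ∈ cube N (rowCorner (lineCorner x L) i t L j) L :=
    fun j hj => line_mem_row hx (by have := hjJ j hj; omega) le_rfl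
      (by rw [add_mul, one_mul]; omega)
  have m2 : ∀ j < J, line x i (t + j * L + (L - 1)) ∈
      cube N (rowCorner (lineCorner x L) i t L j) L :=
    fun j hj => line_mem_row hx (by have := hjJ j hj; omega) (by omega)
      (by rw [add_mul, one_mul]; omega)
  let f : ℕ → Config d N → ℝ := fun j ω => Real.exp
    (cdist ω (rowCorner (lineCorner x L) i t L j) L (line x i (t + j * L))
      (line x i (t + j * L + (L - 1))) / L)
  have hf : ∀ j < J, ∫ ω, f j ω ∂configLaw d N s β ≤ Real.exp (2 * T / L) := by
    intro j hj
    have h1 : ∀ ω, f j ω ≤ 1 + 2 / L * cdist ω (rowCorner (lineCorner x L) i t L j) L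
        (line x i (t + j * L)) (line x i (t + j * L + (L - 1))) := by
      intro ω
      have h2 : cdist ω (rowCorner (lineCorner x L) i t L j) L (line x i (t + j * L))
          (line x i (t + j * L + (L - 1))) / L ≤ 1 := by
        rw [div_le_one hL0]
        obtain ⟨p, hp⟩ := exists_walk_line_cube ω (m1 j hj) (m2 j hj)
          (by have := hjJ j hj; omega) (by have := hjJ j hj; omega)
        unfold cdist
        exact_mod_cast (SimpleGraph.dist_le p).trans hp
      refine (exp_le_one_add_two_mul (div_nonneg (cdist_nonneg _ _ _ _ _) hL0.le) h2).trans
        (le_of_eq (by ring))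
    have h3 := h _ (hfit j hj) x i _ _ (by have := hjJ j hj; omega)
      (by have := hjJ j hj; omega) (m1 j hj) (m2 j hj)
    calc _ ≤ ∫ ω, (1 + 2 / L * cdist ω (rowCorner (lineCorner x L) i t L j) L
          (line x i (t + j * L)) (line x i (t + j * L + (L - 1)))) ∂configLaw d N s β :=
          integral_mono (integrable_config _) (integrable_config _) h1
      _ ≤ 1 + 2 / L * T := by
          rw [integral_add (integrable_config _) (integrable_config _), integral_const_mul]
          simp only [integral_const, probReal_univ, one_smul]
          gcongr
      _ ≤ Real.exp (2 * T / L) := by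
          have := Real.add_one_le_exp (2 * T / L)
          calc 1 + 2 / L * T = 2 * T / L + 1 := by ring
            _ ≤ _ := this
  have hprod : ∫ ω, ∏ j ∈ Finset.range J, f j ω ∂configLaw d N s β ≤
      Real.exp (J * (2 * T / L)) := by
    rw [integral_prod_of_dependsOn (Finset.range J)
      (S := fun j => {e | ∀ z ∈ e, z ∈ cube N (rowCorner (lineCorner x L) i t L j) L})]
    · calc _ ≤ ∏ _j ∈ Finset.range J, Real.exp (2 * T / L) :=
            Finset.prod_le_prod (fun j _ => integral_nonneg fun ω => (Real.exp_pos _).le)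
              fun j hj => hf j (Finset.mem_range.1 hj)
        _ = _ := by rw [Finset.prod_const, Finset.card_range, ← Real.exp_nat_mul]
    · intro j _ ω ω' hω
      have := dependsOn_cdist _ _ (line x i (t + j * L)) (line x i (t + j * L + (L - 1))) hω
      simp only at this
      simp only [f, this]
    · intro j _ j' _ hjj
      rw [Function.onFun, Set.disjoint_left]
      intro e he he'
      induction e using Sym2.ind with
      | _ u v =>
        have h1 := he u (by simp) i
        have h2 := he' u (by simp) i
        simp only [rowCorner, Function.update_self] at h1 h2
        rcases lt_or_gt_of_ne hjj with hlt | hlt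
        · have : (j + 1) * L ≤ j' * L := Nat.mul_le_mul_right L hlt
          rw [add_mul, one_mul] at this
          omega
        · have : (j' + 1) * L ≤ j * L := Nat.mul_le_mul_right L hlt
          rw [add_mul, one_mul] at this
          omega
  have hexp : ∀ ω, ∏ j ∈ Finset.range J, f j ω = Real.exp (rowSum ω x i L t J / L) := by
    intro ω
    rw [rowSum, Finset.sum_div, Real.exp_sum]
  calc _ ≤ (configLaw d N s β).real {ω | Real.exp τ ≤ ∏ j ∈ Finset.range J, f j ω} := by
        refine measureReal_mono fun ω hω => ?_
        simp only [Set.mem_ofPred_eq] at hω ⊢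
        rw [hexp]
        exact Real.exp_le_exp.2 ((le_div_iff₀ hL0).2 hω)
    _ ≤ (∫ ω, ∏ j ∈ Finset.range J, f j ω ∂configLaw d N s β) / Real.exp τ :=
        real_le_integral_div _ (fun ω => Finset.prod_nonneg fun _ _ => (Real.exp_pos _).le)
          (Real.exp_pos _)
    _ ≤ Real.exp (J * (2 * T / L)) / Real.exp τ := by gcongr
    _ = _ := by rw [Real.exp_sub]

lemma dist_line_le_rowSum (ω : Config d N) {L : ℕ} (hL : 1 ≤ L) (hLN : L ≤ N + 1) (x : Node d N)
    (i : Fin d) {t r : ℕ} (htr : t ≤ r) (hr : r ≤ N) :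
    ((boxGraph ω Set.univ).dist (line x i t) (line x i r) : ℝ) ≤
      rowSum ω x i L t ((r - t) / L) + ((r - t) / L : ℕ) + L := by
  have hJ : (r - t) / L * L ≤ r - t := Nat.div_mul_le_self _ _
  have hJ' : r - t < (r - t) / L * L + L := Nat.lt_div_mul_add (by omega)
  have hx : ∀ l, l ≠ i → lineCorner x L l ≤ x l ∧ (x l : ℕ) < lineCorner x L l + L :=
    fun l _ => ⟨(lineCorner_spec hL hLN x l).1, (lineCorner_spec hL hLN x l).2.1⟩
  obtain ⟨-, h1⟩ := dist_row_le ω (B := Set.univ) hL hx ((r - t) / L) (a := t) (by omega)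
    (fun _ _ => Set.subset_univ _) trivial
  obtain ⟨p, hp⟩ := exists_walk_line ω Set.univ x i (t := t + (r - t) / L * L) (r := r) (by omega)
    hr fun _ _ _ => trivial
  have h2 : (boxGraph ω Set.univ).dist (line x i (t + (r - t) / L * L)) (line x i r) ≤ L :=
    (SimpleGraph.dist_le p).trans (by omega)
  have h3 := (connected_boxGraph_univ ω).dist_triangle (u := line x i t)
    (v := line x i (t + (r - t) / L * L)) (w := line x i r)
  have h4 : ((boxGraph ω Set.univ).dist (line x i t) (line x i r) : ℝ) ≤
      (boxGraph ω Set.univ).dist (line x i t) (line x i (t + (r - t) / L * L)) + L := by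
    exact_mod_cast h3.trans (by omega)
  rw [Finset.sum_add_distrib] at h1
  simp only [Finset.sum_const, Finset.card_range, nsmul_eq_mul, mul_one] at h1
  unfold rowSum
  linarith

/-- A bound for the diameter from a bound for distances along lines. -/
lemma D_le_of_line {ω : Config d N} (hω : ω ∈ gridOpen d N) {Q : ℝ}
    (hQ : ∀ (x : Node d N) (i : Fin d) (t r : ℕ), t ≤ r → r ≤ N →
      ((boxGraph ω Set.univ).dist (line x i t) (line x i r) : ℝ) ≤ Q) : (D ω : ℝ) ≤ d * Q := by
  obtain ⟨x, y, hxy⟩ := exists_dist_eq_D ω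
  have h := dist_le_sum_mix ω (c := fun _ => 0) (L := N + 1) (x := x) (y := y)
    (by simp [cube_univ]) (by simp [cube_univ])
  rw [cube_univ, ← graph_eq_boxGraph hω, hxy] at h
  have h' : (D ω : ℝ) ≤ ∑ j ∈ Finset.range d, ((graph ω).dist (mix x y j) (mix x y (j + 1)) : ℝ) := by
    exact_mod_cast h
  refine h'.trans ?_
  calc _ ≤ ∑ _j ∈ Finset.range d, Q := Finset.sum_le_sum fun j hj => ?_
    _ = _ := by simp
  have hj := Finset.mem_range.1 hj
  have h1 := line_mix_left x y ⟨j, hj⟩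
  have h2 := line_mix_right x y ⟨j, hj⟩
  simp only at h1 h2
  rw [graph_eq_boxGraph hω, ← h1, ← h2]
  rcases le_total (x ⟨j, hj⟩ : ℕ) (y ⟨j, hj⟩) with hle | hle
  · exact hQ _ _ _ _ hle (by omega)
  · rw [SimpleGraph.dist_comm]
    exact hQ _ _ _ _ hle (by omega)

/-- A union bound over the polynomially many segments of lines. The diameter is at most d times the
largest distance along a line, which consists of the row sum, one edge per cube, and a remainder of
at most L grid steps. -/
lemma real_D_gt_le {L : ℕ} {T : ℝ} (h : AxisBound d N s β L T) (hT : 0 ≤ T) (hL : 1 ≤ L)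
    (hLN : L ≤ N + 1) (τ : ℝ) :
    (configLaw d N s β).real
      {ω | ω ∈ gridOpen d N ∧ (d : ℝ) * (τ * L + (N : ℝ) / L + L) < D ω} ≤
      d * ((N : ℝ) + 1) ^ (d + 2) * Real.exp ((N : ℝ) / L * (2 * T / L) - τ) := by
  classical
  have hL0 : (0 : ℝ) < L := by exact_mod_cast hL
  let I : Finset ((Node d N × Fin d) × (Fin (N + 1) × Fin (N + 1))) :=
    Finset.univ.filter fun p => p.2.1 ≤ p.2.2
  have hJN : ∀ t r : ℕ, r ≤ N → (((r - t) / L : ℕ) : ℝ) ≤ (N : ℝ) / L := by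
    intro t r hr
    refine Nat.cast_div_le.trans ?_
    gcongr
    omega
  have hsub : {ω | ω ∈ gridOpen d N ∧ (d : ℝ) * (τ * L + (N : ℝ) / L + L) < D ω} ⊆
      ⋃ p ∈ I, {ω | τ * L ≤ rowSum ω p.1.1 p.1.2 L p.2.1 ((p.2.2 - p.2.1 : ℕ) / L)} := by
    rintro ω ⟨hω, hD⟩
    by_contra hc
    rw [Set.mem_iUnion₂] at hc
    push Not at hc
    refine absurd (D_le_of_line hω ?_) (not_le.2 hD)
    intro x i t r htr hr
    have h1 := dist_line_le_rowSum ω hL hLN x i htr hr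
    have h2 := hc ((x, i), (⟨t, by omega⟩, ⟨r, by omega⟩)) (Finset.mem_filter.2
      ⟨Finset.mem_univ _, Fin.mk_le_mk.2 htr⟩)
    rw [Set.mem_ofPred_eq, not_le] at h2
    have := hJN t r hr
    linarith
  refine (measureReal_mono hsub (measure_ne_top _ _)).trans
    ((measureReal_biUnion_finset_le _ _).trans ?_)
  calc _ ≤ ∑ _p ∈ I, Real.exp ((N : ℝ) / L * (2 * T / L) - τ) := by
        refine Finset.sum_le_sum fun p hp => ?_
        have hle : (p.2.1 : ℕ) ≤ p.2.2 := (Finset.mem_filter.1 hp).2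
        have hJ : ((p.2.2 : ℕ) - p.2.1) / L * L ≤ (p.2.2 : ℕ) - p.2.1 := Nat.div_mul_le_self _ _
        refine (real_rowSum_ge_le h hL hLN p.1.1 p.1.2 p.2.1 _
          (by have := p.2.2.2; omega) τ).trans (Real.exp_le_exp.2 ?_)
        have := hJN p.2.1 p.2.2 (by omega)
        gcongr
    _ ≤ ∑ _p : (Node d N × Fin d) × (Fin (N + 1) × Fin (N + 1)),
          Real.exp ((N : ℝ) / L * (2 * T / L) - τ) :=
        Finset.sum_le_sum_of_subset_of_nonneg (Finset.subset_univ _)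
          fun _ _ _ => (Real.exp_pos _).le
    _ = _ := by
        simp
        ring

theorem tendsto_rpow_lt_D (hd : 1 ≤ d) (hβ : 0 < β) (hs : s = 2 * d) :
    ∃ η : ℝ, 0 < η ∧ η < 1 ∧ Tendsto (fun N : ℕ => (configLaw d N s β).real
      {ω | ω ∈ gridOpen d N ∧ (N : ℝ) ^ η < (D ω : ℝ)}) atTop (𝓝 0) := by
  obtain ⟨k, hk⟩ : ∃ k, k = 2 * d + 1 := ⟨_, rfl⟩
  obtain ⟨a, ha⟩ : ∃ a, a = (k : ℝ) - 1 + Real.exp (-(β / ((d : ℝ) * k) ^ (2 * d))) := ⟨_, rfl⟩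
  have hk3' : 3 ≤ k := by omega
  have hk3 : (3 : ℝ) ≤ k := by exact_mod_cast hk3'
  have hd1 : (1 : ℝ) ≤ d := by exact_mod_cast hd
  have ha2 : 2 ≤ a := by rw [ha]; have := Real.exp_pos (-(β / ((d : ℝ) * k) ^ (2 * d))); linarith
  have hak : a < k := by
    have : Real.exp (-(β / ((d : ℝ) * k) ^ (2 * d))) < 1 := by
      rw [Real.exp_lt_one_iff]
      exact neg_lt_zero.2 (by positivity)
    linarith
  have hlogk : 0 < Real.log k := Real.log_pos (by linarith)
  obtain ⟨ρ, hρ⟩ : ∃ ρ, ρ = Real.log a / Real.log k := ⟨_, rfl⟩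
  have hρ0 : 0 < ρ := by rw [hρ]; exact div_pos (Real.log_pos (by linarith)) hlogk
  have hρ1 : ρ < 1 := by
    rw [hρ, div_lt_one hlogk]; exact Real.log_lt_log (by linarith) hak
  have hkρ : (k : ℝ) ^ ρ = a := by
    rw [Real.rpow_def_of_pos (by linarith), hρ, mul_div_cancel₀ _ hlogk.ne',
      Real.exp_log (by linarith)]
  -- With cubes of side M about √N the diameter is of order M ^ (1 + ρ), hence of order N ^ ((1 + ρ)
  -- / 2). The exponent (3 + ρ) / 4 is the midpoint of (1 + ρ) / 2 and 1, so it also absorbs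
  -- constants.
  refine ⟨(3 + ρ) / 4, by linarith, by linarith, squeeze_zero'
    (Eventually.of_forall fun _ => measureReal_nonneg) ?_
    (tendsto_pow_mul_exp_neg_log_sq (d + 3) one_pos)⟩
  have e1 : ∀ᶠ N : ℕ in atTop, 5 * d * (k : ℝ) ^ 3 ≤ (N : ℝ) ^ ((1 - ρ) / 4) :=
    ((tendsto_rpow_atTop (by linarith)).comp tendsto_natCast_atTop_atTop).eventually_ge_atTop _
  have e2 : ∀ᶠ N : ℕ in atTop, Real.log N ^ (2 : ℝ) ≤ (N : ℝ) ^ (ρ / 2) := by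
    have h := (isLittleO_log_rpow_rpow_atTop (2 : ℝ) (half_pos hρ0)).bound one_pos
    have h' := tendsto_natCast_atTop_atTop.eventually h
    filter_upwards [h'] with N hN
    rw [one_mul, Real.norm_of_nonneg (Real.rpow_nonneg (Real.log_natCast_nonneg N) _),
      Real.norm_of_nonneg (by positivity)] at hN
    exact hN
  filter_upwards [e1, e2, eventually_ge_atTop d, eventually_ge_atTop 1] with N h1 h2 hdN hN1
  have hN0 : (0 : ℝ) < N := by exact_mod_cast hN1
  -- The largest power of k not exceeding √N; it satisfies M ^ 2 ≤ N ≤ k ^ 2 M ^ 2.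
  obtain ⟨n, hn⟩ : ∃ n, n = Nat.log k (Nat.sqrt N) := ⟨_, rfl⟩
  have hsq1 : 1 ≤ Nat.sqrt N := Nat.sqrt_pos.2 hN1
  have hM1 : k ^ n ≤ Nat.sqrt N := by rw [hn]; exact Nat.pow_log_le_self k (by omega)
  have hM2 : Nat.sqrt N < k ^ n * k := by
    rw [hn, ← pow_succ]; exact Nat.lt_pow_succ_log_self (by omega) _
  obtain ⟨M, hM⟩ : ∃ M, M = k ^ n := ⟨_, rfl⟩
  have hM0 : 1 ≤ M := by rw [hM]; exact Nat.one_le_pow _ _ (by omega)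
  have hMN : M ≤ N + 1 := by rw [hM]; exact hM1.trans ((Nat.sqrt_le_self N).trans (Nat.le_succ N))
  have hMr : (1 : ℝ) ≤ M := by exact_mod_cast hM0
  have hMle : (M : ℝ) ^ 2 ≤ N := by
    have : M * M ≤ N := (Nat.mul_le_mul (hM ▸ hM1) (hM ▸ hM1)).trans (Nat.sqrt_le N)
    rw [sq]; exact_mod_cast this
  have hMgt : (N : ℝ) ≤ (k : ℝ) ^ 2 * (M : ℝ) ^ 2 := by
    have h3 : N < (M * k) * (M * k) := lt_of_lt_of_le (Nat.lt_succ_sqrt N)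
      (Nat.mul_le_mul (hM ▸ hM2) (hM ▸ hM2))
    have h4 : (N : ℝ) ≤ ((M * k) * (M * k) : ℕ) := by exact_mod_cast h3.le
    push_cast at h4
    linarith
  have hT := axisBound_pow (N := N) hd hβ hs hk ha n
  rw [← hM] at hT
  have hapow : a ^ n = (M : ℝ) ^ ρ := by
    rw [← hkρ, hM]
    push_cast
    rw [← Real.rpow_natCast, ← Real.rpow_natCast, ← Real.rpow_mul (by linarith),
      ← Real.rpow_mul (by linarith), mul_comm]
  have hMρ1 : 1 ≤ (M : ℝ) ^ ρ := Real.one_le_rpow hMr hρ0.le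
  have hT0 : 0 ≤ (k : ℝ) * (a ^ n - 1) := by
    rw [hapow]; exact mul_nonneg (by linarith) (by linarith)
  have hTle : (k : ℝ) * (a ^ n - 1) ≤ k * (M : ℝ) ^ ρ := by
    rw [hapow]; exact mul_le_mul_of_nonneg_left (by linarith) (by linarith)
  have hNM : (N : ℝ) / M ≤ (k : ℝ) ^ 2 * M := by
    rw [div_le_iff₀ (by linarith)]; linarith
  -- The mean term in the exponent is at most 2 k ^ 3 M ^ ρ, so this threshold leaves k ^ 3 M ^ ρ ≥
  -- (log N) ^ 2 to spare.
  have hmain := real_D_gt_le hT hT0 hM0 hMN (3 * (k : ℝ) ^ 3 * (M : ℝ) ^ ρ)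
  refine le_trans (le_trans (measureReal_mono ?_) hmain) ?_
  · rintro ω ⟨hω, hD⟩
    refine ⟨hω, lt_of_le_of_lt ?_ hD⟩
    have h3 : (1 : ℝ) ≤ (k : ℝ) ^ 3 := one_le_pow₀ (by linarith)
    have h4 : (k : ℝ) ^ 2 ≤ (k : ℝ) ^ 3 := pow_le_pow_right₀ (by linarith) (by norm_num)
    have h5 : (M : ℝ) ≤ (M : ℝ) ^ ρ * M := le_mul_of_one_le_left (by linarith) hMρ1
    calc (d : ℝ) * (3 * (k : ℝ) ^ 3 * (M : ℝ) ^ ρ * M + N / M + M)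
        ≤ d * (3 * (k : ℝ) ^ 3 * (M : ℝ) ^ ρ * M + (k : ℝ) ^ 3 * ((M : ℝ) ^ ρ * M) +
            (k : ℝ) ^ 3 * ((M : ℝ) ^ ρ * M)) := by
          gcongr
          · exact hNM.trans (mul_le_mul h4 h5 (by linarith) (by positivity))
          · exact h5.trans (le_mul_of_one_le_left (by positivity) h3)
      _ = 5 * d * (k : ℝ) ^ 3 * (M : ℝ) ^ (1 + ρ) := by
          rw [Real.rpow_one_add' (by linarith) (by linarith)]; ring
      _ ≤ (N : ℝ) ^ ((1 - ρ) / 4) * (N : ℝ) ^ ((1 + ρ) / 2) := by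
          refine mul_le_mul h1 ?_ (by positivity) (by positivity)
          calc (M : ℝ) ^ (1 + ρ) = ((M : ℝ) ^ 2) ^ ((1 + ρ) / 2) := by
                rw [← Real.rpow_natCast, ← Real.rpow_mul (by linarith)]; congr 1; push_cast; ring
            _ ≤ _ := Real.rpow_le_rpow (by positivity) hMle (by linarith)
      _ = (N : ℝ) ^ ((3 + ρ) / 4) := by rw [← Real.rpow_add hN0]; congr 1; ring
  · have hexp : (N : ℝ) / M * (2 * (k * (a ^ n - 1)) / M) - 3 * (k : ℝ) ^ 3 * (M : ℝ) ^ ρ ≤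
        -(1 * Real.log N ^ 2) := by
      have h3 : (N : ℝ) / M * (2 * (k * (a ^ n - 1)) / M) ≤ 2 * (k : ℝ) ^ 3 * (M : ℝ) ^ ρ := by
        calc (N : ℝ) / M * (2 * (k * (a ^ n - 1)) / M)
            ≤ ((k : ℝ) ^ 2 * M) * (2 * (k * (M : ℝ) ^ ρ) / M) := by gcongr
          _ = _ := by field_simp
      have h4 : Real.log N ^ 2 ≤ (k : ℝ) ^ 3 * (M : ℝ) ^ ρ := by
        calc Real.log N ^ 2 = Real.log N ^ (2 : ℝ) := by norm_num
          _ ≤ (N : ℝ) ^ (ρ / 2) := h2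
          _ ≤ ((k : ℝ) ^ 2 * (M : ℝ) ^ 2) ^ (ρ / 2) :=
              Real.rpow_le_rpow hN0.le hMgt (by linarith)
          _ = (k : ℝ) ^ ρ * (M : ℝ) ^ ρ := by
              rw [← mul_pow, ← Real.rpow_natCast, ← Real.rpow_mul (by positivity),
                Real.mul_rpow (by linarith) (by linarith)]
              push_cast
              rw [mul_div_cancel₀ _ (two_ne_zero)]
          _ ≤ _ := by
              gcongr
              calc (k : ℝ) ^ ρ ≤ (k : ℝ) ^ (3 : ℝ) :=
                    Real.rpow_le_rpow_of_exponent_le (by linarith) (by linarith)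
                _ = _ := by norm_num
      linarith
    have hdN' : (d : ℝ) ≤ N := by exact_mod_cast hdN
    calc _ ≤ ((N : ℝ) + 2) * ((N : ℝ) + 2) ^ (d + 2) * Real.exp (-(1 * Real.log N ^ 2)) := by
          gcongr
          · linarith
          · linarith
      _ = _ := by ring

end Critical

/-! ### Division of the grid into blocks -/

section Blocks

variable {d N : ℕ} {s β : ℝ}

/-- Lowest corner of the block of side about `b` that contains `x`. -/
def corner (b : ℕ) (x : Node d N) : Node d N :=
  fun i => ⟨min ((x i : ℕ) / b * b) (((N + 1) / b - 1) * b), by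
    have := (x i).2
    have := Nat.div_mul_le_self (x i : ℕ) b
    omega⟩

lemma corner_add_le {b : ℕ} (hb : 1 ≤ b) (hbN : b ≤ N + 1) (x : Node d N) (i : Fin d) :
    (corner b x i : ℕ) + b ≤ N + 1 := by
  have h1 : 1 ≤ (N + 1) / b := (Nat.one_le_div_iff hb).2 hbN
  have h2 := Nat.div_mul_le_self (N + 1) b
  obtain ⟨q, hq⟩ : ∃ q, (N + 1) / b = q + 1 := ⟨(N + 1) / b - 1, by omega⟩
  rw [hq, add_mul, one_mul] at h2
  simp only [corner, hq, Nat.add_sub_cancel]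
  omega

/-- The incomplete blocks at the far end are merged into the last complete ones, so a block may
extend up to 2 b in each direction, although its core has side b. -/
lemma mem_cube_corner {b : ℕ} (hb : 1 ≤ b) (hbN : b ≤ N + 1) (x : Node d N) :
    x ∈ cube N (fun i => (corner b x i : ℕ)) (2 * b) := by
  intro i
  have h0 : 1 ≤ (N + 1) / b := (Nat.one_le_div_iff hb).2 hbN
  obtain ⟨q, hq⟩ : ∃ q, (N + 1) / b = q + 1 := ⟨(N + 1) / b - 1, by omega⟩
  have h1 := Nat.div_mul_le_self (x i : ℕ) b
  have h2 := Nat.lt_div_mul_add (a := (x i : ℕ)) hb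
  have h3 := Nat.lt_div_mul_add (a := N + 1) hb
  have h4 := (x i).2
  rw [hq, add_mul, one_mul] at h3
  simp only [corner, hq, Nat.add_sub_cancel]
  omega

lemma corner_of_mem_cube {b : ℕ} (hb : 1 ≤ b) (hbN : b ≤ N + 1) {x z : Node d N}
    (hz : z ∈ cube N (fun i => (corner b x i : ℕ)) b) : corner b z = corner b x := by
  funext i
  ext
  have h0 : 1 ≤ (N + 1) / b := (Nat.one_le_div_iff hb).2 hbN
  obtain ⟨q, hq⟩ : ∃ q, (N + 1) / b = q + 1 := ⟨(N + 1) / b - 1, by omega⟩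
  have h1 := hz i
  simp only [corner, hq, Nat.add_sub_cancel] at h1 ⊢
  obtain ⟨w, hw⟩ : ∃ w, min ((x i : ℕ) / b * b) (q * b) = w * b ∧ w ≤ q := by
    rcases le_total ((x i : ℕ) / b) q with h | h
    · exact ⟨_, min_eq_left (Nat.mul_le_mul_right b h), h⟩
    · exact ⟨_, min_eq_right (Nat.mul_le_mul_right b h), le_rfl⟩
  rw [hw.1] at h1 ⊢
  have h2 : (z i : ℕ) / b = w := Nat.div_eq_of_lt_le h1.1 (by rw [Nat.succ_mul]; omega)
  rw [h2]
  exact min_eq_left (Nat.mul_le_mul_right b hw.2)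

lemma corner_mem_cube {b : ℕ} (hb : 1 ≤ b) (x : Node d N) :
    x ∈ cube N (fun i => (x i : ℕ)) b := fun _ => ⟨le_rfl, Nat.lt_add_of_pos_right hb⟩

lemma corner_corner {b : ℕ} (hb : 1 ≤ b) (hbN : b ≤ N + 1) (x : Node d N) :
    corner b (corner b x) = corner b x :=
  corner_of_mem_cube hb hbN (corner_mem_cube hb _)

open Classical in
/-- The union of the cubes of side `b` with corners in `A`. -/
noncomputable def core (b : ℕ) (A : Finset (Node d N)) : Finset (Node d N) :=
  A.biUnion fun c => (cube N (fun i => (c i : ℕ)) b).toFinite.toFinset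

lemma mem_core {b : ℕ} {A : Finset (Node d N)} {z : Node d N} :
    z ∈ core b A ↔ ∃ c ∈ A, z ∈ cube N (fun i => (c i : ℕ)) b := by
  simp [core]

lemma card_core {b : ℕ} (hb : 1 ≤ b) (hbN : b ≤ N + 1) {A : Finset (Node d N)}
    (hA : ∀ c ∈ A, corner b c = c) : (core b A).card = A.card * b ^ d := by
  classical
  have hcor : ∀ c ∈ A, ∀ z ∈ cube N (fun i => (c i : ℕ)) b, corner b z = c := by
    intro c hc z hz
    rw [← hA c hc] at hz
    rw [corner_of_mem_cube hb hbN hz, hA c hc]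
  unfold core
  rw [Finset.card_biUnion]
  · rw [Finset.sum_congr rfl (g := fun _ => b ^ d)]
    · simp
    · intro c hc
      refine card_cube fun i => ?_
      have := corner_add_le hb hbN c i
      rwa [hA c hc] at this
  · intro c hc c' hc' hne
    rw [Function.onFun, Finset.disjoint_left]
    intro z hz hz'
    exact hne ((hcor c hc z (by simpa using hz)).symm.trans (hcor c' hc' z (by simpa using hz')))

lemma card_cube_le (c : Fin d → ℕ) (L : ℕ) : (cube N c L).toFinite.toFinset.card ≤ L ^ d := by
  classical
  have h : (cube N c L).toFinite.toFinset.card ≤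
      (Fintype.piFinset fun i : Fin d => Finset.Ico (c i) (c i + L)).card := by
    refine Finset.card_le_card_of_injOn (fun x i => (x i : ℕ)) ?_ ?_
    · intro x hx
      have hx : x ∈ cube N c L := by simpa using hx
      rw [Finset.mem_coe, Fintype.mem_piFinset]
      exact fun i => Finset.mem_Ico.2 (hx i)
    · intro x _ y _ h
      funext i
      exact Fin.ext (congrFun h i)
  refine h.trans (le_of_eq ?_)
  rw [Fintype.card_piFinset]
  simp

lemma card_le_mul_card_image_corner {b : ℕ} (hb : 1 ≤ b) (hbN : b ≤ N + 1)
    [DecidableEq (Node d N)] (S : Finset (Node d N)) :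
    S.card ≤ (2 * b) ^ d * (S.image (corner b)).card := by
  refine Finset.card_le_mul_card_image S _ fun c _ => ?_
  refine le_trans (Finset.card_le_card ?_) (card_cube_le (N := N) (fun i => (c i : ℕ)) (2 * b))
  intro z hz
  have := mem_cube_corner hb hbN z
  rw [(Finset.mem_filter.1 hz).2] at this
  simpa using this

end Blocks

/-! ### Chernoff bound for the number of nodes reached -/

section Chernoff

variable {d N : ℕ} {β : ℝ}

/-- Pairs of even length at least `r`. -/
def Adm (r : ℕ) (u v : Node d N) : Prop := Even (l1dist u v) ∧ r ≤ l1dist u v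

open Classical in
/-- The nodes joined to `A` by an open admissible pair. -/
noncomputable def reached (r : ℕ) (ω : Config d N) (A : Finset (Node d N)) : Finset (Node d N) :=
  Finset.univ.filter fun v => ∃ u ∈ A, Adm r u v ∧ ω s(u, v) = true

open Classical in
/-- Expected number of admissible open pairs at `v` with other endpoint in `A`, up to a constant. -/
noncomputable def intensity (β : ℝ) (r : ℕ) (A : Finset (Node d N)) (v : Node d N) : ℝ :=
  ∑ u ∈ A, if Adm r u v then β / (l1dist u v : ℝ) ^ (d : ℝ) else 0

lemma real_not_reached_le (hβ : 0 ≤ β) (r : ℕ) (A : Finset (Node d N)) (v : Node d N) :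
    (configLaw d N d β).real {ω | v ∉ reached r ω A} ≤ Real.exp (-intensity β r A v) := by
  classical
  have hinj : Set.InjOn (fun u : Node d N => s(u, v)) (A.filter fun u => Adm r u v) := by
    intro u _ u' _ h
    rcases Sym2.eq_iff.1 h with h | h
    · exact h.1
    · exact h.1.trans h.2
  have h := real_forall_closed_le (s := d) (β := β) hβ
    ((A.filter fun u => Adm r u v).image fun u => s(u, v))
  rw [Finset.sum_image hinj, Finset.sum_filter] at h
  refine le_trans (measureReal_mono ?_) h
  intro ω hω e he
  obtain ⟨u, hu, rfl⟩ := Finset.mem_image.1 he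
  rw [Finset.mem_filter] at hu
  simp only [reached, Set.mem_ofPred_eq, Finset.mem_filter, Finset.mem_univ, true_and, not_exists,
    not_and] at hω
  simpa using hω u hu.1 hu.2

/-- For distinct v outside A the sets of pairs joining v to A are disjoint, so the events of being
reached are independent. The Chernoff bound therefore runs over the complement of A. -/
lemma dependsOn_mem_reached (r : ℕ) (A : Finset (Node d N)) (v : Node d N) :
    DependsOn (fun ω : Config d N => v ∈ reached r ω A) {e | ∃ u ∈ A, e = s(u, v)} := by
  intro ω ω' h
  simp only [reached, Finset.mem_filter, Finset.mem_univ, true_and, eq_iff_iff]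
  refine exists_congr fun u => and_congr_right fun hu => and_congr_right fun _ => ?_
  rw [h _ ⟨u, hu, rfl⟩]

open Classical in
/-- A Chernoff bound for the number of nodes reached. -/
lemma real_card_reached_le (hβ : 0 ≤ β) (r : ℕ) (A : Finset (Node d N))
    (ht : ∀ v, intensity β r A v ≤ 1) (y : ℝ) :
    (configLaw d N d β).real {ω | ((reached r ω A).card : ℝ) ≤ y} ≤
      Real.exp (y - (∑ v ∈ Aᶜ, intensity β r A v) / 4) := by
  have hint0 : ∀ v, 0 ≤ intensity β r A v := fun v => Finset.sum_nonneg fun u _ => by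
    split_ifs <;> positivity
  -- This is exp (-1) if v is reached and 1 otherwise, so its product over the complement of A is
  -- the exponential of minus the number reached there.
  let f : Node d N → Config d N → ℝ := fun v ω =>
    Real.exp (-1) + (1 - Real.exp (-1)) * {ω | v ∉ reached r ω A}.indicator 1 ω
  have hf : ∀ v, DependsOn (f v) {e | ∃ u ∈ A, e = s(u, v)} := by
    intro v ω ω' h
    have h1 : DependsOn (fun ω : Config d N => ω ∈ {ω | v ∉ reached r ω A})
        {e | ∃ u ∈ A, e = s(u, v)} := by
      intro ω ω' h
      have := dependsOn_mem_reached r A v h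
      simp only at this
      simp only [Set.mem_ofPred_eq, this]
    simp only [f, dependsOn_indicator h1 h]
  have he1 : Real.exp (-1) ≤ 1 / 2 := by
    have h1 := Real.add_one_le_exp (1 : ℝ)
    rw [Real.exp_neg, inv_le_comm₀ (Real.exp_pos _) (by norm_num)]
    linarith
  have hEf : ∀ v, ∫ ω, f v ω ∂configLaw d N d β ≤ Real.exp (-(intensity β r A v / 4)) := by
    intro v
    have h1 := real_not_reached_le hβ r A v
    -- Here intensities at most 1 are needed: each node is reached with probability at least half
    -- its intensity. The factor 1 - exp (-1) ≥ 1 / 2 costs the other half of the final constant 1 /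
    -- 4.
    have h2 : Real.exp (-intensity β r A v) ≤ 1 - intensity β r A v / 2 := by
      have h3 := Real.add_one_le_exp (intensity β r A v)
      have h4 : Real.exp (-intensity β r A v) * Real.exp (intensity β r A v) = 1 := by
        rw [← Real.exp_add, neg_add_cancel, Real.exp_zero]
      have h5 := Real.exp_pos (-intensity β r A v)
      nlinarith [hint0 v, ht v, mul_nonneg (hint0 v) (sub_nonneg.2 (ht v)),
        mul_le_mul_of_nonneg_left h3 h5.le]
    have h5 := Real.add_one_le_exp (-(intensity β r A v / 4))
    simp only [f]
    rw [integral_add (integrable_config _) (integrable_config _), integral_const_mul,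
      integral_indicator_config]
    simp only [integral_const, probReal_univ, one_smul]
    have h6 := hint0 v
    nlinarith
  have hprod : ∫ ω, ∏ v ∈ Aᶜ, f v ω ∂configLaw d N d β ≤
      Real.exp (-((∑ v ∈ Aᶜ, intensity β r A v) / 4)) := by
    rw [integral_prod_of_dependsOn Aᶜ (fun v _ => hf v)]
    · calc _ ≤ ∏ v ∈ Aᶜ, Real.exp (-(intensity β r A v / 4)) :=
          Finset.prod_le_prod (fun v _ => integral_nonneg fun ω => by
            have : (0 : ℝ) ≤ {ω | v ∉ reached r ω A}.indicator (1 : Config d N → ℝ) ω :=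
              Set.indicator_nonneg (fun _ _ => zero_le_one) _
            have := Real.exp_pos (-1)
            simp only [Pi.zero_apply, f]
            nlinarith) fun v _ => hEf v
        _ = _ := by rw [← Real.exp_sum, Finset.sum_neg_distrib, Finset.sum_div]
    · intro v hv v' hv' hne
      rw [Function.onFun, Set.disjoint_left]
      rintro e ⟨u, hu, rfl⟩ ⟨u', hu', h⟩
      rw [Sym2.eq_iff] at h
      rcases h with h | h
      · exact hne h.2
      · rw [Finset.mem_coe, Finset.mem_compl] at hv
        exact hv (h.2 ▸ hu')
  have hexp : ∀ ω, Real.exp (-((reached r ω A).card : ℝ)) ≤ ∏ v ∈ Aᶜ, f v ω := by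
    intro ω
    have h1 : ∀ v, f v ω = Real.exp (-(if v ∈ reached r ω A then 1 else 0)) := by
      intro v
      by_cases hv : v ∈ reached r ω A <;> simp [f, hv]
    simp only [h1]
    rw [← Real.exp_sum, Finset.sum_neg_distrib]
    refine Real.exp_le_exp.2 (neg_le_neg ?_)
    rw [← Finset.sum_filter, Finset.sum_const, nsmul_eq_mul, mul_one]
    exact_mod_cast Finset.card_le_card fun v hv => (Finset.mem_filter.1 hv).2
  calc _ ≤ (configLaw d N d β).real {ω | Real.exp (-y) ≤ ∏ v ∈ Aᶜ, f v ω} := by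
        refine measureReal_mono fun ω hω => ?_
        exact (Real.exp_le_exp.2 (neg_le_neg hω)).trans (hexp ω)
    _ ≤ (∫ ω, ∏ v ∈ Aᶜ, f v ω ∂configLaw d N d β) / Real.exp (-y) :=
        real_le_integral_div _ (fun ω => (Real.exp_pos _).le.trans (hexp ω)) (Real.exp_pos _)
    _ ≤ Real.exp (-((∑ v ∈ Aᶜ, intensity β r A v) / 4)) / Real.exp (-y) := by gcongr
    _ = _ := by rw [← Real.exp_sub]; congr 1; ring

-- Since admissible pairs have length at least r and β |A| ≤ r ^ d, every intensity is at most 1,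
-- and each u in A loses at most 1 ≤ β S / 2 to targets inside A. At least |A| β S / 2 of total
-- intensity thus points outside A.
open Classical in
lemma real_card_reached_le_of_sum (hβ : 0 < β) {r : ℕ} (hr : 1 ≤ r) (A : Finset (Node d N))
    (hA : β * A.card ≤ (r : ℝ) ^ d) {S : ℝ}
    (hS : ∀ u : Node d N, S ≤ ∑ v, if Adm r u v then ((l1dist u v : ℝ) ^ d)⁻¹ else 0)
    (hβS : 2 ≤ β * S) :
    (configLaw d N d β).real {ω | ((reached r ω A).card : ℝ) ≤ A.card * (β * S) / 16} ≤
      Real.exp (-(A.card * (β * S) / 16)) := by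
  have hr0 : (0 : ℝ) < r := by exact_mod_cast hr
  have hterm : ∀ u v : Node d N, (if Adm r u v then β / (l1dist u v : ℝ) ^ (d : ℝ) else 0) ≤
      β / (r : ℝ) ^ d := by
    intro u v
    split_ifs with h
    · have h1 : (r : ℝ) ≤ l1dist u v := by exact_mod_cast h.2
      rw [Real.rpow_natCast]
      gcongr
    · positivity
  have hle : ∀ v, intensity β r A v ≤ 1 := by
    intro v
    refine (Finset.sum_le_sum fun u _ => hterm u v).trans ?_
    rw [Finset.sum_const, nsmul_eq_mul, mul_div_assoc', div_le_one (by positivity)]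
    linarith
  have hsum : A.card * (β * S) / 2 ≤ ∑ v ∈ Aᶜ, intensity β r A v := by
    have h1 : ∀ u ∈ A, β * S / 2 ≤
        ∑ v ∈ Aᶜ, if Adm r u v then β / (l1dist u v : ℝ) ^ (d : ℝ) else 0 := by
      intro u _
      have h2 := Finset.sum_add_sum_compl A fun v =>
        if Adm r u v then β / (l1dist u v : ℝ) ^ (d : ℝ) else 0
      have h3 : ∑ v ∈ A, (if Adm r u v then β / (l1dist u v : ℝ) ^ (d : ℝ) else 0) ≤ 1 := by
        refine (Finset.sum_le_sum fun v _ => hterm u v).trans ?_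
        rw [Finset.sum_const, nsmul_eq_mul, mul_div_assoc', div_le_one (by positivity)]
        linarith
      have h4 : β * S ≤ ∑ v, if Adm r u v then β / (l1dist u v : ℝ) ^ (d : ℝ) else 0 := by
        refine (mul_le_mul_of_nonneg_left (hS u) hβ.le).trans (le_of_eq ?_)
        rw [Finset.mul_sum]
        refine Finset.sum_congr rfl fun v _ => ?_
        rw [mul_ite, mul_zero, Real.rpow_natCast, div_eq_mul_inv]
      linarith
    calc A.card * (β * S) / 2 = ∑ _u ∈ A, β * S / 2 := by
          rw [Finset.sum_const, nsmul_eq_mul]; ring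
      _ ≤ ∑ u ∈ A, ∑ v ∈ Aᶜ, (if Adm r u v then β / (l1dist u v : ℝ) ^ (d : ℝ) else 0) :=
          Finset.sum_le_sum h1
      _ = _ := by rw [Finset.sum_comm]; rfl
  refine (real_card_reached_le hβ.le r A hle _).trans (Real.exp_le_exp.2 ?_)
  linarith

end Chernoff

/-! ### Every node has many admissible partners -/

section Dyadic

variable {d N : ℕ}

/-- Shift every coordinate of `u` by `2 * w i`, towards the farther end of the grid. -/
def shift (u : Node d N) (w : Fin d → ℕ) : Node d N :=
  fun i => ⟨min (if 2 * (u i : ℕ) ≤ N then (u i : ℕ) + 2 * w i else (u i : ℕ) - 2 * w i) N, by omega⟩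

lemma natAbs_sub_shift (u : Node d N) {w : Fin d → ℕ} (hw : ∀ i, 4 * w i ≤ N) (i : Fin d) :
    ((u i : ℤ) - (shift u w i : ℤ)).natAbs = 2 * w i := by
  have h1 := hw i
  have h2 := (u i).2
  simp only [shift]
  split_ifs <;> omega

lemma l1dist_shift (u : Node d N) {w : Fin d → ℕ} (hw : ∀ i, 4 * w i ≤ N) :
    l1dist u (shift u w) = 2 * ∑ i, w i := by
  rw [l1dist, Finset.mul_sum]
  exact Finset.sum_congr rfl fun i _ => natAbs_sub_shift u hw i

lemma shift_injOn (u : Node d N) : Set.InjOn (shift u) {w | ∀ i, 4 * w i ≤ N} := by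
  intro w hw w' hw' h
  funext i
  have h1 := natAbs_sub_shift u hw i
  rw [h, natAbs_sub_shift u hw' i] at h1
  omega

-- For each j, shifts by 2 w with all coordinates of w in [2 ^ j, 2 ^ (j + 1)) give 2 ^ (j d) nodes
-- at even distance at most 4 d 2 ^ j. Each dyadic scale thus contributes the same constant. Scales
-- stop below n - 2 so that 4 w ≤ N, which lets every coordinate move towards its farther end
-- without leaving the grid.
open Classical in
lemma le_sum_adm (hd : 1 ≤ d) {a n : ℕ} (hn : 2 ^ n ≤ N) (u : Node d N) :
    ((n - 2 - a : ℕ) : ℝ) * ((4 * (d : ℝ)) ^ d)⁻¹ ≤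
      ∑ v, if Adm (2 ^ a) u v then ((l1dist u v : ℝ) ^ d)⁻¹ else 0 := by
  have : Nonempty (Fin d) := ⟨⟨0, hd⟩⟩
  have hd0 : (0 : ℝ) < d := by exact_mod_cast hd
  let W : ℕ → Finset (Fin d → ℕ) := fun j =>
    Fintype.piFinset fun _ => Finset.Ico (2 ^ j) (2 ^ (j + 1))
  have hW : ∀ {j w}, w ∈ W j → ∀ i, 2 ^ j ≤ w i ∧ w i < 2 ^ (j + 1) := fun h i =>
    Finset.mem_Ico.1 (Fintype.mem_piFinset.1 h i)
  have hdisj : Set.PairwiseDisjoint (Finset.Ico a (n - 2) : Set ℕ) W := by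
    intro j _ j' _ hne
    rw [Function.onFun, Finset.disjoint_left]
    intro w h h'
    let i : Fin d := ⟨0, hd⟩
    have h1 := Nat.log_eq_of_pow_le_of_lt_pow (hW h i).1 (hW h i).2
    have h2 := Nat.log_eq_of_pow_le_of_lt_pow (hW h' i).1 (hW h' i).2
    exact hne (h1.symm.trans h2)
  have hsmall : ∀ j ∈ Finset.Ico a (n - 2), ∀ w ∈ W j, ∀ i, 4 * w i ≤ N := by
    intro j hj w hw i
    have h1 := (hW hw i).2
    have h2 : 2 ^ (j + 3) ≤ 2 ^ n :=
      Nat.pow_le_pow_right (by norm_num) (by have := (Finset.mem_Ico.1 hj).2; omega)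
    have h3 : 2 ^ (j + 3) = 4 * 2 ^ (j + 1) := by ring
    omega
  have hterm : ∀ j ∈ Finset.Ico a (n - 2), ∀ w ∈ W j, ((4 * (d : ℝ) * 2 ^ j) ^ d)⁻¹ ≤
      if Adm (2 ^ a) u (shift u w) then ((l1dist u (shift u w) : ℝ) ^ d)⁻¹ else 0 := by
    intro j hj w hw
    have h1 := l1dist_shift u (hsmall j hj w hw)
    have h2 : 2 ^ j ≤ ∑ i, w i :=
      (hW hw ⟨0, hd⟩).1.trans (Finset.single_le_sum (f := w) (fun _ _ => Nat.zero_le _)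
        (Finset.mem_univ _))
    have h3 : ∑ i, w i ≤ d * 2 ^ (j + 1) := by
      refine (Finset.sum_le_sum fun i _ => (hW hw i).2.le).trans (le_of_eq ?_)
      simp
    have h4 : 2 ^ a ≤ 2 ^ j := Nat.pow_le_pow_right (by norm_num) (Finset.mem_Ico.1 hj).1
    have h5 : 0 < 2 ^ a := by positivity
    rw [if_pos ⟨⟨∑ i, w i, by omega⟩, by omega⟩]
    have h6 : 0 < l1dist u (shift u w) := by omega
    have h7 : (0 : ℝ) < l1dist u (shift u w) := by exact_mod_cast h6
    have h8 : (l1dist u (shift u w) : ℝ) ≤ 4 * d * 2 ^ j := by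
      have : l1dist u (shift u w) ≤ 4 * d * 2 ^ j := by
        rw [h1]
        calc _ ≤ 2 * (d * 2 ^ (j + 1)) := by omega
          _ = _ := by ring
      exact_mod_cast this
    gcongr
  calc ((n - 2 - a : ℕ) : ℝ) * ((4 * (d : ℝ)) ^ d)⁻¹
      = ∑ j ∈ Finset.Ico a (n - 2), ∑ w ∈ W j, ((4 * (d : ℝ) * 2 ^ j) ^ d)⁻¹ := by
        rw [Finset.sum_congr rfl (g := fun _ => ((4 * (d : ℝ)) ^ d)⁻¹)]
        · simp
        · intro j _
          have h : (W j).card = (2 ^ j) ^ d := by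
            simp only [W, Fintype.card_piFinset, Nat.card_Ico, Finset.prod_const,
              Finset.card_univ, Fintype.card_fin]
            congr 1
            rw [pow_succ]
            omega
          rw [Finset.sum_const, h, nsmul_eq_mul, mul_pow (4 * (d : ℝ))]
          push_cast
          field_simp
    _ ≤ ∑ j ∈ Finset.Ico a (n - 2), ∑ w ∈ W j,
          if Adm (2 ^ a) u (shift u w) then ((l1dist u (shift u w) : ℝ) ^ d)⁻¹ else 0 :=
        Finset.sum_le_sum fun j hj => Finset.sum_le_sum fun w hw => hterm j hj w hw
    _ = ∑ v ∈ ((Finset.Ico a (n - 2)).biUnion W).image (shift u),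
          if Adm (2 ^ a) u v then ((l1dist u v : ℝ) ^ d)⁻¹ else 0 := by
        rw [Finset.sum_image, Finset.sum_biUnion hdisj]
        refine (shift_injOn u).mono fun w hw => ?_
        obtain ⟨j, hj, hw⟩ := Finset.mem_biUnion.1 (Finset.mem_coe.1 hw)
        exact hsmall j hj w hw
    _ ≤ _ := Finset.sum_le_sum_of_subset_of_nonneg (Finset.subset_univ _) fun v _ _ => by
        split_ifs <;> positivity

end Dyadic

/-! ### Averaging over an independent choice of event -/

section Independence

variable {d N : ℕ} {s β : ℝ}

/-- A bad event chosen by means of independent randomness is as unlikely as each bad event. -/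
lemma real_key_mem_le {κ : Type*} [Fintype κ] {key : Config d N → κ} {bad : κ → Set (Config d N)}
    {S T : Set (Sym2 (Node d N))} (hkey : DependsOn key S)
    (hbad : ∀ k, DependsOn (fun ω => ω ∈ bad k) T) (hST : Disjoint S T) {p : ℝ}
    (hp : ∀ k, (configLaw d N s β).real (bad k) ≤ p) :
    (configLaw d N s β).real {ω | ω ∈ bad (key ω)} ≤ p := by
  classical
  have hsub : {ω : Config d N | ω ∈ bad (key ω)} ⊆
      ⋃ k ∈ (Finset.univ : Finset κ), {ω | key ω = k} ∩ bad k := by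
    intro ω hω
    simp only [Finset.mem_univ, Set.iUnion_true, Set.mem_iUnion]
    exact ⟨key ω, rfl, hω⟩
  have hone : ∑ k, (configLaw d N s β).real {ω | key ω = k} = 1 := by
    rw [← measureReal_biUnion_finset]
    · have : (⋃ k ∈ (Finset.univ : Finset κ), {ω : Config d N | key ω = k}) = Set.univ := by
        ext ω; simp
      rw [this, probReal_univ]
    · intro k _ k' _ hne
      rw [Function.onFun, Set.disjoint_left]
      intro ω h h'
      exact hne (Eq.trans (Eq.symm h) h')
    · exact fun _ _ => (Set.toFinite _).measurableSet
  calc _ ≤ ∑ k, (configLaw d N s β).real ({ω | key ω = k} ∩ bad k) :=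
        (measureReal_mono hsub (measure_ne_top _ _)).trans (measureReal_biUnion_finset_le _ _)
    _ ≤ ∑ k, (configLaw d N s β).real {ω | key ω = k} * p := by
        refine Finset.sum_le_sum fun k _ => ?_
        rw [real_inter_of_dependsOn (S := S) (T := T) _ (hbad k) hST]
        · exact mul_le_mul_of_nonneg_left (hp k) measureReal_nonneg
        · intro ω ω' h
          simp only [Set.mem_ofPred_eq, hkey h]
    _ = p := by rw [← Finset.sum_mul, hone, one_mul]

end Independence

/-! ### Exploration by pairs of even length -/

section Exploration

variable {d N : ℕ} {β : ℝ}

lemma reached_mono (r : ℕ) (ω : Config d N) {A B : Finset (Node d N)} (h : A ⊆ B) :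
    reached r ω A ⊆ reached r ω B := by
  intro v hv
  simp only [reached, Finset.mem_filter, Finset.mem_univ, true_and] at hv ⊢
  obtain ⟨u, hu, h'⟩ := hv
  exact ⟨u, h hu, h'⟩

open Classical in
/-- The corners of the blocks that are reached from the blocks with corners in `A`. -/
noncomputable def step (b r : ℕ) (ω : Config d N) (A : Finset (Node d N)) : Finset (Node d N) :=
  (reached r ω (core b A)).image (corner b)

lemma step_mono (b r : ℕ) (ω : Config d N) {A B : Finset (Node d N)} (h : A ⊆ B) :
    step b r ω A ⊆ step b r ω B := by
  classical
  exact Finset.image_subset_image (reached_mono r ω (Finset.biUnion_subset_biUnion_of_subset_left _ h))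

/-- Sets of at most `M` blocks grow by a factor `K`. -/
def Expands (b r : ℕ) (K : ℝ) (M : ℕ) (ω : Config d N) : Prop :=
  ∀ A : Finset (Node d N), (∀ c ∈ A, corner b c = c) → A.card ≤ M →
    A.card * K ≤ (step b r ω A).card

/-- The Chernoff bound for the core of A is y ^ |A|, and summing it over all nonempty sets gives (1
+ y) ^ ((N + 1) ^ d) - 1. Controlling all sets simultaneously removes the need to condition on the
history of an exploration. The factor 2 ^ d in K converts nodes into blocks, since a block has at
most (2 b) ^ d nodes. -/
lemma real_not_expands_le (hβ : 0 < β) {b r M : ℕ} (hb : 1 ≤ b) (hbN : b ≤ N + 1) (hr : 1 ≤ r)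
    (hM : β * (M * (b : ℝ) ^ d) ≤ (r : ℝ) ^ d) {S : ℝ}
    (hS : ∀ u : Node d N, S ≤ ∑ v, open Classical in
      if Adm r u v then ((l1dist u v : ℝ) ^ d)⁻¹ else 0)
    (hβS : 2 ≤ β * S) :
    (configLaw d N d β).real {ω | ¬ Expands b r (β * S / (16 * 2 ^ d)) M ω} ≤
      Real.exp (((N : ℝ) + 1) ^ d * Real.exp (-((b : ℝ) ^ d * (β * S) / 16))) - 1 := by
  classical
  obtain ⟨y, hy⟩ : ∃ y, y = Real.exp (-((b : ℝ) ^ d * (β * S) / 16)) := ⟨_, rfl⟩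
  have hy0 : 0 < y := hy ▸ Real.exp_pos _
  have hb0 : (0 : ℝ) < b := by exact_mod_cast hb
  let bad : Finset (Node d N) → Set (Config d N) := fun A =>
    {ω | ((∀ c ∈ A, corner b c = c) ∧ A.card ≤ M) ∧
      ¬ A.card * (β * S / (16 * 2 ^ d)) ≤ (step b r ω A).card}
  have hsub : {ω : Config d N | ¬ Expands b r (β * S / (16 * 2 ^ d)) M ω} ⊆
      ⋃ A ∈ (Finset.univ : Finset (Finset (Node d N))).erase ∅, bad A := by
    intro ω hω
    simp only [Expands, Set.mem_ofPred_eq, not_forall] at hω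
    obtain ⟨A, h1, h2, h3⟩ := hω
    simp only [Set.mem_iUnion]
    refine ⟨A, ?_, ⟨h1, h2⟩, h3⟩
    rw [Finset.mem_erase]
    refine ⟨?_, Finset.mem_univ _⟩
    rintro rfl
    simp at h3
  have hbad : ∀ A, (configLaw d N d β).real (bad A) ≤ y ^ A.card := by
    intro A
    by_cases hA : (∀ c ∈ A, corner b c = c) ∧ A.card ≤ M
    swap
    · rw [show bad A = ∅ from Set.eq_empty_of_forall_notMem fun ω h => hA h.1, measureReal_empty]
      positivity
    have hcard := card_core hb hbN hA.1
    have hAM : (A.card : ℝ) ≤ M := by exact_mod_cast hA.2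
    have h := real_card_reached_le_of_sum hβ hr (core b A) (by
      rw [hcard]
      push_cast
      exact le_trans (by gcongr) hM) hS hβS
    rw [hcard] at h
    push_cast at h
    have h1 : Real.exp (-(A.card * (b : ℝ) ^ d * (β * S) / 16)) = y ^ A.card := by
      rw [hy, ← Real.exp_nat_mul]
      congr 1
      ring
    rw [← h1]
    refine le_trans (measureReal_mono ?_ (measure_ne_top _ _)) h
    rintro ω ⟨-, h2⟩
    rw [not_le] at h2
    have h3 := card_le_mul_card_image_corner hb hbN (reached r ω (core b A))
    have h4 : ((reached r ω (core b A)).card : ℝ) ≤ (2 * b) ^ d * (step b r ω A).card := by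
      exact_mod_cast h3
    refine h4.trans ?_
    calc (2 * (b : ℝ)) ^ d * (step b r ω A).card
        ≤ (2 * (b : ℝ)) ^ d * (A.card * (β * S / (16 * 2 ^ d))) := by gcongr
      _ = _ := by rw [mul_pow]; field_simp
  calc _ ≤ ∑ A ∈ (Finset.univ : Finset (Finset (Node d N))).erase ∅, y ^ A.card :=
        (measureReal_mono hsub (measure_ne_top _ _)).trans
          ((measureReal_biUnion_finset_le _ _).trans (Finset.sum_le_sum fun A _ => hbad A))
    _ = (y + 1) ^ ((N + 1) ^ d) - 1 := by
        have h := Fintype.sum_pow_mul_eq_add_pow (Node d N) y 1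
        simp only [one_pow, mul_one, Fintype.card_pi, Fintype.card_fin, Finset.prod_const,
          Finset.card_univ] at h
        rw [← h, ← Finset.add_sum_erase _ _ (Finset.mem_univ ∅)]
        simp
    _ ≤ _ := by
        have h1 := pow_le_pow_left₀ (by positivity) (Real.add_one_le_exp y) ((N + 1) ^ d)
        rw [← Real.exp_nat_mul] at h1
        push_cast at h1
        rw [← hy]
        linarith

/-- The corners of the blocks reached from the block of `x` after `j` steps. -/
noncomputable def explored (b r : ℕ) (ω : Config d N) (x : Node d N) (j : ℕ) : Finset (Node d N) :=
  (step b r ω)^[j] {corner b x}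

lemma explored_succ (b r : ℕ) (ω : Config d N) (x : Node d N) (j : ℕ) :
    explored b r ω x (j + 1) = step b r ω (explored b r ω x j) :=
  Function.iterate_succ_apply' _ _ _

lemma corner_of_mem_explored {b r : ℕ} (hb : 1 ≤ b) (hbN : b ≤ N + 1) {ω : Config d N}
    {x c : Node d N} {j : ℕ} (hc : c ∈ explored b r ω x j) : corner b c = c := by
  classical
  cases j with
  | zero =>
    rw [Finset.mem_singleton.1 hc]
    exact corner_corner hb hbN x
  | succ j =>
    rw [explored_succ] at hc
    obtain ⟨z, -, rfl⟩ := Finset.mem_image.1 hc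
    exact corner_corner hb hbN z

lemma min_le_card_explored {b r M : ℕ} (hb : 1 ≤ b) (hbN : b ≤ N + 1) {K : ℝ} (hK : 1 ≤ K)
    {ω : Config d N} (h : Expands b r K M ω) (x : Node d N) (j : ℕ) :
    min (K ^ j) M ≤ (explored b r ω x j).card := by
  induction j with
  | zero => simp [explored]
  | succ j ih =>
    rw [explored_succ]
    have hfix : ∀ c ∈ explored b r ω x j, corner b c = c :=
      fun c hc => corner_of_mem_explored hb hbN hc
    rcases le_total M (explored b r ω x j).card with hM | hM
    · obtain ⟨A, hA, hcard⟩ := Finset.exists_subset_card_eq hM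
      have h1 := h A (fun c hc => hfix c (hA hc)) hcard.le
      have h2 : ((step b r ω A).card : ℝ) ≤ (step b r ω (explored b r ω x j)).card := by
        exact_mod_cast Finset.card_le_card (step_mono b r ω hA)
      rw [hcard] at h1
      have h3 : (M : ℝ) ≤ M * K := le_mul_of_one_le_right (by positivity) hK
      exact (min_le_right _ _).trans (by linarith)
    · have h1 := h _ hfix hM
      refine le_trans ?_ h1
      rcases min_le_iff.1 ih with h2 | h2
      · refine (min_le_left _ _).trans ?_
        rw [pow_succ]
        gcongr
      · refine (min_le_right _ _).trans (h2.trans ?_)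
        exact le_mul_of_one_le_right (by positivity) hK

/-- One exploration step costs one open edge and at most d (2 b) grid steps inside the block where
it lands. -/
lemma dist_le_of_corner_mem_explored {b r : ℕ} (hb : 1 ≤ b) (hbN : b ≤ N + 1) {ω : Config d N}
    {x : Node d N} (j : ℕ) : ∀ z, corner b z ∈ explored b r ω x j →
    (boxGraph ω Set.univ).dist x z ≤ d * (2 * b) + (d * (2 * b) + 1) * j := by
  classical
  have hconn := connected_boxGraph_univ ω
  have hblock : ∀ z z' : Node d N, corner b z' = corner b z →
      (boxGraph ω Set.univ).dist z z' ≤ d * (2 * b) := by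
    intro z z' h
    have h1 := mem_cube_corner hb hbN z
    have h2 := mem_cube_corner hb hbN z'
    rw [h] at h2
    exact (dist_univ_le ω (reachable_cube ω h1 h2)).trans (dist_cube_le ω h1 h2)
  induction j with
  | zero =>
    intro z hz
    have := hblock x z (Finset.mem_singleton.1 hz)
    omega
  | succ j ih =>
    intro z hz
    rw [explored_succ] at hz
    obtain ⟨v, hv, hvz⟩ := Finset.mem_image.1 hz
    simp only [reached, Finset.mem_filter, Finset.mem_univ, true_and] at hv
    obtain ⟨u, hu, -, huv⟩ := hv
    obtain ⟨c, hc, huc⟩ := mem_core.1 hu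
    have hfix := corner_of_mem_explored hb hbN hc
    rw [← hfix] at huc
    have h1 := ih u (by rw [corner_of_mem_cube hb hbN huc, hfix]; exact hc)
    have h2 : (boxGraph ω Set.univ).dist u v ≤ 1 := by
      by_cases huv' : u = v
      · rw [huv', SimpleGraph.dist_self]; omega
      · have hadj : (boxGraph ω Set.univ).Adj u v := ⟨huv', trivial, trivial, Or.inr huv⟩
        exact (SimpleGraph.dist_eq_one_iff_adj.2 hadj).le
    have h3 := hblock v z hvz.symm
    have h4 := hconn.dist_triangle (u := x) (v := u) (w := z)
    have h5 := hconn.dist_triangle (u := u) (v := v) (w := z)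
    rw [mul_add, mul_one]
    omega

/-- Admissible pairs have even length, so the state of the odd pairs remains fresh after the
exploration. -/
lemma dependsOn_explored (b r : ℕ) (x : Node d N) (j : ℕ) :
    DependsOn (fun ω : Config d N => explored b r ω x j) {e | Even (len e)} := by
  classical
  intro ω ω' h
  have h1 : step b r ω = step b r ω' := by
    funext A
    have : reached r ω (core b A) = reached r ω' (core b A) := by
      ext v
      simp only [reached, Finset.mem_filter, Finset.mem_univ, true_and]
      refine exists_congr fun u => and_congr_right fun _ => and_congr_right fun hu => ?_
      rw [h s(u, v) hu.1]
    rw [step, step, this]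
  simp only [explored, h1]

end Exploration

/-! ### Connecting two explorations by pairs of odd length -/

section Meeting

variable {d N : ℕ} {s β : ℝ}

lemma l1dist_add_two_mul (u v : Node d N) :
    l1dist u v + 2 * ∑ i, min (u i : ℕ) (v i) = ∑ i, (u i : ℕ) + ∑ i, (v i : ℕ) := by
  rw [l1dist, Finset.mul_sum, ← Finset.sum_add_distrib, ← Finset.sum_add_distrib]
  refine Finset.sum_congr rfl fun i _ => ?_
  omega

/-- A cube of side at least two contains a node at odd distance from a given node. -/
lemma exists_odd_l1dist (hd : 1 ≤ d) {b : ℕ} (hb : 2 ≤ b) {c' : Node d N}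
    (hc' : ∀ i, (c' i : ℕ) + b ≤ N + 1) (c : Node d N) :
    ∃ v ∈ cube N (fun i => (c' i : ℕ)) b, Odd (l1dist c v) := by
  by_cases h : Odd (l1dist c c')
  · exact ⟨c', corner_mem_cube (by omega) c', h⟩
  rw [Nat.not_odd_iff_even] at h
  let i : Fin d := ⟨0, hd⟩
  have hi := hc' i
  refine ⟨line c' i (c' i + 1), line_mem_cube (by omega) (fun j _ => corner_mem_cube (by omega) c' j)
    (by omega) (by omega), ?_⟩
  have h1 := l1dist_line c' i (t := c' i) (r := c' i + 1) (by omega) (by omega)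
  rw [line_coord] at h1
  have h2 := l1dist_add_two_mul c' (line c' i (c' i + 1))
  have h3 := l1dist_add_two_mul c c'
  have h4 := l1dist_add_two_mul c (line c' i (c' i + 1))
  rw [Nat.even_iff] at h
  rw [Nat.odd_iff]
  omega

/-- All pairs of odd length between the blocks of `A` and `B` are closed. -/
def OddClosed (b : ℕ) (A B : Finset (Node d N)) (ω : Config d N) : Prop :=
  ∀ c ∈ A, ∀ c' ∈ B, ∀ u ∈ cube N (fun i => (c i : ℕ)) b, ∀ v ∈ cube N (fun i => (c' i : ℕ)) b,
    Odd (l1dist u v) → ω s(u, v) = false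

/-- For each pair of blocks one pair of odd length suffices: the corner of the first with a node of
the second, where b ≥ 2 provides both parities. These |A| |B| pairs are distinct and have length at
most d N. -/
lemma real_oddClosed_le (hd : 1 ≤ d) (hs : 0 ≤ s) (hβ : 0 ≤ β) {b : ℕ} (hb : 2 ≤ b)
    (hbN : b ≤ N + 1) {A B : Finset (Node d N)} (hA : ∀ c ∈ A, corner b c = c)
    (hB : ∀ c ∈ B, corner b c = c) (hAB : Disjoint A B) :
    (configLaw d N s β).real {ω | OddClosed b A B ω} ≤
      Real.exp (-(β * (A.card * B.card) / ((d : ℝ) * N) ^ s)) := by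
  classical
  have hb1 : 1 ≤ b := by omega
  have hex : ∀ c c' : Node d N, ∃ v : Node d N, c' ∈ B →
      v ∈ cube N (fun i => (c' i : ℕ)) b ∧ Odd (l1dist c v) := by
    intro c c'
    by_cases h : c' ∈ B
    · obtain ⟨v, h1, h2⟩ := exists_odd_l1dist hd hb (c' := c') (fun i => by
        have := corner_add_le hb1 hbN c' i
        rwa [hB c' h] at this) c
      exact ⟨v, fun _ => ⟨h1, h2⟩⟩
    · exact ⟨c', fun h' => absurd h' h⟩
  choose φ hφ using hex
  have hcor : ∀ c, ∀ c' ∈ B, corner b (φ c c') = c' := by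
    intro c c' h
    have h1 := (hφ c c' h).1
    rw [← hB c' h] at h1
    rw [← hB c' h]
    rw [hB c' h] at h1 ⊢
    have h2 : φ c c' ∈ cube N (fun i => (corner b c' i : ℕ)) b := by rw [hB c' h]; exact h1
    rw [corner_of_mem_cube hb1 hbN h2, hB c' h]
  have hinj : Set.InjOn (fun p : Node d N × Node d N => s(p.1, φ p.1 p.2)) (A ×ˢ B : Finset _) := by
    intro p hp q hq h
    rw [Finset.mem_coe, Finset.mem_product] at hp hq
    simp only [Sym2.eq_iff] at h
    rcases h with h | h
    · refine Prod.ext h.1 ?_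
      rw [← hcor p.1 p.2 hp.2, h.2, hcor q.1 q.2 hq.2]
    · have h1 : p.1 = q.2 := by rw [← hA p.1 hp.1, h.1, hcor q.1 q.2 hq.2]
      exact absurd (h1 ▸ hp.1) fun h' => Finset.disjoint_left.1 hAB h' hq.2
  have h := real_forall_closed_le_of_len (s := s) (β := β) hs hβ
    ((A ×ˢ B).image fun p => s(p.1, φ p.1 p.2)) (R := d * N) (by
      intro e he
      obtain ⟨p, hp, rfl⟩ := Finset.mem_image.1 he
      rw [Finset.mem_product] at hp
      rw [len_mk]
      exact ⟨(hφ p.1 p.2 hp.2).2.pos, by exact_mod_cast l1dist_le _ _⟩)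
  rw [Finset.card_image_of_injOn hinj, Finset.card_product] at h
  push_cast at h
  refine le_trans (measureReal_mono ?_) h
  intro ω hω e he
  obtain ⟨p, hp, rfl⟩ := Finset.mem_image.1 he
  rw [Finset.mem_product] at hp
  exact hω p.1 hp.1 p.2 hp.2 p.1 (corner_mem_cube hb1 _) _ (hφ p.1 p.2 hp.2).1 (hφ p.1 p.2 hp.2).2

lemma dependsOn_oddClosed (b : ℕ) (A B : Finset (Node d N)) :
    DependsOn (fun ω : Config d N => OddClosed b A B ω) {e | Odd (len e)} := by
  intro ω ω' h
  simp only [OddClosed, eq_iff_iff]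
  refine forall₂_congr fun c _ => forall₂_congr fun c' _ => forall₂_congr fun u _ =>
    forall₂_congr fun v _ => forall_congr' fun hodd => ?_
  rw [h s(u, v) hodd]

lemma real_explored_oddClosed_le (hd : 1 ≤ d) (hs : 0 ≤ s) (hβ : 0 ≤ β) {b : ℕ} (hb : 2 ≤ b)
    (hbN : b ≤ N + 1) (r M J : ℕ) (x y : Node d N) :
    (configLaw d N s β).real {ω | (Disjoint (explored b r ω x J) (explored b r ω y J) ∧
      M ≤ (explored b r ω x J).card ∧ M ≤ (explored b r ω y J).card) ∧
      OddClosed b (explored b r ω x J) (explored b r ω y J) ω} ≤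
      Real.exp (-(β * ((M : ℝ) * M) / ((d : ℝ) * N) ^ s)) := by
  classical
  let bad : Finset (Node d N) × Finset (Node d N) → Set (Config d N) := fun k =>
    {ω | ((∀ c ∈ k.1, corner b c = c) ∧ (∀ c ∈ k.2, corner b c = c) ∧ Disjoint k.1 k.2 ∧
      M ≤ k.1.card ∧ M ≤ k.2.card) ∧ OddClosed b k.1 k.2 ω}
  have h := real_key_mem_le (s := s) (β := β)
    (key := fun ω : Config d N => (explored b r ω x J, explored b r ω y J)) (bad := bad)
    (S := {e | Even (len e)}) (T := {e | Odd (len e)})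
    (p := Real.exp (-(β * ((M : ℝ) * M) / ((d : ℝ) * N) ^ s))) ?_ ?_ ?_ ?_
  · refine le_trans (measureReal_mono ?_ (measure_ne_top _ _)) h
    rintro ω ⟨h1, h2⟩
    exact ⟨⟨fun c hc => corner_of_mem_explored (by omega) hbN hc,
      fun c hc => corner_of_mem_explored (by omega) hbN hc, h1⟩, h2⟩
  · intro ω ω' h
    exact Prod.ext (dependsOn_explored b r x J h) (dependsOn_explored b r y J h)
  · intro k ω ω' h
    have := dependsOn_oddClosed b k.1 k.2 h
    simp only at this
    simp only [bad, Set.mem_ofPred_eq, this]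
  · rw [Set.disjoint_left]
    intro e he ho
    exact Nat.not_odd_iff_even.2 he ho
  · intro k
    by_cases hk : (∀ c ∈ k.1, corner b c = c) ∧ (∀ c ∈ k.2, corner b c = c) ∧ Disjoint k.1 k.2 ∧
      M ≤ k.1.card ∧ M ≤ k.2.card
    · refine (measureReal_mono (fun ω hω => hω.2) (measure_ne_top _ _)).trans
        ((real_oddClosed_le hd hs hβ hb hbN hk.1 hk.2.1 hk.2.2.1).trans ?_)
      have h1 : (M : ℝ) ≤ k.1.card := by exact_mod_cast hk.2.2.2.1
      have h2 : (M : ℝ) ≤ k.2.card := by exact_mod_cast hk.2.2.2.2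
      gcongr
    · rw [show bad k = ∅ from Set.eq_empty_of_forall_notMem fun ω h => hk h.1, measureReal_empty]
      positivity

lemma dist_le_of_not_oddClosed {b r J : ℕ} (hb : 1 ≤ b) (hbN : b ≤ N + 1) {ω : Config d N}
    {x y : Node d N} (h : ¬ (Disjoint (explored b r ω x J) (explored b r ω y J) ∧
      OddClosed b (explored b r ω x J) (explored b r ω y J) ω)) :
    (boxGraph ω Set.univ).dist x y ≤ 2 * (d * (2 * b) + (d * (2 * b) + 1) * J) + 1 := by
  have hconn := connected_boxGraph_univ ω
  by_cases hdis : Disjoint (explored b r ω x J) (explored b r ω y J)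
  · have h' : ¬ OddClosed b (explored b r ω x J) (explored b r ω y J) ω := fun h' => h ⟨hdis, h'⟩
    simp only [OddClosed, not_forall, Bool.not_eq_false] at h'
    obtain ⟨c, hc, c', hc', u, hu, v, hv, -, huv⟩ := h'
    have hfix := corner_of_mem_explored hb hbN hc
    have hfix' := corner_of_mem_explored hb hbN hc'
    rw [← hfix] at hu
    rw [← hfix'] at hv
    have h1 := dist_le_of_corner_mem_explored hb hbN J u
      (by rw [corner_of_mem_cube hb hbN hu, hfix]; exact hc)
    have h2 := dist_le_of_corner_mem_explored hb hbN J v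
      (by rw [corner_of_mem_cube hb hbN hv, hfix']; exact hc')
    have h3 : (boxGraph ω Set.univ).dist u v ≤ 1 := by
      by_cases huv' : u = v
      · rw [huv', SimpleGraph.dist_self]; omega
      · have hadj : (boxGraph ω Set.univ).Adj u v := ⟨huv', trivial, trivial, Or.inr huv⟩
        exact (SimpleGraph.dist_eq_one_iff_adj.2 hadj).le
    have h4 := hconn.dist_triangle (u := x) (v := u) (w := y)
    have h5 := hconn.dist_triangle (u := u) (v := v) (w := y)
    rw [SimpleGraph.dist_comm (u := y)] at h2
    omega
  · obtain ⟨c, hc, hc'⟩ := Finset.not_disjoint_iff.1 hdis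
    have hfix := corner_of_mem_explored hb hbN hc
    have h1 := dist_le_of_corner_mem_explored hb hbN J c (by rw [hfix]; exact hc)
    have h2 := dist_le_of_corner_mem_explored hb hbN J c (by rw [hfix]; exact hc')
    have h4 := hconn.dist_triangle (u := x) (v := c) (w := y)
    rw [SimpleGraph.dist_comm (u := y)] at h2
    omega

/-- Under expansion both explorations have at least M blocks after J steps. A geodesic longer than
the stated length then requires them to be disjoint with all odd pairs between them closed, and a
union bound over the two starting nodes remains. -/
lemma real_lt_D_le_of_expands (hd : 1 ≤ d) (hs : 0 ≤ s) (hβ : 0 ≤ β) {b : ℕ} (hb : 2 ≤ b)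
    (hbN : b ≤ N + 1) {r M J : ℕ} {K : ℝ} (hK : 1 ≤ K) (hM : (M : ℝ) ≤ K ^ J) :
    (configLaw d N s β).real {ω | ω ∈ gridOpen d N ∧
      2 * (d * (2 * b) + (d * (2 * b) + 1) * J) + 1 < D ω} ≤
      (configLaw d N s β).real {ω | ¬ Expands b r K M ω} +
        ((N : ℝ) + 1) ^ (2 * d) * Real.exp (-(β * ((M : ℝ) * M) / ((d : ℝ) * N) ^ s)) := by
  classical
  let bad : Node d N × Node d N → Set (Config d N) := fun p =>
    {ω | (Disjoint (explored b r ω p.1 J) (explored b r ω p.2 J) ∧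
      M ≤ (explored b r ω p.1 J).card ∧ M ≤ (explored b r ω p.2 J).card) ∧
      OddClosed b (explored b r ω p.1 J) (explored b r ω p.2 J) ω}
  have hsub : {ω : Config d N | ω ∈ gridOpen d N ∧
      2 * (d * (2 * b) + (d * (2 * b) + 1) * J) + 1 < D ω} ⊆
      {ω | ¬ Expands b r K M ω} ∪ ⋃ p ∈ (Finset.univ : Finset _), bad p := by
    rintro ω ⟨hω, hD⟩
    by_contra hc
    simp only [Set.mem_union, not_or, Set.mem_ofPred_eq, not_not] at hc
    obtain ⟨hexp, hc⟩ := hc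
    obtain ⟨x, y, hxy⟩ := exists_dist_eq_D ω
    have hcard : ∀ z, M ≤ (explored b r ω z J).card := by
      intro z
      have h1 := min_le_card_explored (by omega) hbN hK hexp z J
      rw [min_eq_right hM] at h1
      exact_mod_cast h1
    have h1 := dist_le_of_not_oddClosed (x := x) (y := y) (r := r) (J := J) (by omega : 1 ≤ b) hbN
      (ω := ω) fun h => hc (by
        simp only [Finset.mem_univ, Set.iUnion_true, Set.mem_iUnion]
        exact ⟨(x, y), ⟨h.1, hcard x, hcard y⟩, h.2⟩)
    rw [← graph_eq_boxGraph hω, hxy] at h1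
    omega
  refine (measureReal_mono hsub (measure_ne_top _ _)).trans ((measureReal_union_le _ _).trans ?_)
  gcongr
  refine (measureReal_biUnion_finset_le _ _).trans ?_
  calc _ ≤ ∑ _p : Node d N × Node d N,
        Real.exp (-(β * ((M : ℝ) * M) / ((d : ℝ) * N) ^ s)) :=
        Finset.sum_le_sum fun p _ => real_explored_oddClosed_le hd hs hβ hb hbN r M J p.1 p.2
    _ = _ := by simp [pow_mul', sq]

end Meeting

/-! ### Upper bound for s = d: choice of scales -/

section Critical

variable {d : ℕ} {s β : ℝ}

/-- A power of two between `(N / 2) ^ (3 / 4)` and `N` for which every node has many admissible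
partners. -/
lemma exists_scale (hd : 1 ≤ d) {N : ℕ} (hN : 2 ^ 23 ≤ N) :
    ∃ r : ℕ, 1 ≤ r ∧ r ≤ N ∧ (N : ℝ) ^ 3 ≤ 8 * (r : ℝ) ^ 4 ∧ ∀ u : Node d N,
      ((4 * (d : ℝ)) ^ d)⁻¹ / 8 * Real.log N ≤ ∑ v, open Classical in
        if Adm r u v then ((l1dist u v : ℝ) ^ d)⁻¹ else 0 := by
  obtain ⟨n, hn⟩ : ∃ n, n = Nat.log 2 N := ⟨_, rfl⟩
  have hn1 : 2 ^ n ≤ N := hn ▸ Nat.pow_log_le_self 2 (by omega)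
  have hn2 : N < 2 ^ (n + 1) := hn ▸ Nat.lt_pow_succ_log_self (by norm_num) N
  have hn3 : 23 ≤ n := hn ▸ Nat.le_log_of_pow_le (by norm_num) hN
  have hn4 : (N : ℝ) ≤ 2 ^ (n + 1) := by exact_mod_cast hn2.le
  have hN0 : (0 : ℝ) < N := by
    have : 0 < 2 ^ 23 := by norm_num
    exact_mod_cast this.trans_le hN
  -- The exponent is 3 n / 4 rounded up, where 2 ^ n ≤ N < 2 ^ (n + 1). Nearly a quarter of the
  -- dyadic scales lie above it; n ≥ 23 leaves at least (n + 1) / 8 of them after rounding.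
  refine ⟨2 ^ ((3 * n + 3) / 4), Nat.one_le_two_pow,
    (Nat.pow_le_pow_right (by norm_num) (by omega)).trans hn1, ?_, fun u => ?_⟩
  · push_cast
    calc (N : ℝ) ^ 3 ≤ (2 ^ (n + 1)) ^ 3 := by gcongr
      _ = 8 * 2 ^ (3 * n) := by ring
      _ ≤ 8 * 2 ^ ((3 * n + 3) / 4 * 4) := by
        have h : 3 * n ≤ (3 * n + 3) / 4 * 4 := by omega
        exact mul_le_mul_of_nonneg_left (pow_le_pow_right₀ (by norm_num) h) (by norm_num)
      _ = _ := by rw [pow_mul]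
  · refine le_trans ?_ (le_sum_adm hd hn1 u)
    have h1 : Real.log N ≤ n + 1 := by
      have h2 := Real.log_le_log hN0 hn4
      rw [Real.log_pow] at h2
      have h3 := Real.log_two_lt_d9
      push_cast at h2
      have h4 : (0 : ℝ) ≤ n := Nat.cast_nonneg n
      nlinarith
    have h5 : (n : ℝ) + 1 ≤ 8 * ((n - 2 - (3 * n + 3) / 4 : ℕ) : ℝ) := by
      exact_mod_cast (by omega : n + 1 ≤ 8 * (n - 2 - (3 * n + 3) / 4))
    have h6 : (0 : ℝ) ≤ ((4 * (d : ℝ)) ^ d)⁻¹ := by positivity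
    nlinarith [mul_le_mul_of_nonneg_left (h1.trans h5) h6]

lemma tendsto_exp_sub_one (d : ℕ) :
    Tendsto (fun N : ℕ => Real.exp (((N : ℝ) + 1) ^ d * Real.exp (-((d + 1) * Real.log N))) - 1)
      atTop (𝓝 0) := by
  have h : Tendsto (fun N : ℕ => ((N : ℝ) + 1) ^ d * Real.exp (-((d + 1) * Real.log N)))
      atTop (𝓝 0) := by
    have hlim : Tendsto (fun N : ℕ => (2 : ℝ) ^ d / N) atTop (𝓝 0) :=
      tendsto_const_div_atTop_nhds_zero_nat _
    refine squeeze_zero' (Eventually.of_forall fun _ => by positivity) ?_ hlim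
    filter_upwards [eventually_ge_atTop 1] with N hN
    have hN0 : (1 : ℝ) ≤ N := by exact_mod_cast hN
    have h1 : Real.exp (-((d + 1) * Real.log N)) = ((N : ℝ) ^ (d + 1))⁻¹ := by
      rw [Real.exp_neg, ← Real.rpow_natCast, Real.rpow_def_of_pos (by linarith)]
      push_cast
      ring_nf
    rw [h1]
    calc ((N : ℝ) + 1) ^ d * ((N : ℝ) ^ (d + 1))⁻¹ ≤ (2 * N) ^ d * ((N : ℝ) ^ (d + 1))⁻¹ := by
          gcongr; linarith
      _ = _ := by rw [mul_pow, pow_succ]; field_simp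
  have h2 := ((Real.continuous_exp.tendsto 0).comp h).sub_const 1
  simpa using h2

/-- The number of blocks that can be explored without interfering with each other. -/
lemma exists_threshold (hd : 1 ≤ d) (hβ : 0 < β) {b : ℕ} (hb : 1 ≤ b) :
    ∃ κ : ℝ, 0 < κ ∧ ∀ᶠ N : ℕ in atTop, ∀ r : ℕ, 1 ≤ r → r ≤ N → (N : ℝ) ^ 3 ≤ 8 * (r : ℝ) ^ 4 →
      ∃ M : ℕ, β * (M * (b : ℝ) ^ d) ≤ (r : ℝ) ^ d ∧ (M : ℝ) ≤ (N : ℝ) ^ d ∧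
        κ * Real.log N ^ 2 ≤ β * ((M : ℝ) * M) / ((d : ℝ) * N) ^ (d : ℝ) := by
  have hd0 : (0 : ℝ) < d := by exact_mod_cast hd
  -- M will be r ^ d / B rounded down, so B at least β b ^ d gives the first condition. As r is of
  -- order N ^ (3 / 4), r ^ 2 eventually exceeds N (log N) ^ 2, which makes M ^ 2 at least of order
  -- N ^ d (log N) ^ 2.
  obtain ⟨B, hB⟩ : ∃ B : ℕ, B = b ^ d * ⌈β⌉₊ := ⟨_, rfl⟩
  have hB1 : 0 < B := by
    rw [hB]
    have := Nat.ceil_pos.2 hβ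
    positivity
  have hB0 : (0 : ℝ) < B := by exact_mod_cast hB1
  refine ⟨β / (4 * B ^ 2 * (d : ℝ) ^ d), by positivity, ?_⟩
  have hlog := (isLittleO_log_rpow_atTop (show (0 : ℝ) < 1 / 4 by norm_num)).comp_tendsto
    tendsto_natCast_atTop_atTop
  filter_upwards [hlog.def (show (0 : ℝ) < 1 / 8 by norm_num), eventually_ge_atTop (8 * B ^ 4),
    tendsto_log_natCast.eventually_ge_atTop 1, eventually_ge_atTop 2] with N h1 h2 h3 h4 r hr hrN hr4
  have hN0 : (2 : ℝ) ≤ N := by exact_mod_cast h4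
  have hr0 : (1 : ℝ) ≤ r := by exact_mod_cast hr
  have hlogN : 8 * Real.log N ^ 4 ≤ N := by
    simp only [Function.comp_apply, Real.norm_eq_abs] at h1
    rw [abs_of_nonneg (by linarith), abs_of_nonneg (by positivity)] at h1
    have h5 := pow_le_pow_left₀ (by linarith) h1 4
    rw [mul_pow, ← Real.rpow_natCast ((N : ℝ) ^ (1 / 4 : ℝ)), ← Real.rpow_mul (by linarith)] at h5
    norm_num at h5
    linarith
  have hr2 : (N : ℝ) * Real.log N ^ 2 ≤ (r : ℝ) ^ 2 := by
    refine le_of_sq_le_sq ?_ (by positivity)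
    have h5 := mul_le_mul_of_nonneg_left hlogN (show (0 : ℝ) ≤ (N : ℝ) ^ 2 by positivity)
    nlinarith
  have hBr : B ≤ r := by
    have h5 : (8 * B ^ 4 : ℝ) ≤ N := by exact_mod_cast h2
    have h6 : (B : ℝ) ≤ r := by
      refine le_of_pow_le_pow_left₀ (n := 4) (by norm_num) (by positivity) ?_
      have h7 : (N : ℝ) ≤ N ^ 3 := le_self_pow₀ (by linarith) (by norm_num)
      linarith
    exact_mod_cast h6
  have hrd : r ≤ r ^ d := Nat.le_self_pow (by omega) r
  have hM1 : 1 ≤ r ^ d / B := (Nat.one_le_div_iff hB1).2 (hBr.trans hrd)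
  have hM2 : (((r ^ d / B : ℕ) : ℝ)) * B ≤ (r : ℝ) ^ d := by exact_mod_cast Nat.div_mul_le_self _ _
  have hM3 : (r : ℝ) ^ d ≤ 2 * B * ((r ^ d / B : ℕ) : ℝ) := by
    have h5 := Nat.lt_div_mul_add (a := r ^ d) hB1
    have h6 : B ≤ r ^ d / B * B := Nat.le_mul_of_pos_left B hM1
    have h7 : r ^ d ≤ 2 * B * (r ^ d / B) := by
      calc r ^ d ≤ r ^ d / B * B + r ^ d / B * B := by omega
        _ = _ := by ring
    exact_mod_cast h7
  refine ⟨r ^ d / B, ?_, ?_, ?_⟩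
  · refine le_trans ?_ hM2
    rw [hB]
    push_cast
    have h5 := Nat.le_ceil β
    calc _ = ((r ^ d / (b ^ d * ⌈β⌉₊) : ℕ) : ℝ) * ((b : ℝ) ^ d * β) := by ring
      _ ≤ _ := by gcongr
  · exact_mod_cast (Nat.div_le_self _ _).trans (Nat.pow_le_pow_left hrN d)
  · obtain ⟨m, hm⟩ : ∃ m : ℝ, m = ((r ^ d / B : ℕ) : ℝ) := ⟨_, rfl⟩
    rw [← hm] at hM3 ⊢
    have h5 : (N : ℝ) ^ d * Real.log N ^ 2 ≤ 4 * B ^ 2 * (m * m) := by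
      calc (N : ℝ) ^ d * Real.log N ^ 2 ≤ (N : ℝ) ^ d * (Real.log N ^ 2) ^ d := by
            gcongr
            exact le_self_pow₀ (one_le_pow₀ h3) (by omega)
        _ = (N * Real.log N ^ 2) ^ d := by rw [mul_pow]
        _ ≤ ((r : ℝ) ^ 2) ^ d := by gcongr
        _ = ((r : ℝ) ^ d) ^ 2 := by ring
        _ ≤ (2 * B * m) ^ 2 := by gcongr
        _ = _ := by ring
    rw [Real.rpow_natCast, mul_pow, le_div_iff₀ (by positivity)]
    calc _ = β / (4 * B ^ 2) * ((N : ℝ) ^ d * Real.log N ^ 2) := by field_simp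
      _ ≤ β / (4 * B ^ 2) * (4 * B ^ 2 * (m * m)) := by gcongr
      _ = _ := by field_simp

/-- Growth by a factor K of order log N exceeds √(log N) eventually, so log log N ≤ 2 log K. This
explains the 2 in the number of steps needed to reach N ^ d. -/
lemma pow_le_pow_ceil_log {N : ℕ} {K : ℝ} (hN : Real.exp 1 < Real.log N)
    (hK : Real.log N ≤ K ^ 2) (hK0 : 0 < K) :
    (N : ℝ) ^ d ≤ K ^ ⌈2 * d * Real.log N / Real.log (Real.log N)⌉₊ := by
  have hlog : 0 < Real.log N := (Real.exp_pos 1).trans hN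
  have hN0 : (0 : ℝ) < N := by
    rcases (Nat.cast_nonneg N : (0 : ℝ) ≤ N).eq_or_lt with h | h
    · rw [← h, Real.log_zero] at hlog
      exact absurd hlog (lt_irrefl _)
    · exact h
  have hll : 1 < Real.log (Real.log N) := (Real.lt_log_iff_exp_lt hlog).2 hN
  have h1 : Real.log (Real.log N) ≤ 2 * Real.log K := by
    have := Real.log_le_log hlog hK
    rwa [Real.log_pow] at this
  have h2 := Nat.le_ceil (2 * d * Real.log N / Real.log (Real.log N))
  rw [div_le_iff₀ (by linarith)] at h2
  refine (Real.log_le_log_iff (by positivity) (by positivity)).1 ?_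
  rw [Real.log_pow, Real.log_pow]
  have h3 := mul_le_mul_of_nonneg_left h1
    (Nat.cast_nonneg (α := ℝ) ⌈2 * d * Real.log N / Real.log (Real.log N)⌉₊)
  linarith

theorem tendsto_log_div_log_log_lt_D (hd : 1 ≤ d) (hβ : 0 < β) (hs : s = d) :
    ∃ C : ℝ, 0 < C ∧ Tendsto (fun N : ℕ => (configLaw d N s β).real
      {ω | ω ∈ gridOpen d N ∧ C * Real.log N / Real.log (Real.log N) < (D ω : ℝ)})
      atTop (𝓝 0) := by
  subst hs
  have hd0 : (0 : ℝ) < d := by exact_mod_cast hd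
  obtain ⟨c₀, hc₀⟩ : ∃ c₀ : ℝ, c₀ = ((4 * (d : ℝ)) ^ d)⁻¹ / 8 := ⟨_, rfl⟩
  have hc₀0 : 0 < c₀ := by rw [hc₀]; positivity
  -- Large enough that the failure probability per block, exp (-b ^ d β S / 16), is at most N ^ (-(d
  -- + 1)) and beats the (N + 1) ^ d blocks; the added 2 makes both parities available.
  obtain ⟨b, hb⟩ : ∃ b : ℕ, b = ⌈16 * (d + 1) / (β * c₀)⌉₊ + 2 := ⟨_, rfl⟩
  have hb2 : 2 ≤ b := by omega
  have hb0 : (2 : ℝ) ≤ b := by exact_mod_cast hb2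
  have hbc : 16 * ((d : ℝ) + 1) ≤ (b : ℝ) ^ d * (β * c₀) := by
    have h1 := Nat.le_ceil (16 * ((d : ℝ) + 1) / (β * c₀))
    have h2 : (⌈16 * ((d : ℝ) + 1) / (β * c₀)⌉₊ : ℝ) ≤ b := by rw [hb]; push_cast; linarith
    have h3 : (b : ℝ) ≤ (b : ℝ) ^ d := le_self_pow₀ (by linarith) (by omega)
    exact (div_le_iff₀ (by positivity)).1 (h1.trans (h2.trans h3))
  obtain ⟨κ, hκ, hthr⟩ := exists_threshold hd hβ (b := b) (by omega)
  obtain ⟨T, hT⟩ : ∃ T : ℝ, T = d * (2 * b) + 1 := ⟨_, rfl⟩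
  have hT0 : 0 < T := by rw [hT]; positivity
  -- T is the cost of one exploration step. Two explorations of J steps cost 2 T J, the starting
  -- blocks and the joining edge cost at most 2 T, and log N / log log N ≥ 1 absorbs the rounding in
  -- J and this additive term.
  refine ⟨2 * T * (2 * d + 1) + 2 * T, by positivity, ?_⟩
  have hlim := (tendsto_exp_sub_one d).add (tendsto_pow_mul_exp_neg_log_sq (2 * d) hκ)
  rw [add_zero] at hlim
  refine squeeze_zero' (Eventually.of_forall fun _ => measureReal_nonneg) ?_ hlim
  filter_upwards [hthr, eventually_ge_atTop (2 ^ 23), eventually_ge_atTop b,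
    tendsto_log_natCast.eventually_gt_atTop (Real.exp 1),
    tendsto_log_natCast.eventually_ge_atTop (2 / (β * c₀)),
    tendsto_log_natCast.eventually_ge_atTop (16 * 2 ^ d / (β * c₀)),
    tendsto_log_natCast.eventually_ge_atTop ((16 * 2 ^ d / (β * c₀)) ^ 2)]
    with N hN1 hN2 hN3 hN4 hN5 hN6 hN7
  obtain ⟨r, hr1, hrN, hr4, hS⟩ := exists_scale hd hN2
  obtain ⟨M, hM1, hM2, hM3⟩ := hN1 r hr1 hrN hr4
  rw [← hc₀] at hS
  have hlog : 0 < Real.log N := (Real.exp_pos 1).trans hN4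
  have hβc : 0 < β * c₀ := by positivity
  rw [div_le_iff₀ hβc] at hN5 hN6
  obtain ⟨K, hK⟩ : ∃ K, K = β * (c₀ * Real.log N) / (16 * 2 ^ d) := ⟨_, rfl⟩
  have hK1 : 1 ≤ K := by
    rw [hK, le_div_iff₀ (by positivity)]
    linarith
  have hK2 : Real.log N ≤ K ^ 2 := by
    have h1 : K = Real.log N / (16 * 2 ^ d / (β * c₀)) := by rw [hK]; field_simp
    rw [h1, div_pow, le_div_iff₀ (by positivity), sq (Real.log N)]
    gcongr
  obtain ⟨J, hJ⟩ : ∃ J : ℕ, J = ⌈2 * d * Real.log N / Real.log (Real.log N)⌉₊ := ⟨_, rfl⟩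
  have hKJ : (M : ℝ) ≤ K ^ J :=
    hM2.trans (hJ ▸ pow_le_pow_ceil_log hN4 hK2 (by linarith))
  have hmain := real_lt_D_le_of_expands (s := d) (r := r) hd hd0.le hβ.le hb2 (by omega : b ≤ N + 1) hK1 hKJ
  have hexp := real_not_expands_le hβ (by omega : 1 ≤ b) (by omega : b ≤ N + 1) hr1 hM1 hS (by linarith)
  rw [← hK] at hexp
  have hll : 1 < Real.log (Real.log N) := (Real.lt_log_iff_exp_lt hlog).2 hN4
  have hratio : 1 ≤ Real.log N / Real.log (Real.log N) := by
    rw [one_le_div (by linarith)]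
    exact (Real.log_le_sub_one_of_pos hlog).trans (by linarith)
  have hsub : {ω : Config d N | ω ∈ gridOpen d N ∧
      (2 * T * (2 * d + 1) + 2 * T) * Real.log N / Real.log (Real.log N) < (D ω : ℝ)} ⊆
      {ω | ω ∈ gridOpen d N ∧ 2 * (d * (2 * b) + (d * (2 * b) + 1) * J) + 1 < D ω} := by
    rintro ω ⟨hω, hD⟩
    refine ⟨hω, ?_⟩
    have h1 : (J : ℝ) ≤ (2 * d + 1) * (Real.log N / Real.log (Real.log N)) := by
      have h2 := Nat.ceil_lt_add_one (show 0 ≤ 2 * d * Real.log N / Real.log (Real.log N) by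
        positivity)
      rw [← hJ, mul_div_assoc] at h2
      linarith
    have h3 : ((2 * (d * (2 * b) + (d * (2 * b) + 1) * J) + 1 : ℕ) : ℝ) < D ω := by
      refine lt_of_le_of_lt ?_ hD
      push_cast
      rw [mul_div_assoc]
      have h4 := mul_le_mul_of_nonneg_left h1 hT0.le
      have h5 := mul_le_mul_of_nonneg_left hratio hT0.le
      rw [← hT]
      linarith
    exact_mod_cast h3
  refine (measureReal_mono hsub (measure_ne_top _ _)).trans (hmain.trans (add_le_add
    (hexp.trans ?_) ?_))
  · have h1 : ((d : ℝ) + 1) * Real.log N ≤ (b : ℝ) ^ d * (β * (c₀ * Real.log N)) / 16 := by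
      have := mul_le_mul_of_nonneg_right hbc hlog.le
      linarith
    gcongr
  · gcongr
    linarith

end Critical

end LongRangePercolation

/-! ### Assembly of the regimes -/

theorem theorem1 (d : ℕ) (hd : 1 ≤ d) (s β : ℝ) (hs : 0 < s) (hβ : 0 < β) :
    ∃ C₁ C₂ Cs δ η₁ η₂ : ℝ,
      0 < C₁ ∧ 0 < C₂ ∧ 0 < Cs ∧ 1 < δ ∧ 0 < η₁ ∧ η₁ < η₂ ∧ η₂ < 1 ∧
      -- part 1
      (2 * (d : ℝ) < s → ∀ ψ : ℝ, ψ < (s - 2 * d) / (s - d - 1) →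
        Tendsto (fun N : ℕ => LongRangePercolation.configLaw d N s β
          {ω | (N : ℝ) ^ ψ ≤ (LongRangePercolation.D ω : ℝ)}) atTop (𝓝 1)) ∧
      -- part 2
      (s = 2 * (d : ℝ) →
        Tendsto (fun N : ℕ => LongRangePercolation.configLaw d N s β
          {ω | (LongRangePercolation.D ω : ℝ) ≤ (N : ℝ) ^ η₂}) atTop (𝓝 1)) ∧
      (d = 1 → s = 2 → β < 1 →
        Tendsto (fun N : ℕ => LongRangePercolation.configLaw d N s β
          {ω | (N : ℝ) ^ η₁ ≤ (LongRangePercolation.D ω : ℝ)}) atTop (𝓝 1)) ∧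
      -- part 3
      ((d : ℝ) < s → s < 2 * (d : ℝ) →
        Tendsto (fun N : ℕ => LongRangePercolation.configLaw d N s β
          {ω | Cs * Real.log N ≤ (LongRangePercolation.D ω : ℝ) ∧
            (LongRangePercolation.D ω : ℝ) ≤ Real.log N ^ δ}) atTop (𝓝 1)) ∧
      -- part 4
      (s = (d : ℝ) →
        Tendsto (fun N : ℕ => LongRangePercolation.configLaw d N s β
          {ω | C₁ * Real.log N / Real.log (Real.log N) ≤ (LongRangePercolation.D ω : ℝ) ∧
            (LongRangePercolation.D ω : ℝ) ≤ C₂ * Real.log N / Real.log (Real.log N)})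
          atTop (𝓝 1)) := by
  have hunion : ∀ {A B : ∀ N : ℕ, Set (LongRangePercolation.Config d N)},
      Tendsto (fun N => (LongRangePercolation.configLaw d N s β).real (A N)) atTop (𝓝 0) →
      Tendsto (fun N => (LongRangePercolation.configLaw d N s β).real (B N)) atTop (𝓝 0) →
      Tendsto (fun N => (LongRangePercolation.configLaw d N s β).real (A N ∪ B N))
        atTop (𝓝 0) := by
    intro A B hA hB
    have h := hA.add hB
    rw [add_zero] at h
    exact squeeze_zero (fun _ => measureReal_nonneg) (fun _ => measureReal_union_le _ _) h
  -- The constants precede the assumptions that distinguish the regimes, so in each regime that does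
  -- not apply an arbitrary admissible value is supplied.
  have hlower : ∃ C : ℝ, 0 < C ∧ ((d : ℝ) < s → Tendsto (fun N : ℕ =>
      (LongRangePercolation.configLaw d N s β).real {ω | ω ∈ LongRangePercolation.gridOpen d N ∧
        (LongRangePercolation.D ω : ℝ) < C * Real.log N}) atTop (𝓝 0)) := by
    by_cases h : (d : ℝ) < s
    · obtain ⟨C, hC, h1⟩ := LongRangePercolation.tendsto_D_lt_log hd hβ h
      exact ⟨C, hC, fun _ => h1⟩
    · exact ⟨1, one_pos, fun h' => absurd h' h⟩
  have hupper : ∃ δ : ℝ, 1 < δ ∧ ((d : ℝ) < s → s < 2 * (d : ℝ) → Tendsto (fun N : ℕ =>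
      (LongRangePercolation.configLaw d N s β).real {ω | ω ∈ LongRangePercolation.gridOpen d N ∧
        Real.log N ^ δ < (LongRangePercolation.D ω : ℝ)}) atTop (𝓝 0)) := by
    by_cases h : (d : ℝ) < s ∧ s < 2 * (d : ℝ)
    · obtain ⟨δ, hδ, h1⟩ := LongRangePercolation.tendsto_log_rpow_lt_D hd hβ h.1 h.2
      exact ⟨δ, hδ, fun _ _ => h1⟩
    · exact ⟨2, one_lt_two, fun h1 h2 => absurd ⟨h1, h2⟩ h⟩
  have hcrit : ∃ C₁ C₂ : ℝ, 0 < C₁ ∧ 0 < C₂ ∧ (s = (d : ℝ) →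
      Tendsto (fun N : ℕ => (LongRangePercolation.configLaw d N s β).real
        {ω | ω ∈ LongRangePercolation.gridOpen d N ∧
          (LongRangePercolation.D ω : ℝ) < C₁ * Real.log N / Real.log (Real.log N)})
        atTop (𝓝 0) ∧
      Tendsto (fun N : ℕ => (LongRangePercolation.configLaw d N s β).real
        {ω | ω ∈ LongRangePercolation.gridOpen d N ∧
          C₂ * Real.log N / Real.log (Real.log N) < (LongRangePercolation.D ω : ℝ)})
        atTop (𝓝 0)) := by
    by_cases h : s = (d : ℝ)
    · obtain ⟨C₁, hC₁, h1⟩ := LongRangePercolation.tendsto_D_lt_log_div_log_log hd hβ h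
      obtain ⟨C₂, hC₂, h2⟩ := LongRangePercolation.tendsto_log_div_log_log_lt_D hd hβ h
      exact ⟨C₁, C₂, hC₁, hC₂, fun _ => ⟨h1, h2⟩⟩
    · exact ⟨1, 1, one_pos, one_pos, fun h' => absurd h' h⟩
  have hpow : ∃ η : ℝ, 0 < η ∧ η < 1 ∧ (s = 2 * (d : ℝ) → Tendsto (fun N : ℕ =>
      (LongRangePercolation.configLaw d N s β).real {ω | ω ∈ LongRangePercolation.gridOpen d N ∧
        (N : ℝ) ^ η < (LongRangePercolation.D ω : ℝ)}) atTop (𝓝 0)) := by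
    by_cases h : s = 2 * (d : ℝ)
    · obtain ⟨η, h0, h1, h2⟩ := LongRangePercolation.tendsto_rpow_lt_D hd hβ h
      exact ⟨η, h0, h1, fun _ => h2⟩
    · exact ⟨1 / 2, by norm_num, by norm_num, fun h' => absurd h' h⟩
  obtain ⟨Cs, hCs, hCs'⟩ := hlower
  obtain ⟨δ, hδ, hδ'⟩ := hupper
  obtain ⟨C₁, C₂, hC₁, hC₂, hC⟩ := hcrit
  obtain ⟨η₂, hη₂, hη₂1, hη₂'⟩ := hpow
  -- The exponent (1 - β) / 2 is lowered if necessary to lie below η₂; a smaller exponent only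
  -- weakens the lower bound.
  obtain ⟨η₁, hη₁, hη₁₂, hη₁β⟩ : ∃ η₁ : ℝ, 0 < η₁ ∧ η₁ < η₂ ∧ (β < 1 → η₁ ≤ (1 - β) / 2) := by
    by_cases h : β < 1
    · exact ⟨min (η₂ / 2) ((1 - β) / 2), lt_min (by linarith) (by linarith),
        (min_le_left _ _).trans_lt (by linarith), fun _ => min_le_right _ _⟩
    · exact ⟨η₂ / 2, by linarith, by linarith, fun h' => absurd h' h⟩
  refine ⟨C₁, C₂, Cs, δ, η₁, η₂, hC₁, hC₂, hCs, hδ, hη₁, hη₁₂, hη₂1, ?_, ?_, ?_, ?_, ?_⟩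
  · intro hsd ψ hψ
    refine LongRangePercolation.tendsto_one_of_bad _ _ (Eventually.of_forall fun N ω hω hB => ?_)
      (LongRangePercolation.tendsto_D_lt_rpow hd hβ hsd hψ)
    exact not_lt.1 fun h => hB ⟨hω, h⟩
  · intro hsd
    refine LongRangePercolation.tendsto_one_of_bad _ _ (Eventually.of_forall fun N ω hω hB => ?_)
      (hη₂' hsd)
    exact not_lt.1 fun h => hB ⟨hω, h⟩
  · intro hd1 hs2 hβ1
    subst hd1 hs2
    refine LongRangePercolation.tendsto_one_of_bad _ _ ?_
      (LongRangePercolation.tendsto_D_lt_rpow_of_lt_one hβ hβ1)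
    filter_upwards [eventually_ge_atTop 1] with N hN ω hω hB
    have h1 : (N : ℝ) ^ η₁ ≤ (N : ℝ) ^ ((1 - β) / 2) :=
      Real.rpow_le_rpow_of_exponent_le (by exact_mod_cast hN) (hη₁β hβ1)
    exact h1.trans (not_lt.1 fun h => hB ⟨hω, h⟩)
  · intro h1 h2
    refine LongRangePercolation.tendsto_one_of_bad _ _ (Eventually.of_forall fun N ω hω hB => ?_)
      (hunion (hCs' h1) (hδ' h1 h2))
    exact ⟨not_lt.1 fun h => hB (Or.inl ⟨hω, h⟩), not_lt.1 fun h => hB (Or.inr ⟨hω, h⟩)⟩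
  · intro h1
    refine LongRangePercolation.tendsto_one_of_bad _ _ (Eventually.of_forall fun N ω hω hB => ?_)
      (hunion (hC h1).1 (hC h1).2)
    exact ⟨not_lt.1 fun h => hB (Or.inl ⟨hω, h⟩), not_lt.1 fun h => hB (Or.inr ⟨hω, h⟩)⟩
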